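/- Notation. $\Lambda$ is the ring of symmetric functions with complex coefficients in $x_1,x_2,\dots$ (formal infinite sums of symmetric functions of increasing degrees are allowed), with complete homogeneous, elementary and power sum functions $h_n,e_n,p_n$, $p_\lambda=\prod_i p_{\lambda_i}$, and $\omega$ the involution with $\omega(p_k)=(-1)^{k-1}p_k$ (so $\omega(h_n)=e_n$). $f[g]$ denotes plethysm: if $f=P(p_1,p_2,\dots)$ and $g$ has no constant term, then $f[g]=P(p_1[g],p_2[g],\dots)$ with $p_k[g]=g(x_1^k,x_2^k,\dots)$. The Frobenius characteristic of a representation $V$ of $S_n$ is $\mathrm{ch}\,V=\frac1{n!}\sum_{\sigma\in S_n}\chi_V(\sigma)\,p_{\mathrm{type}(\sigma)}$. Put $H=\sum_{r\ge0}h_r$, $E=\sum_{r\ge0}e_r$, $H^{\pm}=\sum_{r\ge0}(-1)^rh_r$. For a sequence $Q=(q_n)_{n\ge1}$ of symmetric functions, $q_n$ homogeneous of degree $n$, write also $Q=\sum_{n\ge1}q_n$, and for a partition $\lambda$ with $m_i$ parts equal to $i$ and length $\ell(\lambda)$ put $$H_\lambda[Q]=\prod_{i:m_i\ge1}h_{m_i}[q_i],\qquad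 E_\lambda[Q]=\prod_{i:m_i\ge1}e_{m_i}[q_i],$$ $$H[Q](t)=\sum_\lambda t^{|\lambda|}H_\lambda[Q],\qquad E[Q](t)=\sum_\lambda t^{|\lambda|}E_\lambda[Q],\qquad H^\pm[Q](t)=\sum_\lambda t^{|\lambda|}(-1)^{\ell(\lambda)}H_\lambda[Q],$$ the sums being over all partitions, including the empty one. Let $Q^{\omega}$ be the sequence $((-1)^{n-1}\omega(q_n))_{n\ge1}$. Let $C_n\subset S_n$ be generated by an $n$-cycle. Let $Lie_n$ be the Frobenius characteristic of the representation of $S_n$ induced from the character of $C_n$ that sends the generator to $\exp(2\pi i/n)$, and $Lie_n^{(2)}$ that of the representation induced from the character that sends the generator to $\exp(2\pi i\cdot 2^{k_n}/n)$, where $2^{k_n}$ is the largest power of $2$ that divides $n$. Let $Lie=\sum_{n\ge1}Lie_n$ and $Lie^{(2)}=\sum_{n\ge1}Lie^{(2)}_n$. **Theorem.** (A) The following identities hold for $Lie$. 1. $\sum_{\lambda\vdash n}H_\lambda[Lie]=p_1^n$ for all $n\ge0$. 2. $H\big[\sum_{n\ge1}(-1)^{n-1}\omega(Lie_n)\big]=1+p_1$.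 3. $\sum_{\lambda\vdash n}(-1)^{n-\ell(\lambda)}E_\lambda[Lie]=0$ for all $n\ge2$. 4. $\sum_{\lambda\vdash n}E_\lambda[Lie]=2e_2p_1^{n-2}$ for all $n\ge2$. (B) The following identities hold for $Lie^{(2)}$. 1. For all $n\ge0$, $\sum_{\lambda\vdash n}E_\lambda[Lie^{(2)}]=p_1^n$. Here $p_1^n$ is the Frobenius characteristic of the regular representation of $S_n$, so the sum is a decomposition of the regular representation. In other forms: $E[Lie^{(2)}]=(1-p_1)^{-1}$; $E[Lie^{(2)}](t)=(1-tp_1)^{-1}$; $H^{\pm}[Lie^{(2)}]=1-p_1$; $H^{\pm}[Lie^{(2)}](t)=1-tp_1$. 2. $E\big[\sum_{n\ge1}(-1)^{n-1}\omega(Lie^{(2)}_n)\big]=1+p_1$; $E[(Lie^{(2)})^{\omega}](t)=1+tp_1$; that is, $\sum_{n\ge1}e_n$ and $\sum_{n\ge1}(-1)^{n-1}\omega(Lie^{(2)}_n)$ are (two-sided) plethystic inverses of each other. 3. $\sum_{\lambda\vdash n}(-1)^{n-\ell(\lambda)}H_\lambda[Lie^{(2)}]=0$ for all $n\ge2$.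 4. For all $n\ge0$, $\sum_{\lambda\vdash n}H_\lambda[Lie^{(2)}]=\sum p_\lambda$, the sum on the right being over the partitions $\lambda$ of $n$ all of whose parts are powers of $2$ (including $1=2^0$); and $H[Lie^{(2)}](t)=\prod_{k\ge0}(1-t^{2^k}p_{2^k})^{-1}$. 5. For all $n\ge0$, $\sum_{\lambda\vdash n}(-1)^{n-\ell(\lambda)}\omega(E_\lambda[Lie^{(2)}])=\sum_{\lambda\vdash n}H_\lambda[(Lie^{(2)})^{\omega}]=\sum p_\lambda$, the last sum being over the partitions $\lambda$ of $n$ into distinct parts that are powers of $2$; and $H[(Lie^{(2)})^{\omega}](t)=\prod_{k\ge0}(1+t^{2^k}p_{2^k})$. (C) The identities in (A) are equivalent to each other, and so are the identities in (B), in the following sense. Let $F=(f_n)_{n\ge1}$ be any sequence of symmetric functions, $f_n$ homogeneous of degree $n$, with $f_1=p_1$. Then the four statements of (A) with $F$ in place of $Lie$ are equivalent to each other, and all the statements of (B), in each of the forms listed (in (B5), that the first sum equals the third, that the second sum equals the third, and the product formula), with $F$ in place of $Lie^{(2)}$, are equivalent to each other. -/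

import Mathlib

open scoped BigOperators MvPowerSeries.WithPiTopology PowerSeries.WithPiTopology

namespace PlethLie

noncomputable section

/-! ### Symmetric functions -/

/-- Formal power series of arbitrary degree in countably many variables `x₀, x₁, x₂, …` over `ℂ`.
Formal series of symmetric functions are the symmetric elements of this ring. -/
abbrev Ser : Type := MvPowerSeries ℕ ℂ

/-- `f` is invariant under every permutation of the variables. -/
def IsSymmSeries (f : Ser) : Prop :=
  ∀ (σ : Equiv.Perm ℕ) (d : ℕ →₀ ℕ),
    MvPowerSeries.coeff (d.mapDomain σ) f = MvPowerSeries.coeff d f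

/-- The power sum `p_k = ∑ᵢ xᵢ^k`, for `k ≥ 1`. -/
def psum (k : ℕ) : Ser := fun d => open Classical in
  if ∃ i, d = Finsupp.single i k then 1 else 0

/-- The complete homogeneous symmetric function `h_n`, the sum of all monomials of degree `n`. -/
def hsymm (n : ℕ) : Ser := fun d => if d.degree = n then 1 else 0

/-- The elementary symmetric function `e_n`, the sum of all squarefree monomials of degree `n`. -/
def esymm (n : ℕ) : Ser := fun d => open Classical in
  if d.degree = n ∧ ∀ i, d i ≤ 1 then 1 else 0

/-- `p_μ = ∏ᵢ p_{μᵢ}` for a partition `μ`. -/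
def psumPart {n : ℕ} (μ : n.Partition) : Ser := (μ.parts.map psum).prod

/-- `∑_{n ≥ 0} q n` for a sequence of series such that `q n` is homogeneous of degree `n`. -/
def sumAll (q : ℕ → Ser) : Ser := fun d => MvPowerSeries.coeff d (q d.degree)

/-- `∑_{n ≥ 1} q n` for a sequence of series such that `q n` is homogeneous of degree `n` for
`n ≥ 1`; the value `q 0` is ignored. -/
def sumPos (q : ℕ → Ser) : Ser := sumAll fun n => if n = 0 then 0 else q n

/-! ### Plethysm -/

/-- The value at `P` of the substitution of the power sums for the indeterminates: the series
`P(p₁, p₂, p₃, …)`. -/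
def evalPsum (P : MvPowerSeries ℕ+ ℂ) : Ser :=
  MvPowerSeries.subst (fun k : ℕ+ => psum k) P

/-! Existence and uniqueness of the expression in power sums. -/

/-- The multiset of the nonzero exponents of a monomial. -/
def vals (e : ℕ →₀ ℕ) : Multiset ℕ := e.support.val.map e

/-- The product of the `p_k` over the members `k` of a multiset. -/
def psumMul (s : Multiset ℕ) : Ser := (s.map psum).prod

theorem coeff_psum (k : ℕ) (d : ℕ →₀ ℕ) : MvPowerSeries.coeff d (psum k) =
    open Classical in if ∃ i, d = Finsupp.single i k then 1 else 0 := rfl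

theorem vals_single_add {b : ℕ →₀ ℕ} {i k : ℕ} (hk : k ≠ 0) (hi : b i = 0) :
    vals (Finsupp.single i k + b) = k ::ₘ vals b := by
  have hd : Disjoint (Finsupp.single i k).support b.support := by
    rw [Finsupp.support_single i hk]; simpa using hi
  have hs : (Finsupp.single i k + b).support = insert i b.support := by
    rw [Finsupp.support_add_eq hd, Finsupp.support_single i hk]; rfl
  have hni : i ∉ b.support := by simpa using hi
  unfold vals
  rw [hs, Finset.insert_val_of_notMem hni, Multiset.map_cons]
  simp only [Finsupp.add_apply, Finsupp.single_eq_same, hi, add_zero]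
  congr 1
  apply Multiset.map_congr rfl
  intro x hx
  have : x ≠ i := by rintro rfl; exact hni hx
  simp [this.symm]

theorem vals_erase {e : ℕ →₀ ℕ} {k : ℕ} {t : Multiset ℕ} (h : vals e = k ::ₘ t) :
    ∃ i b, b i = 0 ∧ k ≠ 0 ∧ e = Finsupp.single i k + b ∧ vals b = t := by
  have hk : k ∈ vals e := by rw [h]; exact Multiset.mem_cons_self _ _
  obtain ⟨i, hi, hik⟩ := Multiset.mem_map.1 hk
  have hi' : e i ≠ 0 := by simpa using hi
  have he : e = Finsupp.single i k + e.erase i := by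
    rw [← hik, Finsupp.single_add_erase]
  have h0 : e.erase i i = 0 := by simp
  refine ⟨i, e.erase i, h0, hik ▸ hi', he, ?_⟩
  rw [he, vals_single_add (hik ▸ hi') h0] at h
  exact (Multiset.cons_inj_right k).1 h

theorem exists_vals (s : Multiset ℕ) (hs : ∀ k ∈ s, k ≠ 0) : ∃ e, vals e = s := by
  induction s using Multiset.induction with
  | empty => exact ⟨0, by simp [vals]⟩
  | cons k t ih =>
    obtain ⟨e, he⟩ := ih fun k hk => hs k (Multiset.mem_cons_of_mem hk)
    obtain ⟨i, hi⟩ := Infinite.exists_notMem_finset e.support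
    exact ⟨Finsupp.single i k + e, by
      rw [vals_single_add (hs k (Multiset.mem_cons_self _ _)) (by simpa using hi), he]⟩

theorem exists_perm_of_vals_eq (s : Multiset ℕ) : ∀ e e' : ℕ →₀ ℕ, vals e = s → vals e' = s →
    ∃ σ : Equiv.Perm ℕ, e.mapDomain σ = e' := by
  induction s using Multiset.induction with
  | empty =>
    intro e e' h h'
    have aux : ∀ e : ℕ →₀ ℕ, vals e = 0 → e = 0 := fun e h => by
      simpa [vals] using h
    exact ⟨1, by rw [aux e h, aux e' h', Finsupp.mapDomain_zero]⟩
  | cons k t ih =>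
    intro e e' h h'
    obtain ⟨i, b, hb, hk, rfl, hbt⟩ := vals_erase h
    obtain ⟨j, b', hb', -, rfl, hbt'⟩ := vals_erase h'
    obtain ⟨σ, hσ⟩ := ih b b' hbt hbt'
    have hσi : b' (σ i) = 0 := by
      rw [← hσ, Finsupp.mapDomain_apply σ.injective, hb]
    refine ⟨σ.trans (Equiv.swap (σ i) j), ?_⟩
    rw [Finsupp.mapDomain_add, Finsupp.mapDomain_single]
    congr 1
    · simp
    · rw [Equiv.coe_trans, Finsupp.mapDomain_comp, hσ]
      ext x
      obtain ⟨y, rfl⟩ := (Equiv.swap (σ i) j).surjective x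
      rw [Finsupp.mapDomain_apply (Equiv.injective _)]
      rcases eq_or_ne y (σ i) with rfl | h1
      · rw [Equiv.swap_apply_left, hσi, hb']
      · rcases eq_or_ne y j with rfl | h2
        · rw [Equiv.swap_apply_right, hσi, hb']
        · rw [Equiv.swap_apply_of_ne_of_ne h1 h2]

theorem IsSymmSeries.mul {f g : Ser} (hf : IsSymmSeries f) (hg : IsSymmSeries g) :
    IsSymmSeries (f * g) := by
  classical
  intro σ d
  rw [MvPowerSeries.coeff_mul, MvPowerSeries.coeff_mul]
  symm
  refine Finset.sum_nbij' (fun p => (p.1.mapDomain σ, p.2.mapDomain σ))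
    (fun p => (p.1.mapDomain σ.symm, p.2.mapDomain σ.symm)) ?_ ?_ ?_ ?_ ?_
  · intro p hp
    rw [Finset.HasAntidiagonal.mem_antidiagonal] at hp ⊢
    rw [← hp, Finsupp.mapDomain_add]
  · intro p hp
    rw [Finset.HasAntidiagonal.mem_antidiagonal] at hp ⊢
    rw [← Finsupp.mapDomain_add, hp, ← Finsupp.mapDomain_comp]
    simp [Finsupp.mapDomain_id]
  · intro p _
    simp [← Finsupp.mapDomain_comp, Finsupp.mapDomain_id]
  · intro p _
    simp [← Finsupp.mapDomain_comp, Finsupp.mapDomain_id]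
  · intro p _
    rw [hf σ, hg σ]

theorem isSymmSeries_psum (k : ℕ) : IsSymmSeries (psum k) := by
  classical
  intro σ d
  rw [coeff_psum, coeff_psum]
  congr 1
  apply propext
  constructor
  · rintro ⟨i, hi⟩
    refine ⟨σ.symm i, Finsupp.mapDomain_injective σ.injective ?_⟩
    rw [hi, Finsupp.mapDomain_single]; simp
  · rintro ⟨i, rfl⟩
    exact ⟨σ i, Finsupp.mapDomain_single⟩

theorem isSymmSeries_psumMul (s : Multiset ℕ) : IsSymmSeries (psumMul s) := by
  induction s using Multiset.induction with
  | empty =>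
    intro σ d
    classical
    simp only [psumMul, Multiset.map_zero, Multiset.prod_zero, MvPowerSeries.coeff_one]
    congr 1
    apply propext
    exact ⟨fun h => Finsupp.mapDomain_injective σ.injective (by rw [h, Finsupp.mapDomain_zero]),
      fun h => by rw [h, Finsupp.mapDomain_zero]⟩
  | cons k t ih =>
    simpa [psumMul] using (isSymmSeries_psum k).mul ih

/-- A monomial that occurs in `p_s` has at most as many variables as `s` has members, with
equality only if its exponents are the members of `s`. -/
theorem coeff_psumMul_ne_zero (s : Multiset ℕ) : ∀ e : ℕ →₀ ℕ,
    MvPowerSeries.coeff e (psumMul s) ≠ 0 → (∀ k ∈ s, k ≠ 0) →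
      (vals e).card ≤ s.card ∧ (vals e).sum = s.sum ∧ ((vals e).card = s.card → vals e = s) := by
  classical
  induction s using Multiset.induction with
  | empty =>
    intro e he _
    have : e = 0 := by
      by_contra h
      exact he (by simp [psumMul, MvPowerSeries.coeff_one, h])
    subst this
    simp [vals]
  | cons k t ih =>
    intro e he hs
    have hk : k ≠ 0 := hs k (Multiset.mem_cons_self _ _)
    rw [psumMul, Multiset.map_cons, Multiset.prod_cons, MvPowerSeries.coeff_mul] at he
    obtain ⟨⟨a, b⟩, hab, hne⟩ := Finset.exists_ne_zero_of_sum_ne_zero he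
    rw [Finset.HasAntidiagonal.mem_antidiagonal] at hab
    obtain ⟨i, rfl⟩ : ∃ i, a = Finsupp.single i k := by
      by_contra h
      exact hne (by rw [coeff_psum, if_neg h, zero_mul])
    simp only at hab
    subst hab
    obtain ⟨h1, h2, h3⟩ := ih b (right_ne_zero_of_mul hne)
      fun k hk => hs k (Multiset.mem_cons_of_mem hk)
    by_cases hi : b i = 0
    · rw [vals_single_add hk hi]
      simp only [Multiset.card_cons, Multiset.sum_cons]
      exact ⟨by omega, by omega, fun h => by rw [h3 (by omega)]⟩
    · have e1 : b = Finsupp.single i (b i) + b.erase i := (Finsupp.single_add_erase i b).symm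
      have h0 : b.erase i i = 0 := by simp
      have e2 : Finsupp.single i k + b = Finsupp.single i (k + b i) + b.erase i := by
        conv_lhs => rw [e1, ← add_assoc, ← Finsupp.single_add]
      have v1 : vals b = b i ::ₘ vals (b.erase i) := by
        conv_lhs => rw [e1]
        exact vals_single_add hi h0
      have v2 := vals_single_add (k := k + b i) (by omega) h0
      rw [← e2] at v2
      rw [v1] at h1 h2
      rw [v2]
      simp only [Multiset.card_cons, Multiset.sum_cons] at h1 h2 ⊢
      exact ⟨by omega, by omega, fun h => by omega⟩

open scoped ComplexOrder in
theorem coeff_psumMul_nonneg (s : Multiset ℕ) (e : ℕ →₀ ℕ) :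
    0 ≤ MvPowerSeries.coeff e (psumMul s) := by
  classical
  induction s using Multiset.induction generalizing e with
  | empty =>
    simp only [psumMul, Multiset.map_zero, Multiset.prod_zero, MvPowerSeries.coeff_one]
    split_ifs <;> simp
  | cons k t ih =>
    rw [psumMul, Multiset.map_cons, Multiset.prod_cons, MvPowerSeries.coeff_mul]
    refine Finset.sum_nonneg fun p _ => mul_nonneg ?_ (ih _)
    rw [coeff_psum]
    split_ifs <;> simp

open scoped ComplexOrder in
theorem coeff_psumMul_vals (s : Multiset ℕ) : ∀ e : ℕ →₀ ℕ, vals e = s →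
    MvPowerSeries.coeff e (psumMul s) ≠ 0 := by
  classical
  induction s using Multiset.induction with
  | empty =>
    intro e he
    have : e = 0 := by simpa [vals] using he
    subst this
    simp [psumMul]
  | cons k t ih =>
    intro e he
    obtain ⟨i, b, hb, hk, rfl, hbt⟩ := vals_erase he
    rw [psumMul, Multiset.map_cons, Multiset.prod_cons, MvPowerSeries.coeff_mul]
    intro h
    rw [Finset.sum_eq_zero_iff_of_nonneg] at h
    · have := h (Finsupp.single i k, b) (by simp)
      simp only [coeff_psum] at this
      rw [if_pos ⟨i, rfl⟩, one_mul] at this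
      exact ih b hbt this
    · intro p _
      refine mul_nonneg ?_ (coeff_psumMul_nonneg t _)
      rw [coeff_psum]
      split_ifs <;> simp

theorem hasSubst_psum : MvPowerSeries.HasSubst (fun k : ℕ+ => psum k) where
  const_coeff k := by
    rw [← MvPowerSeries.coeff_zero_eq_constantCoeff_apply, coeff_psum, if_neg]
    · exact IsNilpotent.zero
    · rintro ⟨i, hi⟩
      exact k.ne_zero (Finsupp.single_eq_zero.1 hi.symm)
  coeff_zero d := by
    refine Set.Finite.subset (Set.finite_le_nat d.degree |>.preimage
      (f := fun k : ℕ+ => (k : ℕ)) PNat.coe_injective.injOn) ?_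
    intro k hk
    by_contra h
    apply hk
    change MvPowerSeries.coeff d (psum k) = 0
    rw [coeff_psum, if_neg]
    rintro ⟨i, rfl⟩
    exact h (by simp)

/-- The multiset of positive integers of a monomial in the power sums. -/
def toMul (d : ℕ+ →₀ ℕ) : Multiset ℕ := (Finsupp.toMultiset d).map fun k : ℕ+ => (k : ℕ)

theorem toMul_injective : Function.Injective toMul :=
  (Multiset.map_injective PNat.coe_injective).comp (AddEquiv.injective Multiset.toFinsupp.symm)

theorem toMul_ne_zero (d : ℕ+ →₀ ℕ) : ∀ k ∈ toMul d, k ≠ 0 := by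
  intro k hk
  obtain ⟨k, -, rfl⟩ := Multiset.mem_map.1 hk
  exact k.ne_zero

theorem exists_toMul (s : Multiset ℕ) (hs : ∀ k ∈ s, k ≠ 0) : ∃ d, toMul d = s := by
  refine ⟨Multiset.toFinsupp (s.attach.map fun k => Nat.toPNat k.1 (Nat.pos_of_ne_zero (hs _ k.2))), ?_⟩
  rw [toMul, Multiset.toFinsupp_toMultiset, Multiset.map_map]
  exact Multiset.attach_map_val s

theorem prod_psum_eq (d : ℕ+ →₀ ℕ) :
    (d.prod fun k n => psum k ^ n) = psumMul (toMul d) := by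
  rw [psumMul, toMul, Multiset.map_map, Finsupp.toMultiset_map, Finsupp.prod_toMultiset,
    Finsupp.prod_mapDomain_index (fun _ => pow_zero _) (fun _ _ _ => pow_add _ _ _)]
  rfl

theorem coeff_evalPsum (P : MvPowerSeries ℕ+ ℂ) (e : ℕ →₀ ℕ) :
    MvPowerSeries.coeff e (evalPsum P) =
      ∑ᶠ d, MvPowerSeries.coeff d P * MvPowerSeries.coeff e (psumMul (toMul d)) := by
  rw [evalPsum, MvPowerSeries.coeff_subst hasSubst_psum]
  simp_rw [prod_psum_eq, smul_eq_mul]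

theorem isSymmSeries_evalPsum (P : MvPowerSeries ℕ+ ℂ) : IsSymmSeries (evalPsum P) := by
  intro σ e
  simp_rw [coeff_evalPsum, isSymmSeries_psumMul _ σ e]

/-- The excess of the size of a partition over its length. -/
def excess (d : ℕ+ →₀ ℕ) : ℕ := (toMul d).sum - (toMul d).card

theorem card_le_sum {s : Multiset ℕ} (hs : ∀ k ∈ s, k ≠ 0) : s.card ≤ s.sum := by
  simpa using Multiset.card_nsmul_le_sum (a := 1) (fun x hx => Nat.pos_of_ne_zero (hs x hx))

theorem excess_lt {d d' : ℕ+ →₀ ℕ} {e : ℕ →₀ ℕ} (he : vals e = toMul d)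
    (h : MvPowerSeries.coeff e (psumMul (toMul d')) ≠ 0) (hne : d' ≠ d) :
    excess d' < excess d := by
  obtain ⟨h1, h2, h3⟩ := coeff_psumMul_ne_zero _ e h (toMul_ne_zero d')
  rw [he] at h1 h2 h3
  have h4 : (toMul d).card ≠ (toMul d').card := fun h => hne (toMul_injective (h3 h).symm)
  have := card_le_sum (toMul_ne_zero d')
  unfold excess
  omega

/-- The power sums are algebraically independent, also for infinite series. -/
theorem evalPsum_injective : Function.Injective evalPsum := by
  intro P Q hPQ
  ext d
  induction hm : excess d using Nat.strong_induction_on generalizing d with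
  | _ m ih =>
    subst hm
    obtain ⟨e, he⟩ := exists_vals (toMul d) (toMul_ne_zero d)
    have key : ∀ R : MvPowerSeries ℕ+ ℂ, (fun d' => MvPowerSeries.coeff d' R *
        MvPowerSeries.coeff e (psumMul (toMul d'))).HasFiniteSupport := fun R => by
      simpa only [prod_psum_eq, smul_eq_mul] using
        MvPowerSeries.coeff_subst_finite hasSubst_psum R e
    have h := congrArg (MvPowerSeries.coeff e) hPQ
    rw [coeff_evalPsum, coeff_evalPsum, ← sub_eq_zero, ← finsum_sub_distrib (key P) (key Q),
      finsum_eq_single _ d, ← sub_mul] at h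
    · exact sub_eq_zero.1 ((mul_eq_zero.1 h).resolve_right (coeff_psumMul_vals _ e he))
    · intro d' hd'
      by_cases h0 : MvPowerSeries.coeff e (psumMul (toMul d')) = 0
      · simp [h0]
      · rw [ih _ (excess_lt he h0 hd') d' rfl, sub_self]

/-- Every symmetric series is a series in the power sums. -/
theorem evalPsum_surjective {f : Ser} (hf : IsSymmSeries f) : ∃ P, evalPsum P = f := by
  choose e he using fun d : ℕ+ →₀ ℕ => exists_vals (toMul d) (toMul_ne_zero d)
  let c (d d' : ℕ+ →₀ ℕ) : ℂ := MvPowerSeries.coeff (e d) (psumMul (toMul d'))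
  have hc : ∀ d, c d d ≠ 0 := fun d => coeff_psumMul_vals _ _ (he d)
  let wf : WellFounded fun d d' : ℕ+ →₀ ℕ => excess d < excess d' :=
    (measure excess).wf
  let P : MvPowerSeries ℕ+ ℂ := wf.fix fun d rec =>
    (MvPowerSeries.coeff (e d) f -
      ∑ᶠ d', if h : excess d' < excess d then rec d' h * c d d' else 0) / c d d
  have hP : ∀ d, P d = (MvPowerSeries.coeff (e d) f -
      ∑ᶠ d', if excess d' < excess d then P d' * c d d' else 0) / c d d := by
    intro d
    have := wf.fix_eq (fun d rec => (MvPowerSeries.coeff (e d) f -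
      ∑ᶠ d', if h : excess d' < excess d then rec d' h * c d d' else 0) / c d d) d
    simpa only [dite_eq_ite] using this
  refine ⟨P, ?_⟩
  have main : ∀ d, MvPowerSeries.coeff (e d) (evalPsum P) = MvPowerSeries.coeff (e d) f := by
    intro d
    have fin : (fun d' => P d' * c d d').HasFiniteSupport := by
      have := MvPowerSeries.coeff_subst_finite hasSubst_psum P (e d)
      simp only [prod_psum_eq, smul_eq_mul] at this
      exact this
    have split : (fun d' => P d' * c d d') = fun d' =>
        (if excess d' < excess d then P d' * c d d' else 0) +
          (if d' = d then P d * c d d else 0) := by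
      funext d'
      rcases eq_or_ne d' d with rfl | hne
      · simp
      · by_cases h0 : c d d' = 0
        · simp [h0, hne]
        · simp [excess_lt (he d) h0 hne, hne]
    have f1 : (fun d' => if excess d' < excess d then P d' * c d d' else 0).HasFiniteSupport := by
      refine Set.Finite.subset fin ?_
      intro d' hd' h0
      apply hd'
      simp only at h0 ⊢
      rw [h0, ite_self]
    have f2 : (fun d' => if d' = d then P d * c d d else 0).HasFiniteSupport := by
      refine Set.Finite.subset (Set.finite_singleton d) ?_
      intro d' hd'
      by_contra h
      exact hd' (if_neg h)
    rw [coeff_evalPsum]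
    change ∑ᶠ d', P d' * c d d' = _
    rw [split, finsum_add_distrib f1 f2, finsum_eq_single _ d (fun d' h => if_neg h), if_pos rfl,
      hP d, div_mul_cancel₀ _ (hc d)]
    ring
  ext x
  obtain ⟨d, hd⟩ := exists_toMul (vals x) (by
    intro k hk
    obtain ⟨i, hi, rfl⟩ := Multiset.mem_map.1 hk
    simpa using hi)
  obtain ⟨σ, hσ⟩ := exists_perm_of_vals_eq (vals x) (e d) x ((he d).trans hd) rfl
  rw [← hσ, isSymmSeries_evalPsum P σ, hf σ, main]

/-- The expression of `f` as a series in the power sums: the series `P` with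
`f = P(p₁, p₂, p₃, …)`. It exists and is unique for every symmetric `f`, see
`evalPsum_injective`, `evalPsum_surjective`, `evalPsum_psumExpr`. -/
def psumExpr (f : Ser) : MvPowerSeries ℕ+ ℂ := Function.invFun evalPsum f

theorem evalPsum_psumExpr {f : Ser} (hf : IsSymmSeries f) : evalPsum (psumExpr f) = f :=
  Function.invFun_eq (evalPsum_surjective hf)

theorem psumExpr_evalPsum (P : MvPowerSeries ℕ+ ℂ) : psumExpr (evalPsum P) = P :=
  Function.leftInverse_invFun evalPsum_injective P

/-- `p_k[g] = g(x₀^k, x₁^k, x₂^k, …)`. -/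
def psumPleth (k : ℕ+) (g : Ser) : Ser := MvPowerSeries.expand (k : ℕ) k.ne_zero g

/-- The plethysm `f[g]`, for a symmetric `f` and a series `g` without constant term: if
`f = P(p₁, p₂, …)`, then `f[g] = P(p₁[g], p₂[g], …)`. -/
def pleth (f g : Ser) : Ser :=
  MvPowerSeries.subst (fun k : ℕ+ => psumPleth k g) (psumExpr f)

/-- The involution `ω`, determined by `ω(p_k) = (-1)^(k-1) p_k`. -/
def omega (f : Ser) : Ser :=
  MvPowerSeries.subst (fun k : ℕ+ => (-1 : ℂ) ^ ((k : ℕ) - 1) • psum k) (psumExpr f)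

/-- `f` and `g` are inverse to each other for plethysm. -/
def IsPlethInverse (f g : Ser) : Prop := pleth f g = psum 1 ∧ pleth g f = psum 1

/-- `H = ∑_{r ≥ 0} h_r`. -/
def hSeries : Ser := sumAll hsymm

/-- `E = ∑_{r ≥ 0} e_r`. -/
def eSeries : Ser := sumAll esymm

/-- `H^± = ∑_{r ≥ 0} (-1)^r h_r`. -/
def hpmSeries : Ser := sumAll fun r => (-1 : ℂ) ^ r • hsymm r

/-- `H_μ[Q] = ∏_i h_{mᵢ}[qᵢ]`, over the `i` that occur in `μ`, `mᵢ` times. -/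
def Hpart (q : ℕ → Ser) {n : ℕ} (μ : n.Partition) : Ser :=
  ∏ i ∈ μ.parts.toFinset, pleth (hsymm (μ.parts.count i)) (q i)

/-- `E_μ[Q] = ∏_i e_{mᵢ}[qᵢ]`, over the `i` that occur in `μ`, `mᵢ` times. -/
def Epart (q : ℕ → Ser) {n : ℕ} (μ : n.Partition) : Ser :=
  ∏ i ∈ μ.parts.toFinset, pleth (esymm (μ.parts.count i)) (q i)

/-- The length of a partition, the number of its parts. -/
def len {n : ℕ} (μ : n.Partition) : ℕ := μ.parts.card

/-- `H[Q](t) = ∑_μ t^{|μ|} H_μ[Q]`. -/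
def genH (q : ℕ → Ser) : PowerSeries Ser :=
  PowerSeries.mk fun n => ∑ μ : n.Partition, Hpart q μ

/-- `E[Q](t) = ∑_μ t^{|μ|} E_μ[Q]`. -/
def genE (q : ℕ → Ser) : PowerSeries Ser :=
  PowerSeries.mk fun n => ∑ μ : n.Partition, Epart q μ

/-- `H^±[Q](t) = ∑_μ t^{|μ|} (-1)^{ℓ(μ)} H_μ[Q]`. -/
def genHpm (q : ℕ → Ser) : PowerSeries Ser :=
  PowerSeries.mk fun n => ∑ μ : n.Partition, (-1 : ℂ) ^ len μ • Hpart q μ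

/-- The sequence `(-1)^(n-1) ω(q_n)`, for `n ≥ 1`. -/
def altOmega (q : ℕ → Ser) (n : ℕ) : Ser := (-1 : ℂ) ^ (n - 1) • omega (q n)

/-- The partitions of `n` all of whose parts are powers of `2` (including `1 = 2^0`). -/
def twoPowerParts (n : ℕ) : Finset n.Partition := open Classical in
  Finset.univ.filter fun μ => ∀ i ∈ μ.parts, ∃ a : ℕ, i = 2 ^ a

/-- The partitions of `n` with distinct parts, all of which are powers of `2`. -/
def twoPowerDistinctParts (n : ℕ) : Finset n.Partition := open Classical in
  (twoPowerParts n).filter fun μ => μ.parts.Nodup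

/-- `t^k p_k`. -/
def tpsum (k : ℕ) : PowerSeries Ser := PowerSeries.C (psum k) * PowerSeries.X ^ k

/-! ### The modules -/

/-- The Frobenius characteristic `ch V = (1/n!) ∑_{σ ∈ S_n} χ_V(σ) p_{type(σ)}`. -/
def ch {n : ℕ} {V : Type*} [AddCommGroup V] [Module ℂ V]
    (ρ : Representation ℂ (Equiv.Perm (Fin n)) V) : Ser :=
  (n.factorial : ℂ)⁻¹ • ∑ σ : Equiv.Perm (Fin n),
    LinearMap.trace ℂ V (ρ σ) • psumPart σ.partition

/-- The subgroup `C_n` of `S_n` generated by the `n`-cycle `(0 1 ⋯ n-1)`. -/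
def cyc (n : ℕ) : Subgroup (Equiv.Perm (Fin n)) := Subgroup.zpowers (finRotate n)

/-- The generator of `C_n`. -/
def cycGen (n : ℕ) : cyc n := ⟨finRotate n, Subgroup.mem_zpowers _⟩

/-- The complex number `exp((2πi/n) r)`. -/
def rootExp (n r : ℕ) : ℂˣ :=
  Units.mk0 (Complex.exp (2 * Real.pi * Complex.I / n * r)) (Complex.exp_ne_zero _)

theorem mem_zpowers_cycGen (n : ℕ) (x : cyc n) : x ∈ Subgroup.zpowers (cycGen n) := by
  obtain ⟨x, k, rfl⟩ := x
  exact ⟨k, Subtype.ext (by simp [cycGen])⟩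

theorem orderOf_rootExp_dvd (n r : ℕ) : orderOf (rootExp n r) ∣ orderOf (cycGen n) := by
  have h1 : orderOf (cycGen n) = orderOf (finRotate n) := Subgroup.orderOf_mk ..
  rw [h1]
  rcases n with _ | _ | n
  · have : rootExp 0 r = 1 := by ext; simp [rootExp]
    simp [this]
  · have : rootExp 1 r = 1 := by
      ext
      simp only [rootExp, Units.val_mk0, Units.val_one]
      rw [Complex.exp_eq_one_iff]
      exact ⟨r, by push_cast; ring⟩
    simp [this]
  · rw [← Equiv.Perm.lcm_cycleType, cycleType_finRotate]
    simp only [Multiset.lcm_singleton, normalize_eq]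
    rw [orderOf_dvd_iff_pow_eq_one]
    ext
    simp only [rootExp, Units.val_pow_eq_pow_val, Units.val_mk0, Units.val_one]
    rw [← Complex.exp_nat_mul, Complex.exp_eq_one_iff]
    refine ⟨r, ?_⟩
    have : ((n + 2 : ℕ) : ℂ) ≠ 0 := by exact_mod_cast (by omega : n + 2 ≠ 0)
    rw [mul_comm ((n + 2 : ℕ) : ℂ)]
    push_cast at this ⊢
    have h2 : (n : ℂ) + 1 + 1 ≠ 0 := by rwa [add_assoc, one_add_one_eq_two]
    field_simp
    ring

/-- The linear character of `C_n` that sends the generator to `exp((2πi/n) r)`. -/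
def cycChar (n r : ℕ) : cyc n →* ℂˣ :=
  monoidHomOfForallMemZpowers (mem_zpowers_cycGen n) (orderOf_rootExp_dvd n r)

theorem cycChar_gen (n r : ℕ) : cycChar n r (cycGen n) = rootExp n r :=
  monoidHomOfForallMemZpowers_apply_gen _ _

/-- The one-dimensional representation of `C_n` afforded by `cycChar n r`. -/
def cycRep (n r : ℕ) : Representation ℂ (cyc n) ℂ :=
  ((Algebra.lmul ℂ ℂ : ℂ →* Module.End ℂ ℂ).comp (Units.coeHom ℂ)).comp (cycChar n r)

/-- The induced representation of `S_n` from the character `exp((2πi/n) r)` of `C_n`. -/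
def cycInd (n r : ℕ) : Representation ℂ (Equiv.Perm (Fin n))
    (Representation.IndV (cyc n).subtype (cycRep n r)) :=
  Representation.ind (cyc n).subtype (cycRep n r)

/-- (The Frobenius characteristic of) `Lie_n`, induced from the character `exp(2πi/n)`. -/
def LieSym (n : ℕ) : Ser := ch (cycInd n 1)

/-- (The Frobenius characteristic of) `Lie_n^{(2)}`, induced from the character
`exp((2πi/n) 2^k)`, where `2^k` is the largest power of `2` that divides `n`. -/
def LieTwoSym (n : ℕ) : Ser := ch (cycInd n (2 ^ padicValNat 2 n))

end

end PlethLie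

open PlethLie

namespace PlethLie

noncomputable section

/-! ### The operators `p_k[·]` -/

/-! Put F = ∑ f_n, U = H[F] and V = E[F]. Since H = exp(∑ p_k/k), plethysm by H turns sums into
products. So the sum of all H_λ[F] factors over the part sizes and equals U, the partitions of n
giving the component of degree n (`mk_sum_partition`); the same holds for E, H^± and E^±. Every
identity thus becomes a statement about U and V.

These two are tied together by E·H^± = 1, E^±·H = 1 and E·p_2[H] = H. The last gives V·p_2[U] = U,
in which V determines U, because a series with constant term 1 that is fixed by p_2[·] is 1
(`eq_of_eq_mul_psumPleth`). The sequence F^ω sums to -F[-p_1], so H[F^ω] and E[F^ω] are the inverses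
of U and V after p_k ↦ -p_k. It follows that each statement of (A) amounts to U(1 - p_1) = 1 and
each statement of (B) to V(1 - p_1) = 1; the products over powers of 2 come from iterating U =
V·p_2[U].

One identity of each kind remains to be computed. Let D be the Euler derivation. Then D(H[g]) = (∑_k
p_k[Dg])·H[g], and a series is determined by its constant term and such an equation
(`eq_of_euler_eq_mul`). For the representation induced from the character exp(2πi r/n) of C_n, n·ch
= ∑_{d∣n} c_d p_d^{n/d}, with c_d the sum of the character over the elements of order d. The
elements of order dividing m form the subgroup of order m, and the character is trivial on it iff m
∣ r, so ∑_{d∣m} c_d is m or 0 (`sum_charSum`). For r = 1 it is nonzero only at m = 1, and for r =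
2^{k_n} only at powers of 2; in both cases the value does not depend on n. Therefore ∑_k p_k[D Lie]
= ∑_{j≥1} p_1^j = p_1/(1 - p_1), the logarithmic derivative of (1 - p_1)^{-1}. The corresponding
series M for Lie^(2) satisfies M = p_1/(1 - p_1) + 2p_2[M], which says that U(1 - p_1) and p_2[U]
have the same logarithmic derivative, and so V(1 - p_1) = 1. -/

theorem coeff_smul_psumPleth (k : ℕ+) (g : Ser) (d : ℕ →₀ ℕ) :
    MvPowerSeries.coeff ((k : ℕ) • d) (psumPleth k g) = MvPowerSeries.coeff d g :=
  MvPowerSeries.coeff_expand_smul _ k.ne_zero g d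

theorem coeff_psumPleth_of_not_dvd (k : ℕ+) (g : Ser) {d : ℕ →₀ ℕ} {i : ℕ} (h : ¬ (k : ℕ) ∣ d i) :
    MvPowerSeries.coeff d (psumPleth k g) = 0 :=
  MvPowerSeries.coeff_expand_of_not_dvd _ k.ne_zero g h

theorem eq_smul_of_forall_dvd {k : ℕ} {d : ℕ →₀ ℕ} (h : ∀ i, k ∣ d i) :
    ∃ m : ℕ →₀ ℕ, d = k • m := by
  refine ⟨d.mapRange (· / k) (Nat.zero_div k), Finsupp.ext fun i => ?_⟩
  simp [Nat.mul_div_cancel' (h i)]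

/-- Two series that agree under `coeff (k • d)` and outside the multiples of `k` are equal. -/
theorem eq_psumPleth_iff {k : ℕ+} {f g : Ser} :
    psumPleth k g = f ↔ (∀ d, MvPowerSeries.coeff ((k : ℕ) • d) f = MvPowerSeries.coeff d g) ∧
      ∀ d i, ¬ (k : ℕ) ∣ d i → MvPowerSeries.coeff d f = 0 := by
  constructor
  · rintro rfl
    exact ⟨fun d => coeff_smul_psumPleth k g d, fun d i h => coeff_psumPleth_of_not_dvd k g h⟩
  · rintro ⟨h1, h2⟩
    ext d
    by_cases h : ∀ i, (k : ℕ) ∣ d i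
    · obtain ⟨m, rfl⟩ := eq_smul_of_forall_dvd h
      rw [coeff_smul_psumPleth, h1]
    · push Not at h
      obtain ⟨i, hi⟩ := h
      rw [coeff_psumPleth_of_not_dvd k g hi, h2 d i hi]

theorem psumPleth_mul (k : ℕ+) (f g : Ser) :
    psumPleth k (f * g) = psumPleth k f * psumPleth k g := map_mul _ _ _

theorem psumPleth_one (k : ℕ+) : psumPleth k 1 = 1 := map_one _

theorem psumPleth_add (k : ℕ+) (f g : Ser) :
    psumPleth k (f + g) = psumPleth k f + psumPleth k g := map_add _ _ _

theorem psumPleth_sub (k : ℕ+) (f g : Ser) :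
    psumPleth k (f - g) = psumPleth k f - psumPleth k g := map_sub _ _ _

theorem psumPleth_neg (k : ℕ+) (g : Ser) : psumPleth k (-g) = -psumPleth k g := map_neg _ _

theorem psumPleth_pow (k : ℕ+) (g : Ser) (n : ℕ) :
    psumPleth k (g ^ n) = psumPleth k g ^ n := map_pow _ _ _

theorem psumPleth_psum (k : ℕ+) (j : ℕ) : psumPleth k (psum j) = psum (k * j) := by
  classical
  have hk : (k : ℕ) ≠ 0 := k.ne_zero
  rw [eq_psumPleth_iff]
  constructor
  · intro d
    rw [coeff_psum, coeff_psum]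
    congr 1
    apply propext
    refine exists_congr fun i => ?_
    rw [← smul_eq_mul, ← Finsupp.smul_single]
    exact ⟨fun h => smul_right_injective _ hk h, fun h => by rw [h]⟩
  · intro d i hi
    rw [coeff_psum, if_neg]
    rintro ⟨l, rfl⟩
    apply hi
    rw [Finsupp.single_apply]
    split_ifs <;> simp

theorem psumPleth_psumPleth (j k : ℕ+) (g : Ser) :
    psumPleth j (psumPleth k g) = psumPleth (j * k) g :=
  (MvPowerSeries.expand_mul _ j.ne_zero _ k.ne_zero g).symm

theorem psumPleth_one_apply (g : Ser) : psumPleth 1 g = g :=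
  MvPowerSeries.expand_one_apply g

theorem constantCoeff_psumPleth (k : ℕ+) (g : Ser) :
    MvPowerSeries.constantCoeff (psumPleth k g) = MvPowerSeries.constantCoeff g :=
  MvPowerSeries.constantCoeff_expand _ k.ne_zero g

theorem constantCoeff_psum {k : ℕ} (hk : k ≠ 0) : MvPowerSeries.constantCoeff (psum k) = 0 := by
  rw [← MvPowerSeries.coeff_zero_eq_constantCoeff_apply, coeff_psum, if_neg]
  rintro ⟨i, hi⟩
  exact hk (Finsupp.single_eq_zero.1 hi.symm)

/-- Each coefficient of `psumPleth k g` is either one coefficient of `g` or zero. Continuity is what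
lets p_2[·] pass inside an infinite product in `twoProd_eq`. -/
theorem continuous_psumPleth (k : ℕ+) : Continuous (psumPleth k) := by
  refine continuous_pi fun d => ?_
  by_cases h : ∀ i, (k : ℕ) ∣ d i
  · obtain ⟨m, rfl⟩ := eq_smul_of_forall_dvd h
    have : (fun g : Ser => psumPleth k g ((k : ℕ) • m)) = fun g => MvPowerSeries.coeff m g :=
      funext fun g => coeff_smul_psumPleth k g m
    rw [this]
    exact MvPowerSeries.WithPiTopology.continuous_coeff ℂ m
  · push Not at h
    obtain ⟨i, hi⟩ := h
    have : (fun g : Ser => psumPleth k g d) = fun g => 0 :=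
      funext fun g => coeff_psumPleth_of_not_dvd k g hi
    rw [this]
    exact continuous_const

theorem hasSubst_psumPleth {g : Ser} (hg : MvPowerSeries.constantCoeff g = 0) :
    MvPowerSeries.HasSubst (fun k : ℕ+ => psumPleth k g) where
  const_coeff k := by
    rw [constantCoeff_psumPleth, hg]
    exact IsNilpotent.zero
  coeff_zero d := by
    by_cases hd : d = 0
    · convert Set.finite_empty
      ext k
      simp only [Set.mem_ofPred_eq, Set.mem_empty_iff_false, iff_false, not_not, hd]
      rw [MvPowerSeries.coeff_zero_eq_constantCoeff_apply, constantCoeff_psumPleth, hg]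
    · obtain ⟨i, hi⟩ := Finsupp.ne_iff.1 hd
      -- A monomial with d i > 0 can occur in p_k[g] only if k ∣ d i, hence only for k ≤ d i.
      refine Set.Finite.subset (Set.finite_le_nat (d i) |>.preimage
        (f := fun k : ℕ+ => (k : ℕ)) PNat.coe_injective.injOn) ?_
      intro k hk
      by_contra h
      apply hk
      refine coeff_psumPleth_of_not_dvd k g (i := i) fun hdvd => h ?_
      exact Nat.le_of_dvd (Nat.pos_of_ne_zero hi) hdvd

theorem hasSubst_X_mul (k : ℕ+) :
    MvPowerSeries.HasSubst (fun j : ℕ+ => (MvPowerSeries.X (k * j) : MvPowerSeries ℕ+ ℂ)) where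
  const_coeff j := by simp
  coeff_zero d := by
    classical
    refine Set.Finite.subset ((d.support.finite_toSet).preimage
      (f := fun j : ℕ+ => k * j) (mul_right_injective k).injOn) ?_
    intro j hj
    by_contra h
    apply hj
    rw [MvPowerSeries.coeff_X, if_neg]
    rintro rfl
    exact h (by simp)

theorem psumPleth_subst (k : ℕ+) {a : ℕ+ → Ser} (ha : MvPowerSeries.HasSubst a)
    (P : MvPowerSeries ℕ+ ℂ) :
    psumPleth k (MvPowerSeries.subst a P) = MvPowerSeries.subst (fun j => psumPleth k (a j)) P :=
  MvPowerSeries.expand_subst _ k.ne_zero ha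

/-- On expressions in the power sums, p_k[·] is the substitution p_j ↦ p_{kj}; in particular it
preserves symmetry. -/
theorem psumPleth_evalPsum (k : ℕ+) (P : MvPowerSeries ℕ+ ℂ) :
    psumPleth k (evalPsum P) =
      evalPsum (MvPowerSeries.subst (fun j : ℕ+ => MvPowerSeries.X (k * j)) P) := by
  rw [evalPsum, psumPleth_subst k hasSubst_psum, evalPsum,
    MvPowerSeries.subst_comp_subst_apply (hasSubst_X_mul k) hasSubst_psum]
  congr 1
  funext j
  rw [MvPowerSeries.subst_X hasSubst_psum, psumPleth_psum, PNat.mul_coe]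

/-! ### Plethysm -/

theorem pleth_evalPsum (P : MvPowerSeries ℕ+ ℂ) (g : Ser) :
    pleth (evalPsum P) g = MvPowerSeries.subst (fun k : ℕ+ => psumPleth k g) P := by
  rw [pleth, psumExpr_evalPsum]

theorem exists_evalPsum {f : Ser} (hf : IsSymmSeries f) : ∃ P, f = evalPsum P :=
  ⟨_, (evalPsum_psumExpr hf).symm⟩

theorem evalPsum_add (P Q : MvPowerSeries ℕ+ ℂ) :
    evalPsum (P + Q) = evalPsum P + evalPsum Q := MvPowerSeries.subst_add hasSubst_psum P Q

theorem evalPsum_mul (P Q : MvPowerSeries ℕ+ ℂ) :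
    evalPsum (P * Q) = evalPsum P * evalPsum Q := MvPowerSeries.subst_mul hasSubst_psum P Q

theorem evalPsum_smul (c : ℂ) (P : MvPowerSeries ℕ+ ℂ) :
    evalPsum (c • P) = c • evalPsum P := MvPowerSeries.subst_smul hasSubst_psum c P

theorem evalPsum_one : evalPsum 1 = 1 := by
  rw [evalPsum, ← MvPowerSeries.coe_substAlgHom hasSubst_psum, map_one]

theorem evalPsum_X (k : ℕ+) : evalPsum (MvPowerSeries.X k) = psum k :=
  MvPowerSeries.subst_X hasSubst_psum k

theorem IsSymmSeries.add {f g : Ser} (hf : IsSymmSeries f) (hg : IsSymmSeries g) :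
    IsSymmSeries (f + g) := fun σ d => by rw [map_add, map_add, hf σ, hg σ]

theorem IsSymmSeries.smul {f : Ser} (c : ℂ) (hf : IsSymmSeries f) :
    IsSymmSeries (c • f) := fun σ d => by
  rw [MvPowerSeries.coeff_smul, MvPowerSeries.coeff_smul, hf σ]

theorem IsSymmSeries.neg {f : Ser} (hf : IsSymmSeries f) :
    IsSymmSeries (-f) := fun σ d => by rw [map_neg, map_neg, hf σ]

theorem IsSymmSeries.sub {f g : Ser} (hf : IsSymmSeries f) (hg : IsSymmSeries g) :
    IsSymmSeries (f - g) := sub_eq_add_neg f g ▸ hf.add hg.neg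

theorem isSymmSeries_zero : IsSymmSeries 0 := fun _ _ => rfl

theorem isSymmSeries_one : IsSymmSeries 1 := by
  rw [← evalPsum_one]; exact isSymmSeries_evalPsum 1

theorem IsSymmSeries.psumPleth {f : Ser} (hf : IsSymmSeries f) (k : ℕ+) :
    IsSymmSeries (psumPleth k f) := by
  obtain ⟨P, rfl⟩ := exists_evalPsum hf
  rw [psumPleth_evalPsum]
  exact isSymmSeries_evalPsum _

theorem pleth_add {f₁ f₂ g : Ser} (h₁ : IsSymmSeries f₁) (h₂ : IsSymmSeries f₂)
    (hg : MvPowerSeries.constantCoeff g = 0) : pleth (f₁ + f₂) g = pleth f₁ g + pleth f₂ g := by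
  obtain ⟨P, rfl⟩ := exists_evalPsum h₁
  obtain ⟨Q, rfl⟩ := exists_evalPsum h₂
  simp only [← evalPsum_add, pleth_evalPsum, MvPowerSeries.subst_add (hasSubst_psumPleth hg)]

theorem pleth_mul {f₁ f₂ g : Ser} (h₁ : IsSymmSeries f₁) (h₂ : IsSymmSeries f₂)
    (hg : MvPowerSeries.constantCoeff g = 0) : pleth (f₁ * f₂) g = pleth f₁ g * pleth f₂ g := by
  obtain ⟨P, rfl⟩ := exists_evalPsum h₁
  obtain ⟨Q, rfl⟩ := exists_evalPsum h₂
  simp only [← evalPsum_mul, pleth_evalPsum, MvPowerSeries.subst_mul (hasSubst_psumPleth hg)]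

theorem pleth_smul {f g : Ser} (c : ℂ) (hf : IsSymmSeries f)
    (hg : MvPowerSeries.constantCoeff g = 0) : pleth (c • f) g = c • pleth f g := by
  obtain ⟨P, rfl⟩ := exists_evalPsum hf
  simp only [← evalPsum_smul, pleth_evalPsum, MvPowerSeries.subst_smul (hasSubst_psumPleth hg)]

theorem pleth_one {g : Ser} (hg : MvPowerSeries.constantCoeff g = 0) : pleth 1 g = 1 := by
  rw [← evalPsum_one, pleth_evalPsum, ← MvPowerSeries.coe_substAlgHom (hasSubst_psumPleth hg),
    map_one, evalPsum_one]

theorem pleth_neg {f g : Ser} (hf : IsSymmSeries f)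
    (hg : MvPowerSeries.constantCoeff g = 0) : pleth (-f) g = -pleth f g := by
  rw [← neg_one_smul ℂ f, pleth_smul _ hf hg, neg_one_smul]

theorem pleth_psum {g : Ser} (hg : MvPowerSeries.constantCoeff g = 0) (k : ℕ+) :
    pleth (psum k) g = psumPleth k g := by
  rw [← evalPsum_X, pleth_evalPsum, MvPowerSeries.subst_X (hasSubst_psumPleth hg)]

theorem pleth_psumPleth (k : ℕ+) {f g : Ser} (hf : IsSymmSeries f)
    (hg : MvPowerSeries.constantCoeff g = 0) :
    pleth (psumPleth k f) g = psumPleth k (pleth f g) := by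
  obtain ⟨P, rfl⟩ := exists_evalPsum hf
  rw [psumPleth_evalPsum, pleth_evalPsum, pleth_evalPsum, psumPleth_subst k (hasSubst_psumPleth hg),
    MvPowerSeries.subst_comp_subst_apply (hasSubst_X_mul k) (hasSubst_psumPleth hg)]
  simp only [MvPowerSeries.subst_X (hasSubst_psumPleth hg), psumPleth_psumPleth]

theorem pleth_psum_one {f : Ser} (hf : IsSymmSeries f) : pleth f (psum 1) = f := by
  obtain ⟨P, rfl⟩ := exists_evalPsum hf
  rw [pleth_evalPsum, evalPsum]
  simp only [psumPleth_psum, mul_one]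

/-- Writing g = Q(p_1, p_2, …), the expression of f[g] in power sums arises by substituting the
shifted copies Q(X_k, X_{2k}, …) into the expression of f. Both the symmetry of f[g] and the
associativity of plethysm are read off from this explicit P. -/
theorem exists_pleth_eq_evalPsum (f : Ser) {g : Ser} (hg : IsSymmSeries g)
    (hg0 : MvPowerSeries.constantCoeff g = 0) : ∃ P, pleth f g = evalPsum P ∧
      ∀ h : Ser, MvPowerSeries.constantCoeff h = 0 →
        MvPowerSeries.subst (fun k : ℕ+ => psumPleth k h) P = pleth f (pleth g h) := by
  obtain ⟨Q, rfl⟩ := exists_evalPsum hg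
  have hQ : MvPowerSeries.HasSubst fun k : ℕ+ =>
      MvPowerSeries.subst (fun j : ℕ+ => (MvPowerSeries.X (k * j) : MvPowerSeries ℕ+ ℂ)) Q := by
    have hQ0 : MvPowerSeries.constantCoeff Q = 0 := by
      -- Splitting off the constant term of Q leaves a series whose value at the power sums has no
      -- constant term, so Q inherits the vanishing constant term of g.
      have h1 : evalPsum Q = MvPowerSeries.constantCoeff Q • 1 +
          evalPsum (Q - MvPowerSeries.constantCoeff Q • 1) := by
        rw [← evalPsum_one, ← evalPsum_smul, ← evalPsum_add]
        congr 1
        ring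
      rw [h1, map_add] at hg0
      have h2 : MvPowerSeries.constantCoeff
          (evalPsum (Q - MvPowerSeries.constantCoeff Q • 1)) = 0 := by
        apply MvPowerSeries.constantCoeff_subst_eq_zero hasSubst_psum
        · intro k
          exact constantCoeff_psum k.ne_zero
        · simp
      rw [h2] at hg0
      simpa using hg0
    refine ⟨fun k => ?_, fun d => ?_⟩
    · rw [MvPowerSeries.constantCoeff_subst_eq_zero (hasSubst_X_mul k) (by simp) hQ0]
      exact IsNilpotent.zero
    · by_cases hd : d = 0
      · convert Set.finite_empty
        ext k
        simp only [Set.mem_ofPred_eq, Set.mem_empty_iff_false, iff_false, not_not, hd]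
        rw [MvPowerSeries.coeff_zero_eq_constantCoeff_apply]
        exact MvPowerSeries.constantCoeff_subst_eq_zero (hasSubst_X_mul k) (by simp) hQ0
      · obtain ⟨i, hi⟩ := Finsupp.ne_iff.1 hd
        -- The k-th shifted copy of Q involves only variables X_{kj}, so X_i can occur in it only
        -- when k ∣ i, hence only for k ≤ i.
        refine Set.Finite.subset (Set.finite_le_nat (i : ℕ) |>.preimage
          (f := fun k : ℕ+ => (k : ℕ)) PNat.coe_injective.injOn) ?_
        intro k hk
        by_contra h
        apply hk
        classical
        rw [MvPowerSeries.coeff_subst (hasSubst_X_mul k)]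
        apply finsum_eq_zero_of_forall_eq_zero
        intro e
        rw [show (e.prod fun s n => (MvPowerSeries.X (k * s) : MvPowerSeries ℕ+ ℂ) ^ n) =
          MvPowerSeries.monomial (e.mapDomain fun s => k * s) 1 from ?_,
          MvPowerSeries.coeff_monomial, if_neg, smul_zero]
        · rintro rfl
          apply hi
          rw [Finsupp.zero_apply]
          apply Finsupp.mapDomain_of_notMem_range
          rintro ⟨s, rfl⟩
          apply h
          simp only [Set.mem_preimage, Set.mem_ofPred_eq, PNat.mul_coe]
          exact Nat.le_mul_of_pos_right _ s.pos
        · rw [MvPowerSeries.monomial_one_eq, Finsupp.prod_mapDomain_index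
            (fun _ => pow_zero _) (fun _ _ _ => pow_add _ _ _)]
  refine ⟨MvPowerSeries.subst (fun k : ℕ+ =>
      MvPowerSeries.subst (fun j : ℕ+ => MvPowerSeries.X (k * j)) Q) (psumExpr f), ?_, ?_⟩
  · conv_rhs => rw [evalPsum, MvPowerSeries.subst_comp_subst_apply hQ hasSubst_psum]
    rw [pleth]
    congr 1
    funext k
    exact psumPleth_evalPsum k Q
  · intro h hh
    rw [MvPowerSeries.subst_comp_subst_apply hQ (hasSubst_psumPleth hh), pleth, pleth_evalPsum]
    congr 1
    funext k
    rw [psumPleth_subst k (hasSubst_psumPleth hh),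
      MvPowerSeries.subst_comp_subst_apply (hasSubst_X_mul k) (hasSubst_psumPleth hh)]
    simp only [MvPowerSeries.subst_X (hasSubst_psumPleth hh), psumPleth_psumPleth]

theorem isSymmSeries_pleth (f : Ser) {g : Ser} (hg : IsSymmSeries g)
    (hg0 : MvPowerSeries.constantCoeff g = 0) : IsSymmSeries (pleth f g) := by
  obtain ⟨P, hP, -⟩ := exists_pleth_eq_evalPsum f hg hg0
  rw [hP]
  exact isSymmSeries_evalPsum P

theorem pleth_assoc (f : Ser) {g h : Ser} (hg : IsSymmSeries g)
    (hg0 : MvPowerSeries.constantCoeff g = 0) (hh : MvPowerSeries.constantCoeff h = 0) :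
    pleth (pleth f g) h = pleth f (pleth g h) := by
  obtain ⟨P, hP, hP'⟩ := exists_pleth_eq_evalPsum f hg hg0
  rw [hP, pleth_evalPsum, hP' h hh]

/-! ### Homogeneous components -/

/-- The homogeneous component of degree `n`. -/
abbrev comp (n : ℕ) : Ser →ₗ[ℂ] Ser := MvPowerSeries.homogeneousComponent n

theorem coeff_comp (n : ℕ) (d : ℕ →₀ ℕ) (f : Ser) :
    MvPowerSeries.coeff d (comp n f) = if d.degree = n then MvPowerSeries.coeff d f else 0 :=
  MvPowerSeries.coeff_homogeneousComponent n d f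

/-- Every monomial that occurs in `f` has degree `n`. -/
def IsHomog (f : Ser) (n : ℕ) : Prop :=
  ∀ d : ℕ →₀ ℕ, d.degree ≠ n → MvPowerSeries.coeff d f = 0

theorem isHomog_iff {f : Ser} {n : ℕ} : IsHomog f n ↔
    ∀ d : ℕ →₀ ℕ, d.degree ≠ n → MvPowerSeries.coeff d f = 0 := Iff.rfl

theorem isHomog_of_isHomogeneous {f : Ser} {n : ℕ} (hf : f.IsHomogeneous n) : IsHomog f n :=
  fun _ hd => hf.coeff_eq_zero hd

theorem IsHomog.mul {f g : Ser} {m n : ℕ} (hf : IsHomog f m) (hg : IsHomog g n) :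
    IsHomog (f * g) (m + n) := by
  classical
  intro d hd
  rw [MvPowerSeries.coeff_mul]
  refine Finset.sum_eq_zero fun p hp => ?_
  rw [Finset.HasAntidiagonal.mem_antidiagonal] at hp
  by_cases h : p.1.degree = m
  · rw [hg p.2 (by rintro rfl; exact hd (by rw [← hp, map_add, h])), mul_zero]
  · rw [hf p.1 h, zero_mul]

theorem isHomog_comp (n : ℕ) (f : Ser) : IsHomog (comp n f) n := fun d hd => by
  rw [coeff_comp, if_neg hd]

theorem comp_of_isHomog {f : Ser} {n : ℕ} (hf : IsHomog f n) (m : ℕ) :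
    comp m f = if m = n then f else 0 := by
  ext d
  rw [coeff_comp]
  rw [isHomog_iff] at hf
  by_cases h : d.degree = m
  · rw [if_pos h]
    split_ifs with h'
    · rfl
    · rw [hf d (by omega), map_zero]
  · rw [if_neg h]
    split_ifs with h'
    · rw [hf d (by omega)]
    · rw [map_zero]

theorem isHomog_one : IsHomog (1 : Ser) 0 := by
  classical
  rw [isHomog_iff]
  intro d hd
  rw [MvPowerSeries.coeff_one, if_neg]
  rintro rfl
  exact hd (map_zero _)

theorem isHomog_pow {f : Ser} {n : ℕ} (hf : IsHomog f n) (m : ℕ) :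
    IsHomog (f ^ m) (m * n) := by
  induction m with
  | zero => simpa using isHomog_one
  | succ m ih => rw [pow_succ, add_mul, one_mul]; exact ih.mul hf

theorem isHomog_prod {ι : Type*} (s : Finset ι) (f : ι → Ser) (n : ι → ℕ)
    (h : ∀ i ∈ s, IsHomog (f i) (n i)) : IsHomog (∏ i ∈ s, f i) (∑ i ∈ s, n i) := by
  classical
  induction s using Finset.induction with
  | empty => simpa using isHomog_one
  | insert a s ha ih =>
    rw [Finset.prod_insert ha, Finset.sum_insert ha]
    exact (h a (Finset.mem_insert_self _ _)).mul
      (ih fun i hi => h i (Finset.mem_insert_of_mem hi))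

theorem isHomog_smul {f : Ser} {n : ℕ} (c : ℂ) (hf : IsHomog f n) :
    IsHomog (c • f) n := by
  rw [isHomog_iff] at hf ⊢
  intro d hd
  rw [MvPowerSeries.coeff_smul, hf d hd, mul_zero]

theorem isHomog_neg {f : Ser} {n : ℕ} (hf : IsHomog f n) :
    IsHomog (-f) n := by
  rw [← neg_one_smul ℂ f]
  exact isHomog_smul _ hf

theorem isHomog_zero (n : ℕ) : IsHomog (0 : Ser) n := by
  rw [isHomog_iff]
  exact fun _ _ => rfl

theorem isHomog_sum {ι : Type*} (s : Finset ι) (f : ι → Ser) (n : ℕ)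
    (h : ∀ i ∈ s, IsHomog (f i) n) : IsHomog (∑ i ∈ s, f i) n := by
  rw [isHomog_iff]
  intro d hd
  rw [map_sum]
  exact Finset.sum_eq_zero fun i hi => isHomog_iff.1 (h i hi) d hd

theorem isHomog_psum (k : ℕ) : IsHomog (psum k) k := by
  classical
  rw [isHomog_iff]
  intro d hd
  rw [coeff_psum, if_neg]
  rintro ⟨i, rfl⟩
  simp at hd

theorem isHomog_psumMul (s : Multiset ℕ) : IsHomog (psumMul s) s.sum := by
  induction s using Multiset.induction with
  | empty => simpa [psumMul] using isHomog_one
  | cons k t ih => simpa [psumMul] using (isHomog_psum k).mul ih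

theorem isHomog_psumPart {n : ℕ} (μ : n.Partition) : IsHomog (psumPart μ) n := by
  have := isHomog_psumMul μ.parts
  rwa [μ.parts_sum] at this

theorem isHomog_psumPleth (k : ℕ+) {f : Ser} {n : ℕ} (hf : IsHomog f n) :
    IsHomog (psumPleth k f) (k * n) := by
  rw [isHomog_iff] at hf ⊢
  intro d hd
  by_cases h : ∀ i, (k : ℕ) ∣ d i
  · obtain ⟨m, rfl⟩ := eq_smul_of_forall_dvd h
    rw [coeff_smul_psumPleth]
    apply hf
    rintro rfl
    simp at hd
  · push Not at h
    obtain ⟨i, hi⟩ := h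
    exact coeff_psumPleth_of_not_dvd k f hi

theorem constantCoeff_eq_zero_of_isHomog {f : Ser} {n : ℕ} (hf : IsHomog f n)
    (hn : n ≠ 0) : MvPowerSeries.constantCoeff f = 0 := by
  rw [← MvPowerSeries.coeff_zero_eq_constantCoeff_apply]
  apply isHomog_iff.1 hf
  simpa using hn.symm

theorem IsSymmSeries.comp {f : Ser} (hf : IsSymmSeries f) (n : ℕ) : IsSymmSeries (comp n f) := by
  intro σ d
  rw [coeff_comp, coeff_comp, hf σ, Finsupp.degree_mapDomain]

theorem coeff_sumAll (q : ℕ → Ser) (d : ℕ →₀ ℕ) :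
    MvPowerSeries.coeff d (sumAll q) = MvPowerSeries.coeff d (q d.degree) := rfl

theorem isSymmSeries_sumAll {q : ℕ → Ser} (hq : ∀ n, IsSymmSeries (q n)) :
    IsSymmSeries (sumAll q) := by
  intro σ d
  rw [coeff_sumAll, coeff_sumAll, Finsupp.degree_mapDomain, hq]

theorem comp_sumAll {q : ℕ → Ser} (n : ℕ) (hq : IsHomog (q n) n) :
    comp n (sumAll q) = q n := by
  rw [isHomog_iff] at hq
  ext d
  rw [coeff_comp, coeff_sumAll]
  split_ifs with h
  · rw [h]
  · rw [hq d h]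

theorem sumAll_comp (f : Ser) : sumAll (fun n => comp n f) = f := by
  ext d
  rw [coeff_sumAll, coeff_comp, if_pos rfl]

theorem eq_of_comp_eq {f g : Ser} (h : ∀ n, comp n f = comp n g) : f = g := by
  rw [← sumAll_comp f, ← sumAll_comp g]
  simp only [h]

theorem comp_sumPos {q : ℕ → Ser} (n : ℕ) (hq : n ≠ 0 → IsHomog (q n) n) :
    comp n (sumPos q) = if n = 0 then 0 else q n := by
  rw [sumPos, comp_sumAll]
  split_ifs with h
  · exact isHomog_zero n
  · exact hq h

theorem constantCoeff_sumPos (q : ℕ → Ser) : MvPowerSeries.constantCoeff (sumPos q) = 0 := by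
  rw [← MvPowerSeries.coeff_zero_eq_constantCoeff_apply, sumPos, coeff_sumAll]
  simp

theorem isSymmSeries_sumPos {q : ℕ → Ser} (hq : ∀ n, 1 ≤ n → IsSymmSeries (q n)) :
    IsSymmSeries (sumPos q) := by
  apply isSymmSeries_sumAll
  intro n
  split_ifs with h
  · exact isSymmSeries_zero
  · exact hq n (by omega)

/-! ### Weights of power sum monomials and degrees of plethysms -/

/-- The degree of a monomial in the power sums. -/
def weight (d : ℕ+ →₀ ℕ) : ℕ := (toMul d).sum

theorem weight_eq (d : ℕ+ →₀ ℕ) : weight d = ∑ k ∈ d.support, d k * k := by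
  rw [weight, toMul, Finsupp.toMultiset_apply, Finsupp.sum, ← Multiset.coe_mapAddMonoidHom,
    map_sum, Multiset.sum_sum]
  simp [Multiset.map_nsmul, Multiset.sum_nsmul]

/-- The part of a given weight of a series in the power sums. -/
def weightComp (n : ℕ) (P : MvPowerSeries ℕ+ ℂ) : MvPowerSeries ℕ+ ℂ := fun d =>
  if weight d = n then MvPowerSeries.coeff d P else 0

theorem coeff_weightComp (n : ℕ) (P : MvPowerSeries ℕ+ ℂ) (d : ℕ+ →₀ ℕ) :
    MvPowerSeries.coeff d (weightComp n P) =
      if weight d = n then MvPowerSeries.coeff d P else 0 := rfl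

theorem evalPsum_weightComp (n : ℕ) (P : MvPowerSeries ℕ+ ℂ) :
    evalPsum (weightComp n P) = comp n (evalPsum P) := by
  ext e
  rw [coeff_comp, coeff_evalPsum, coeff_evalPsum]
  have key : ∀ d, weight d ≠ e.degree → MvPowerSeries.coeff e (psumMul (toMul d)) = 0 :=
    fun d hd => isHomog_iff.1 (isHomog_psumMul (toMul d)) e (Ne.symm hd)
  split_ifs with h
  · refine finsum_congr fun d => ?_
    rw [coeff_weightComp]
    split_ifs with hd
    · rfl
    · rw [key d (by omega), mul_zero, mul_zero]
  · refine finsum_eq_zero_of_forall_eq_zero fun d => ?_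
    rw [coeff_weightComp]
    split_ifs with hd
    · rw [key d (by omega), mul_zero]
    · rw [zero_mul]

theorem isHomog_prod_psumPleth {g : Ser} {i : ℕ} (hg : IsHomog g i) (d : ℕ+ →₀ ℕ) :
    IsHomog (d.prod fun k n => psumPleth k g ^ n) (i * weight d) := by
  rw [weight_eq, Finset.mul_sum]
  apply isHomog_prod
  intro k _
  convert isHomog_pow (isHomog_psumPleth k hg) (d k) using 1
  ring

/-- A power sum monomial of weight w in f turns into a series of degree i·w in f[g], so degree i·j
only sees the part of f of degree j. -/
theorem coeff_pleth_of_isHomog {f g : Ser} (hf : IsSymmSeries f) {i : ℕ} (hi : i ≠ 0)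
    (hg : IsHomog g i) (j : ℕ) {e : ℕ →₀ ℕ} (he : e.degree = i * j) :
    MvPowerSeries.coeff e (pleth f g) = MvPowerSeries.coeff e (pleth (comp j f) g) := by
  obtain ⟨P, rfl⟩ := exists_evalPsum hf
  have hs := hasSubst_psumPleth (constantCoeff_eq_zero_of_isHomog hg hi)
  rw [← evalPsum_weightComp, pleth_evalPsum, pleth_evalPsum, MvPowerSeries.coeff_subst hs,
    MvPowerSeries.coeff_subst hs]
  refine finsum_congr fun d => ?_
  rw [coeff_weightComp]
  split_ifs with hd
  · rfl
  · rw [isHomog_iff.1 (isHomog_prod_psumPleth hg d), smul_zero, smul_zero]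
    rw [he]
    exact fun h => hd (Nat.eq_of_mul_eq_mul_left (Nat.pos_of_ne_zero hi) h).symm

theorem coeff_pleth_of_not_dvd {f g : Ser} {i : ℕ} (hi : i ≠ 0)
    (hg : IsHomog g i) {e : ℕ →₀ ℕ} (he : ¬ i ∣ e.degree) :
    MvPowerSeries.coeff e (pleth f g) = 0 := by
  have hs := hasSubst_psumPleth (constantCoeff_eq_zero_of_isHomog hg hi)
  rw [pleth, MvPowerSeries.coeff_subst hs]
  refine finsum_eq_zero_of_forall_eq_zero fun d => ?_
  rw [isHomog_iff.1 (isHomog_prod_psumPleth hg d), smul_zero]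
  exact fun h => he ⟨_, h⟩

theorem pleth_zero_left {g : Ser} (hg : MvPowerSeries.constantCoeff g = 0) : pleth 0 g = 0 := by
  rw [← zero_smul ℂ (1 : Ser), pleth_smul 0 isSymmSeries_one hg, zero_smul, zero_smul]

theorem isHomog_pleth {f g : Ser} (hfs : IsSymmSeries f) {i j : ℕ} (hi : i ≠ 0)
    (hf : IsHomog f j) (hg : IsHomog g i) : IsHomog (pleth f g) (i * j) := by
  rw [isHomog_iff]
  intro e he
  by_cases h : i ∣ e.degree
  · obtain ⟨m, hm⟩ := h
    rw [coeff_pleth_of_isHomog hfs hi hg m hm, comp_of_isHomog hf, if_neg,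
      pleth_zero_left (constantCoeff_eq_zero_of_isHomog hg hi), map_zero]
    rintro rfl
    exact he hm
  · exact coeff_pleth_of_not_dvd hi hg h

theorem comp_pleth {f g : Ser} (hf : IsSymmSeries f) {i : ℕ} (hi : i ≠ 0)
    (hg : IsHomog g i) (n : ℕ) :
    comp n (pleth f g) = if i ∣ n then pleth (comp (n / i) f) g else 0 := by
  ext e
  rw [coeff_comp]
  split_ifs with h1 h2 h2
  · subst h1
    rw [coeff_pleth_of_isHomog hf hi hg (e.degree / i) (Nat.mul_div_cancel' h2).symm]
  · subst h1
    rw [coeff_pleth_of_not_dvd hi hg h2, map_zero]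
  · have := isHomog_pleth (hf.comp (n / i)) hi
      (isHomog_comp (n / i) f) hg
    rw [isHomog_iff.1 this e (by rwa [Nat.mul_div_cancel' h2])]
  · rw [map_zero]

/-! ### The grading as a power series in `t` -/

/-- The series `∑_n t^n f_n`, where `f_n` is the homogeneous component of degree `n` of `f`. -/
def grade : Ser →+* PowerSeries Ser where
  toFun f := PowerSeries.mk fun n => comp n f
  map_zero' := by ext1 n; simp
  map_one' := by
    ext1 n
    rw [PowerSeries.coeff_mk, comp_of_isHomog isHomog_one, PowerSeries.coeff_one]
  map_add' f g := by ext1 n; simp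
  map_mul' f g := by
    classical
    ext n d
    rw [PowerSeries.coeff_mk, PowerSeries.coeff_mul, coeff_comp, map_sum]
    simp only [PowerSeries.coeff_mk, MvPowerSeries.coeff_mul]
    rw [Finset.sum_comm]
    split_ifs with h
    · refine Finset.sum_congr rfl fun p hp => ?_
      rw [Finset.HasAntidiagonal.mem_antidiagonal] at hp
      -- A pair of monomials contributes to exactly one pair of components, the one given by their
      -- own degrees.
      rw [Finset.sum_eq_single (p.1.degree, p.2.degree)]
      · rw [coeff_comp, coeff_comp, if_pos rfl, if_pos rfl]
      · intro b _ hb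
        rw [coeff_comp, coeff_comp]
        split_ifs with h1 h2
        · exact absurd (Prod.ext h1.symm h2.symm) hb
        · rw [mul_zero]
        · rw [zero_mul]
        · rw [zero_mul]
      · intro h'
        exfalso
        apply h'
        rw [Finset.HasAntidiagonal.mem_antidiagonal, ← map_add, hp, h]
    · symm
      refine Finset.sum_eq_zero fun p hp => Finset.sum_eq_zero fun b hb => ?_
      rw [Finset.HasAntidiagonal.mem_antidiagonal] at hp hb
      rw [coeff_comp, coeff_comp]
      split_ifs with h1 h2
      · exact absurd (by rw [← hp, map_add, h1, h2, hb]) h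
      · rw [mul_zero]
      · rw [zero_mul]
      · rw [zero_mul]

theorem coeff_grade (n : ℕ) (f : Ser) : PowerSeries.coeff n (grade f) = comp n f := by
  change PowerSeries.coeff n (PowerSeries.mk fun n => comp n f) = _
  rw [PowerSeries.coeff_mk]

theorem grade_injective : Function.Injective grade := fun f g h =>
  eq_of_comp_eq fun n => by rw [← coeff_grade, h, coeff_grade]

theorem grade_of_isHomog {f : Ser} {n : ℕ} (hf : IsHomog f n) :
    grade f = PowerSeries.C f * PowerSeries.X ^ n := by
  ext1 m
  rw [coeff_grade, comp_of_isHomog hf, PowerSeries.coeff_C_mul, PowerSeries.coeff_X_pow]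
  simp

theorem grade_psum (k : ℕ) : grade (psum k) = tpsum k :=
  grade_of_isHomog (isHomog_psum k)

theorem continuous_grade : Continuous grade := by
  rw [continuous_iff_continuousAt]
  intro f
  rw [ContinuousAt, PowerSeries.WithPiTopology.tendsto_iff_coeff_tendsto]
  intro n
  rw [MvPowerSeries.WithPiTopology.tendsto_iff_coeff_tendsto]
  intro d
  simp only [coeff_grade, coeff_comp]
  split_ifs with h
  · exact (MvPowerSeries.WithPiTopology.continuous_coeff ℂ d).tendsto f
  · exact tendsto_const_nhds

/-! ### Plethysm and congruence of low degree terms -/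

/-- The series without terms of degree at most `n`. -/
def highIdeal (n : ℕ) : Ideal Ser where
  carrier := {f | ∀ e : ℕ →₀ ℕ, e.degree ≤ n → MvPowerSeries.coeff e f = 0}
  zero_mem' := fun _ _ => rfl
  add_mem' := fun {f g} hf hg e he => by rw [map_add, hf e he, hg e he, add_zero]
  smul_mem' := fun c f hf e he => by
    classical
    rw [smul_eq_mul, MvPowerSeries.coeff_mul]
    refine Finset.sum_eq_zero fun p hp => ?_
    rw [Finset.HasAntidiagonal.mem_antidiagonal] at hp
    rw [hf p.2 (by rw [← hp, map_add] at he; omega), mul_zero]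

theorem mem_highIdeal {n : ℕ} {f : Ser} : f ∈ highIdeal n ↔
    ∀ e : ℕ →₀ ℕ, e.degree ≤ n → MvPowerSeries.coeff e f = 0 := Iff.rfl

theorem psumPleth_mem_highIdeal (k : ℕ+) {n : ℕ} {f : Ser} (hf : f ∈ highIdeal n) :
    psumPleth k f ∈ highIdeal n := by
  rw [mem_highIdeal] at hf ⊢
  intro e he
  by_cases h : ∀ i, (k : ℕ) ∣ e i
  · obtain ⟨m, rfl⟩ := eq_smul_of_forall_dvd h
    rw [coeff_smul_psumPleth]
    apply hf
    rw [map_nsmul, smul_eq_mul] at he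
    exact (Nat.le_mul_of_pos_left _ k.pos).trans he
  · push Not at h
    obtain ⟨i, hi⟩ := h
    exact coeff_psumPleth_of_not_dvd k f hi

/-- Each monomial in the p_k[g] is taken modulo the ideal of terms of degree above n, where p_k[g]
and p_k[h] agree. This allows an infinite sum ∑ q_i inside a plethysm to be replaced by finite
partial sums. -/
theorem pleth_sub_mem_highIdeal (f : Ser) {g h : Ser} (hg : MvPowerSeries.constantCoeff g = 0)
    (hh : MvPowerSeries.constantCoeff h = 0) {n : ℕ} (hgh : g - h ∈ highIdeal n) :
    pleth f g - pleth f h ∈ highIdeal n := by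
  rw [mem_highIdeal]
  intro e he
  rw [map_sub, sub_eq_zero, pleth, pleth, MvPowerSeries.coeff_subst (hasSubst_psumPleth hg),
    MvPowerSeries.coeff_subst (hasSubst_psumPleth hh)]
  refine finsum_congr fun d => ?_
  congr 1
  rw [← sub_eq_zero, ← map_sub]
  refine mem_highIdeal.1 ?_ e he
  rw [← Ideal.Quotient.mk_eq_mk_iff_sub_mem, Finsupp.prod, Finsupp.prod, map_prod, map_prod]
  refine Finset.prod_congr rfl fun k _ => ?_
  rw [map_pow, map_pow]
  congr 1
  rw [Ideal.Quotient.mk_eq_mk_iff_sub_mem, ← psumPleth_sub]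
  exact psumPleth_mem_highIdeal k hgh

theorem comp_eq_of_sub_mem_highIdeal {f g : Ser} {n m : ℕ} (h : f - g ∈ highIdeal n)
    (hm : m ≤ n) : comp m f = comp m g := by
  rw [← sub_eq_zero, ← map_sub]
  ext d
  rw [coeff_comp]
  split_ifs with hd
  · rw [mem_highIdeal.1 h d (by omega), map_zero]
  · rw [map_zero]

/-! ### The Euler derivation -/

/-- The Euler derivation, which multiplies the component of degree `n` by `n`. -/
def euler : Ser →ₗ[ℂ] Ser where
  toFun f := fun d => (d.degree : ℂ) * MvPowerSeries.coeff d f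
  map_add' f g := by
    ext d
    exact mul_add _ _ _
  map_smul' c f := by
    ext d
    exact mul_left_comm _ _ _

theorem coeff_euler (f : Ser) (d : ℕ →₀ ℕ) :
    MvPowerSeries.coeff d (euler f) = (d.degree : ℂ) * MvPowerSeries.coeff d f := rfl

theorem euler_mul (f g : Ser) : euler (f * g) = euler f * g + f * euler g := by
  classical
  ext d
  rw [coeff_euler, map_add, MvPowerSeries.coeff_mul, MvPowerSeries.coeff_mul,
    MvPowerSeries.coeff_mul, Finset.mul_sum, ← Finset.sum_add_distrib]
  refine Finset.sum_congr rfl fun p hp => ?_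
  rw [Finset.HasAntidiagonal.mem_antidiagonal] at hp
  rw [coeff_euler, coeff_euler, ← hp, map_add]
  push_cast
  ring

theorem euler_of_isHomog {f : Ser} {n : ℕ} (hf : IsHomog f n) : euler f = (n : ℂ) • f := by
  ext d
  rw [coeff_euler, MvPowerSeries.coeff_smul]
  by_cases h : d.degree = n
  · rw [h]
  · rw [hf d h, mul_zero, mul_zero]

theorem euler_one : euler 1 = 0 := by
  rw [euler_of_isHomog isHomog_one, Nat.cast_zero, zero_smul]

theorem euler_psumPleth (k : ℕ+) (g : Ser) :
    euler (psumPleth k g) = ((k : ℕ) : ℂ) • psumPleth k (euler g) := by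
  ext d
  rw [coeff_euler, MvPowerSeries.coeff_smul]
  by_cases h : ∀ i, (k : ℕ) ∣ d i
  · obtain ⟨m, rfl⟩ := eq_smul_of_forall_dvd h
    rw [coeff_smul_psumPleth, coeff_smul_psumPleth, coeff_euler, map_nsmul, smul_eq_mul]
    push_cast
    ring
  · push Not at h
    obtain ⟨i, hi⟩ := h
    rw [coeff_psumPleth_of_not_dvd k _ hi, coeff_psumPleth_of_not_dvd k _ hi, mul_zero, mul_zero]

theorem constantCoeff_euler (f : Ser) : MvPowerSeries.constantCoeff (euler f) = 0 := by
  rw [← MvPowerSeries.coeff_zero_eq_constantCoeff_apply, coeff_euler, map_zero, Nat.cast_zero,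
    zero_mul]

/-- In degree m > 0 the equation expresses m·W_m through components of W of lower degree, because N
has no constant term; induction on the degree then kills W. -/
theorem eq_zero_of_euler_eq_mul {N W : Ser} (hN : MvPowerSeries.constantCoeff N = 0)
    (hW : euler W = N * W) (h0 : MvPowerSeries.constantCoeff W = 0) : W = 0 := by
  classical
  ext d
  rw [map_zero]
  induction hm : d.degree using Nat.strong_induction_on generalizing d with
  | _ m ih =>
    by_cases hd : d = 0
    · rw [hd, MvPowerSeries.coeff_zero_eq_constantCoeff_apply, h0]
    · have h1 : (d.degree : ℂ) ≠ 0 := by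
        rw [Nat.cast_ne_zero]
        rwa [Ne, Finsupp.degree_eq_zero_iff]
      have h2 := congrArg (MvPowerSeries.coeff d) hW
      rw [coeff_euler, MvPowerSeries.coeff_mul, Finset.sum_eq_zero] at h2
      · exact (mul_eq_zero.1 h2).resolve_left h1
      · intro p hp
        rw [Finset.HasAntidiagonal.mem_antidiagonal] at hp
        by_cases hp1 : p.1 = 0
        · rw [hp1, MvPowerSeries.coeff_zero_eq_constantCoeff_apply, hN, zero_mul]
        · rw [ih p.2.degree _ p.2 rfl, mul_zero]
          have h3 : p.1.degree ≠ 0 := by rwa [Ne, Finsupp.degree_eq_zero_iff]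
          have h4 := congrArg Finsupp.degree hp
          rw [map_add] at h4
          omega

/-- A series is determined by its constant term and its logarithmic derivative. This is the device
by which product identities are reduced to additive ones without introducing logarithms. -/
theorem eq_of_euler_eq_mul {N U V : Ser} (hN : MvPowerSeries.constantCoeff N = 0)
    (hU : euler U = N * U) (hV : euler V = N * V)
    (h0 : MvPowerSeries.constantCoeff U = MvPowerSeries.constantCoeff V) : U = V := by
  rw [← sub_eq_zero]
  apply eq_zero_of_euler_eq_mul hN
  · rw [map_sub, hU, hV, mul_sub]
  · rw [map_sub, h0, sub_self]

/-! ### The exponential series -/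

/-- The exponential of a series without constant term. -/
def pexp {σ : Type*} (a : MvPowerSeries σ ℂ) : MvPowerSeries σ ℂ :=
  PowerSeries.subst a (PowerSeries.exp ℂ)

theorem subst_pexp {σ τ : Type*} {b : σ → MvPowerSeries τ ℂ} (hb : MvPowerSeries.HasSubst b)
    {a : MvPowerSeries σ ℂ} (ha : MvPowerSeries.constantCoeff a = 0) :
    MvPowerSeries.subst b (pexp a) = pexp (MvPowerSeries.subst b a) :=
  MvPowerSeries.subst_comp_subst_apply
    (PowerSeries.HasSubst.of_constantCoeff_zero ha).const hb _

theorem coeff_pow_eq_zero {a : Ser} (ha : MvPowerSeries.constantCoeff a = 0) (n : ℕ) :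
    ∀ d : ℕ →₀ ℕ, d.degree < n → MvPowerSeries.coeff d (a ^ n) = 0 := by
  classical
  induction n with
  | zero => intro d hd; omega
  | succ n ih =>
    intro d hd
    rw [pow_succ, MvPowerSeries.coeff_mul]
    refine Finset.sum_eq_zero fun p hp => ?_
    rw [Finset.HasAntidiagonal.mem_antidiagonal] at hp
    by_cases h : p.2 = 0
    · rw [h, MvPowerSeries.coeff_zero_eq_constantCoeff_apply, ha, mul_zero]
    · have h3 : p.2.degree ≠ 0 := by rwa [Ne, Finsupp.degree_eq_zero_iff]
      have h4 := congrArg Finsupp.degree hp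
      rw [map_add] at h4
      rw [ih p.1 (by omega), zero_mul]

theorem coeff_pexp {a : Ser} (ha : MvPowerSeries.constantCoeff a = 0) {N : ℕ} {d : ℕ →₀ ℕ}
    (hd : d.degree < N) : MvPowerSeries.coeff d (pexp a) =
      MvPowerSeries.coeff d (∑ n ∈ Finset.range N, ((n.factorial : ℂ)⁻¹) • a ^ n) := by
  rw [pexp, PowerSeries.coeff_subst (PowerSeries.HasSubst.of_constantCoeff_zero ha), map_sum,
    finsum_eq_sum_of_support_subset (s := Finset.range N)]
  · refine Finset.sum_congr rfl fun n _ => ?_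
    rw [PowerSeries.coeff_exp, MvPowerSeries.coeff_smul]
    simp
  · intro n hn
    rw [Finset.coe_range, Set.mem_Iio]
    by_contra h
    apply hn
    beta_reduce
    rw [coeff_pow_eq_zero ha n d (by omega), smul_zero]

theorem constantCoeff_pexp {a : Ser} (ha : MvPowerSeries.constantCoeff a = 0) :
    MvPowerSeries.constantCoeff (pexp a) = 1 := by
  rw [← MvPowerSeries.coeff_zero_eq_constantCoeff_apply, coeff_pexp ha (N := 1) (by simp)]
  simp

theorem euler_pow (a : Ser) (n : ℕ) :
    euler (a ^ (n + 1)) = ((n + 1 : ℕ) : ℂ) • (euler a * a ^ n) := by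
  induction n with
  | zero => simp
  | succ n ih =>
    rw [pow_succ, euler_mul, ih, pow_succ]
    push_cast
    simp only [Algebra.smul_def, map_add, map_one]
    ring

theorem euler_pexp {a : Ser} (ha : MvPowerSeries.constantCoeff a = 0) :
    euler (pexp a) = euler a * pexp a := by
  classical
  ext d
  have h1 : MvPowerSeries.coeff d (euler a * pexp a) = MvPowerSeries.coeff d
      (euler a * ∑ n ∈ Finset.range (d.degree + 1), ((n.factorial : ℂ)⁻¹) • a ^ n) := by
    rw [MvPowerSeries.coeff_mul, MvPowerSeries.coeff_mul]
    refine Finset.sum_congr rfl fun p hp => ?_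
    rw [Finset.HasAntidiagonal.mem_antidiagonal] at hp
    rw [coeff_pexp ha (N := d.degree + 1)]
    rw [← hp, map_add]
    omega
  -- The exponential on the left is cut off one term later, since the derivation turns
  -- a^(n+1)/(n+1)! into (euler a)·a^n/n!.
  rw [h1, coeff_euler, coeff_pexp ha (N := d.degree + 2) (by omega), ← coeff_euler]
  congr 1
  rw [Finset.sum_range_succ', map_add, map_sum, Finset.mul_sum, pow_zero, map_smul, euler_one,
    smul_zero, add_zero]
  refine Finset.sum_congr rfl fun n _ => ?_
  rw [map_smul, euler_pow, smul_smul, mul_smul_comm]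
  congr 1
  rw [Nat.factorial_succ]
  have : ((n + 1 : ℕ) : ℂ) ≠ 0 := Nat.cast_ne_zero.2 (by omega)
  push_cast at this ⊢
  field_simp

/-! ### Weighted sums of the `p_k[g]` -/

/-- The series `∑_{k ≥ 1} w_k p_k[g]`. -/
def sumPleth (w : ℕ+ → ℂ) (g : Ser) : Ser := fun e =>
  ∑ k ∈ Finset.Iic (Nat.succPNat e.degree), w k * MvPowerSeries.coeff e (psumPleth k g)

theorem coeff_sumPleth (w : ℕ+ → ℂ) (g : Ser) (e : ℕ →₀ ℕ) :
    MvPowerSeries.coeff e (sumPleth w g) =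
      ∑ k ∈ Finset.Iic (Nat.succPNat e.degree), w k * MvPowerSeries.coeff e (psumPleth k g) := rfl

theorem sumPleth_add (w : ℕ+ → ℂ) (f g : Ser) :
    sumPleth w (f + g) = sumPleth w f + sumPleth w g := by
  ext e
  simp only [map_add, coeff_sumPleth, psumPleth_add, mul_add, Finset.sum_add_distrib]

theorem constantCoeff_sumPleth (w : ℕ+ → ℂ) {g : Ser} (hg : MvPowerSeries.constantCoeff g = 0) :
    MvPowerSeries.constantCoeff (sumPleth w g) = 0 := by
  rw [← MvPowerSeries.coeff_zero_eq_constantCoeff_apply, coeff_sumPleth]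
  refine Finset.sum_eq_zero fun k _ => ?_
  rw [MvPowerSeries.coeff_zero_eq_constantCoeff_apply, constantCoeff_psumPleth, hg, mul_zero]

/-- If g has no constant term, p_k[g] starts in degree k, so the cutoff k ≤ deg e + 1 in `sumPleth`
loses nothing. The extra 1 keeps the bound a positive integer when deg e = 0. -/
theorem coeff_psumPleth_of_degree_lt {k : ℕ+} {g : Ser} (hg : MvPowerSeries.constantCoeff g = 0)
    {e : ℕ →₀ ℕ} (h : e.degree < k) : MvPowerSeries.coeff e (psumPleth k g) = 0 := by
  by_cases hk : ∀ i, (k : ℕ) ∣ e i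
  · obtain ⟨m, rfl⟩ := eq_smul_of_forall_dvd hk
    have hm : m = 0 := by
      rw [← Finsupp.degree_eq_zero_iff]
      by_contra h'
      rw [map_nsmul, smul_eq_mul] at h
      have := Nat.le_mul_of_pos_right (k : ℕ) (Nat.pos_of_ne_zero h')
      omega
    rw [coeff_smul_psumPleth, hm, MvPowerSeries.coeff_zero_eq_constantCoeff_apply, hg]
  · push Not at hk
    obtain ⟨i, hi⟩ := hk
    exact coeff_psumPleth_of_not_dvd k g hi

/-- The weight 1/k cancels the factor k of `euler_psumPleth`. -/
theorem euler_sumPleth (g : Ser) :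
    euler (sumPleth (fun k => ((k : ℕ) : ℂ)⁻¹) g) = sumPleth 1 (euler g) := by
  ext e
  rw [coeff_euler, coeff_sumPleth, coeff_sumPleth, Finset.mul_sum]
  refine Finset.sum_congr rfl fun k _ => ?_
  have h := congrArg (MvPowerSeries.coeff e) (euler_psumPleth k g)
  rw [coeff_euler, MvPowerSeries.coeff_smul] at h
  have hk : ((k : ℕ) : ℂ) ≠ 0 := Nat.cast_ne_zero.2 k.ne_zero
  rw [mul_left_comm, h, Pi.one_apply, one_mul, inv_mul_cancel_left₀ hk]

/-- The series `∑_{k ≥ 1} w_k X_k`. -/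
def linSeries (w : ℕ+ → ℂ) : MvPowerSeries ℕ+ ℂ := fun d =>
  ∑ k ∈ d.support, if d = Finsupp.single k 1 then w k else 0

theorem coeff_linSeries (w : ℕ+ → ℂ) (d : ℕ+ →₀ ℕ) : MvPowerSeries.coeff d (linSeries w) =
    ∑ k ∈ d.support, if d = Finsupp.single k 1 then w k else 0 := rfl

/-- This exhibits ∑ w_k p_k[g] as the plethysm by ∑ w_k p_k, so that a formula for H in terms of ∑
p_k/k carries over to H[g]. -/
theorem subst_linSeries (w : ℕ+ → ℂ) {g : Ser} (hg : MvPowerSeries.constantCoeff g = 0) :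
    MvPowerSeries.subst (fun k : ℕ+ => psumPleth k g) (linSeries w) = sumPleth w g := by
  classical
  ext e
  have hinj : Function.Injective fun k : ℕ+ => (Finsupp.single k 1 : ℕ+ →₀ ℕ) :=
    Finsupp.single_left_injective one_ne_zero
  rw [MvPowerSeries.coeff_subst (hasSubst_psumPleth hg), coeff_sumPleth,
    finsum_eq_sum_of_support_subset
      (s := (Finset.Iic (Nat.succPNat e.degree)).image fun k => Finsupp.single k 1),
    Finset.sum_image hinj.injOn]
  · refine Finset.sum_congr rfl fun k _ => ?_
    rw [coeff_linSeries, Finsupp.support_single k one_ne_zero, Finset.sum_singleton, if_pos rfl,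
      Finsupp.prod_single_index (h := fun s n => psumPleth s g ^ n) (pow_zero _),
      pow_one, smul_eq_mul]
  · intro d hd
    rw [Function.mem_support] at hd
    have h1 := left_ne_zero_of_smul hd
    rw [coeff_linSeries] at h1
    obtain ⟨k, -, hk⟩ := Finset.exists_ne_zero_of_sum_ne_zero h1
    have hdk : d = Finsupp.single k 1 := by
      by_contra h
      rw [if_neg h] at hk
      exact hk rfl
    subst hdk
    rw [Finset.mem_coe, Finset.mem_image]
    refine ⟨k, ?_, rfl⟩
    rw [Finset.mem_Iic, ← PNat.coe_le_coe, Nat.succPNat_coe]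
    by_contra h
    apply hd
    rw [Finsupp.prod_single_index (h := fun s n => psumPleth s g ^ n) (pow_zero _),
      pow_one, coeff_psumPleth_of_degree_lt hg, smul_zero]
    omega

theorem constantCoeff_linSeries (w : ℕ+ → ℂ) :
    MvPowerSeries.constantCoeff (linSeries w) = 0 := by
  rw [← MvPowerSeries.coeff_zero_eq_constantCoeff_apply, coeff_linSeries]
  simp

theorem evalPsum_eq_subst (P : MvPowerSeries ℕ+ ℂ) :
    evalPsum P = MvPowerSeries.subst (fun k : ℕ+ => psumPleth k (psum 1)) P := by
  simp only [evalPsum, psumPleth_psum, mul_one]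

/-! ### The series `H`, `E` and `H^±` -/

theorem coeff_hsymm (n : ℕ) (d : ℕ →₀ ℕ) :
    MvPowerSeries.coeff d (hsymm n) = if d.degree = n then 1 else 0 := rfl

theorem coeff_esymm (n : ℕ) (d : ℕ →₀ ℕ) :
    MvPowerSeries.coeff d (esymm n) =
      open Classical in if d.degree = n ∧ ∀ i, d i ≤ 1 then 1 else 0 := rfl

theorem isHomog_hsymm (n : ℕ) : IsHomog (hsymm n) n := fun d hd => by
  rw [coeff_hsymm, if_neg hd]

theorem isHomog_esymm (n : ℕ) : IsHomog (esymm n) n := fun d hd => by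
  rw [coeff_esymm, if_neg fun h => hd h.1]

theorem isSymmSeries_hsymm (n : ℕ) : IsSymmSeries (hsymm n) := fun σ d => by
  rw [coeff_hsymm, coeff_hsymm, Finsupp.degree_mapDomain]

theorem isSymmSeries_esymm (n : ℕ) : IsSymmSeries (esymm n) := fun σ d => by
  rw [coeff_esymm, coeff_esymm, Finsupp.degree_mapDomain]
  have : (∀ i, d.mapDomain σ i ≤ 1) ↔ ∀ i, d i ≤ 1 := by
    rw [← σ.forall_congr_right]
    refine forall_congr' fun i => ?_
    rw [Finsupp.mapDomain_apply σ.injective]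
  classical exact if_congr (and_congr Iff.rfl this) rfl rfl

theorem isSymmSeries_hSeries : IsSymmSeries hSeries := isSymmSeries_sumAll isSymmSeries_hsymm

theorem isSymmSeries_eSeries : IsSymmSeries eSeries := isSymmSeries_sumAll isSymmSeries_esymm

theorem isSymmSeries_hpmSeries : IsSymmSeries hpmSeries :=
  isSymmSeries_sumAll fun n => (isSymmSeries_hsymm n).smul _

theorem coeff_hSeries (d : ℕ →₀ ℕ) : MvPowerSeries.coeff d hSeries = 1 := by
  rw [hSeries, coeff_sumAll, coeff_hsymm, if_pos rfl]

theorem coeff_hpmSeries (d : ℕ →₀ ℕ) : MvPowerSeries.coeff d hpmSeries = (-1) ^ d.degree := by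
  rw [hpmSeries, coeff_sumAll, MvPowerSeries.coeff_smul, coeff_hsymm, if_pos rfl, mul_one]

theorem coeff_eSeries (d : ℕ →₀ ℕ) : MvPowerSeries.coeff d eSeries =
    open Classical in if ∀ i, d i ≤ 1 then 1 else 0 := by
  rw [eSeries, coeff_sumAll, coeff_esymm]
  classical exact if_congr (and_iff_right rfl) rfl rfl

theorem constantCoeff_hSeries : MvPowerSeries.constantCoeff hSeries = 1 := by
  rw [← MvPowerSeries.coeff_zero_eq_constantCoeff_apply, coeff_hSeries]

theorem coeff_sumPleth_psum_one (d : ℕ →₀ ℕ) :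
    MvPowerSeries.coeff d (sumPleth 1 (psum 1)) =
      open Classical in if ∃ i k, k ≠ 0 ∧ d = Finsupp.single i k then 1 else 0 := by
  classical
  rw [coeff_sumPleth]
  simp only [Pi.one_apply, one_mul, psumPleth_psum, mul_one]
  split_ifs with h
  · obtain ⟨i, k, hk, rfl⟩ := h
    rw [Finset.sum_eq_single (Nat.toPNat k (Nat.pos_of_ne_zero hk))]
    · rw [coeff_psum, if_pos ⟨i, rfl⟩]
    · intro b _ hb
      rw [coeff_psum, if_neg]
      rintro ⟨j, hj⟩
      rw [Finsupp.single_eq_single_iff] at hj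
      rcases hj with ⟨-, h⟩ | ⟨h, -⟩
      · exact hb (PNat.coe_injective h.symm)
      · exact hk h
    · intro h
      exfalso
      apply h
      rw [Finset.mem_Iic, ← PNat.coe_le_coe, Nat.succPNat_coe, Finsupp.degree_single]
      exact Nat.le_succ k
  · refine Finset.sum_eq_zero fun k _ => ?_
    rw [coeff_psum, if_neg]
    rintro ⟨i, hi⟩
    exact h ⟨i, k, k.ne_zero, hi⟩

/-- ∑ p_k is the sum of all pure powers x_i^k with k ≥ 1. The monomial x^d is a pure power times a
monomial in ∑ d_i = deg d ways, one for each i and each 1 ≤ k ≤ d_i. -/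
theorem euler_hSeries : euler hSeries = sumPleth 1 (psum 1) * hSeries := by
  classical
  ext d
  rw [coeff_euler, coeff_hSeries, MvPowerSeries.coeff_mul, mul_one]
  simp only [coeff_hSeries, mul_one, coeff_sumPleth_psum_one]
  rw [← Finset.sum_filter, Finset.sum_const, nsmul_eq_mul, mul_one, Nat.cast_inj]
  have h1 : d.degree = (d.support.sigma fun i => Finset.Icc 1 (d i)).card := by
    rw [Finset.card_sigma, Finsupp.degree_apply]
    exact Finset.sum_congr rfl fun i _ => by simp
  rw [h1]
  refine Finset.card_bij (fun x _ => (Finsupp.single x.1 x.2, d - Finsupp.single x.1 x.2)) ?_ ?_ ?_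
  · rintro ⟨i, k⟩ hx
    rw [Finset.mem_sigma, Finset.mem_Icc] at hx
    rw [Finset.mem_filter, Finset.HasAntidiagonal.mem_antidiagonal]
    refine ⟨add_tsub_cancel_of_le (Finsupp.single_le_iff.2 hx.2.2), i, k, ?_, rfl⟩
    exact (Nat.lt_of_lt_of_le Nat.zero_lt_one hx.2.1).ne'
  · rintro ⟨i, k⟩ hx ⟨j, l⟩ _ h
    rw [Finset.mem_sigma, Finset.mem_Icc] at hx
    have h2 := (Prod.ext_iff.1 h).1
    simp only at h2 hx
    rw [Finsupp.single_eq_single_iff] at h2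
    rcases h2 with ⟨rfl, rfl⟩ | ⟨h, -⟩
    · rfl
    · omega
  · rintro ⟨a, b⟩ hab
    rw [Finset.mem_filter, Finset.HasAntidiagonal.mem_antidiagonal] at hab
    obtain ⟨h2, i, k, hk, h3⟩ := hab
    simp only at h2 h3
    subst h3
    subst h2
    refine ⟨⟨i, k⟩, ?_, ?_⟩
    · rw [Finset.mem_sigma, Finset.mem_Icc]
      simp only [Finsupp.mem_support_iff, Finsupp.add_apply, Finsupp.single_eq_same]
      omega
    · simp

theorem constantCoeff_psum_one : MvPowerSeries.constantCoeff (psum 1) = 0 :=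
  constantCoeff_psum one_ne_zero

theorem hSeries_eq_pexp :
    hSeries = pexp (sumPleth (fun k => ((k : ℕ) : ℂ)⁻¹) (psum 1)) := by
  have h := constantCoeff_sumPleth (fun k => ((k : ℕ) : ℂ)⁻¹) constantCoeff_psum_one
  refine eq_of_euler_eq_mul (constantCoeff_sumPleth 1 constantCoeff_psum_one) euler_hSeries ?_ ?_
  · rw [euler_pexp h, euler_sumPleth, euler_of_isHomog (isHomog_psum 1), Nat.cast_one, one_smul]
  · rw [constantCoeff_pexp h, constantCoeff_hSeries]

/-- The formula H = exp(∑ p_k/k) is first lifted to the indeterminates X_k; there p_k may be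
replaced by p_k[g]. -/
theorem pleth_hSeries {g : Ser} (hg : MvPowerSeries.constantCoeff g = 0) :
    pleth hSeries g = pexp (sumPleth (fun k => ((k : ℕ) : ℂ)⁻¹) g) := by
  have h : hSeries = evalPsum (pexp (linSeries fun k => ((k : ℕ) : ℂ)⁻¹)) := by
    rw [evalPsum_eq_subst, subst_pexp (hasSubst_psumPleth constantCoeff_psum_one)
      (constantCoeff_linSeries _), subst_linSeries _ constantCoeff_psum_one, ← hSeries_eq_pexp]
  rw [h, pleth_evalPsum, subst_pexp (hasSubst_psumPleth hg) (constantCoeff_linSeries _),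
    subst_linSeries _ hg]

theorem constantCoeff_pleth_hSeries {g : Ser} (hg : MvPowerSeries.constantCoeff g = 0) :
    MvPowerSeries.constantCoeff (pleth hSeries g) = 1 := by
  rw [pleth_hSeries hg, constantCoeff_pexp (constantCoeff_sumPleth _ hg)]

theorem euler_pleth_hSeries {g : Ser} (hg : MvPowerSeries.constantCoeff g = 0) :
    euler (pleth hSeries g) = sumPleth 1 (euler g) * pleth hSeries g := by
  rw [pleth_hSeries hg, euler_pexp (constantCoeff_sumPleth _ hg), euler_sumPleth]

/-- Both sides have the logarithmic derivative ∑ p_k[D(f + g)], D being the Euler derivation, which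
is additive. -/
theorem pleth_hSeries_add {f g : Ser} (hf : MvPowerSeries.constantCoeff f = 0)
    (hg : MvPowerSeries.constantCoeff g = 0) :
    pleth hSeries (f + g) = pleth hSeries f * pleth hSeries g := by
  have hfg : MvPowerSeries.constantCoeff (f + g) = 0 := by rw [map_add, hf, hg, add_zero]
  refine eq_of_euler_eq_mul (constantCoeff_sumPleth 1 (constantCoeff_euler (f + g)))
    (euler_pleth_hSeries hfg) ?_ ?_
  · rw [euler_mul, euler_pleth_hSeries hf, euler_pleth_hSeries hg, map_add, sumPleth_add]
    ring
  · rw [map_mul, constantCoeff_pleth_hSeries hf, constantCoeff_pleth_hSeries hg,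
      constantCoeff_pleth_hSeries hfg, one_mul]

/-- This is ∏(1 + x_i)·∏(1 - x_i²)^{-1} = ∏(1 - x_i)^{-1}: every monomial is uniquely a squarefree
monomial times a square, by the remainders and quotients of its exponents modulo 2. -/
theorem eSeries_mul_psumPleth_hSeries : eSeries * psumPleth 2 hSeries = hSeries := by
  classical
  ext d
  rw [coeff_hSeries, MvPowerSeries.coeff_mul]
  let m : ℕ →₀ ℕ := d.mapRange (· / 2) (Nat.zero_div 2)
  let r : ℕ →₀ ℕ := d.mapRange (· % 2) (Nat.zero_mod 2)
  have hd : r + (2 : ℕ) • m = d := by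
    ext i
    simp only [r, m, Finsupp.add_apply, Finsupp.smul_apply, Finsupp.mapRange_apply, smul_eq_mul]
    omega
  have hc : ∀ x : ℕ →₀ ℕ, MvPowerSeries.coeff ((2 : ℕ) • x) (psumPleth 2 hSeries) = 1 :=
    fun x => (coeff_smul_psumPleth 2 hSeries x).trans (coeff_hSeries x)
  rw [Finset.sum_eq_single (r, (2 : ℕ) • m)]
  · rw [hc, coeff_eSeries, if_pos, mul_one]
    intro i
    simp only [r, Finsupp.mapRange_apply]
    omega
  · rintro ⟨a, b⟩ hab hne
    rw [Finset.HasAntidiagonal.mem_antidiagonal] at hab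
    by_cases h1 : ∀ i, a i ≤ 1
    · by_cases h2 : ∀ i, 2 ∣ b i
      · exfalso
        apply hne
        have h3 : ∀ i, a i + b i = d i := fun i => by rw [← Finsupp.add_apply, hab]
        rw [Prod.mk.injEq]
        constructor
        · ext i
          have := h1 i; have := h2 i; have := h3 i
          simp only [r, Finsupp.mapRange_apply]
          omega
        · ext i
          have := h1 i; have := h2 i; have := h3 i
          simp only [m, Finsupp.smul_apply, Finsupp.mapRange_apply, smul_eq_mul]
          omega
      · push Not at h2
        obtain ⟨i, hi⟩ := h2
        rw [coeff_psumPleth_of_not_dvd 2 hSeries hi, mul_zero]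
    · rw [coeff_eSeries, if_neg h1, zero_mul]
  · intro h
    exact absurd (Finset.HasAntidiagonal.mem_antidiagonal.2 hd) h

/-- H^± is H with x_i replaced by -x_i, so its logarithmic derivative is ∑ (-1)^k p_k. The form
given here is twice the even part minus the whole. -/
theorem euler_hpmSeries : euler hpmSeries =
    (2 * psumPleth 2 (sumPleth 1 (psum 1)) - sumPleth 1 (psum 1)) * hpmSeries := by
  classical
  have key : ∀ a : ℕ →₀ ℕ, MvPowerSeries.coeff a
      (2 * psumPleth 2 (sumPleth 1 (psum 1)) - sumPleth 1 (psum 1)) =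
        (-1) ^ a.degree * MvPowerSeries.coeff a (sumPleth 1 (psum 1)) := by
    intro a
    rw [map_sub, show (2 : Ser) = MvPowerSeries.C (2 : ℂ) from (map_ofNat MvPowerSeries.C 2).symm,
      MvPowerSeries.coeff_C_mul]
    by_cases h : ∀ i, 2 ∣ a i
    · obtain ⟨m, rfl⟩ := eq_smul_of_forall_dvd h
      have h1 := coeff_smul_psumPleth 2 (sumPleth 1 (psum 1)) m
      rw [PNat.val_ofNat] at h1
      have h2 : MvPowerSeries.coeff (2 • m) (sumPleth 1 (psum 1)) =
          MvPowerSeries.coeff m (sumPleth 1 (psum 1)) := by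
        rw [coeff_sumPleth_psum_one, coeff_sumPleth_psum_one]
        congr 1
        apply propext
        refine exists_congr fun i => ⟨?_, ?_⟩
        · rintro ⟨k, hk, h3⟩
          refine ⟨m i, ?_, ?_⟩
          · have := DFunLike.congr_fun h3 i
            simp only [Finsupp.smul_apply, smul_eq_mul, Finsupp.single_eq_same] at this
            omega
          · ext j
            have := DFunLike.congr_fun h3 j
            simp only [Finsupp.smul_apply, smul_eq_mul, Finsupp.single_apply] at this ⊢
            split_ifs at this ⊢ with hij
            · rw [hij]
            · omega
        · rintro ⟨k, hk, rfl⟩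
          exact ⟨2 * k, by omega, by simp⟩
      rw [h1, h2, map_nsmul, smul_eq_mul, pow_mul, neg_one_sq, one_pow]
      ring
    · push Not at h
      obtain ⟨i, hi⟩ := h
      rw [coeff_psumPleth_of_not_dvd 2 _ hi, coeff_sumPleth_psum_one]
      split_ifs with h1
      · obtain ⟨j, k, hk, rfl⟩ := h1
        have : Odd k := by
          rw [Finsupp.single_apply] at hi
          split_ifs at hi
          · rwa [← Nat.not_even_iff_odd, even_iff_two_dvd]
          · simp at hi
        rw [Finsupp.degree_single, this.neg_one_pow]
        ring
      · ring
  ext d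
  have h := congrArg (MvPowerSeries.coeff d) euler_hSeries
  rw [coeff_euler, coeff_hSeries, mul_one] at h
  rw [coeff_euler, coeff_hpmSeries, h, MvPowerSeries.coeff_mul, MvPowerSeries.coeff_mul,
    Finset.sum_mul]
  refine Finset.sum_congr rfl fun p hp => ?_
  rw [Finset.HasAntidiagonal.mem_antidiagonal] at hp
  rw [key, coeff_hSeries, coeff_hpmSeries, ← hp, map_add, pow_add]
  ring

/-- H(x)H(-x) = H(x²); the odd power sums cancel in the sum of the two logarithmic derivatives. -/
theorem hSeries_mul_hpmSeries : hSeries * hpmSeries = psumPleth 2 hSeries := by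
  have hp := constantCoeff_sumPleth 1 constantCoeff_psum_one
  refine eq_of_euler_eq_mul (N := 2 * psumPleth 2 (sumPleth 1 (psum 1))) ?_ ?_ ?_ ?_
  · rw [map_mul, constantCoeff_psumPleth, hp, mul_zero]
  · rw [euler_mul, euler_hSeries, euler_hpmSeries]
    ring
  · rw [euler_psumPleth, euler_hSeries, psumPleth_mul, PNat.val_ofNat, Nat.cast_ofNat,
      Algebra.smul_def, map_ofNat, mul_assoc]
  · rw [map_mul, constantCoeff_psumPleth, constantCoeff_hSeries, one_mul,
      ← MvPowerSeries.coeff_zero_eq_constantCoeff_apply, coeff_hpmSeries, map_zero, pow_zero]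

theorem hSeries_ne_zero : hSeries ≠ 0 := fun h => by
  have := constantCoeff_hSeries
  rw [h, map_zero] at this
  exact zero_ne_one this

theorem eSeries_mul_hpmSeries : eSeries * hpmSeries = 1 := by
  apply mul_left_cancel₀ hSeries_ne_zero
  rw [mul_left_comm, hSeries_mul_hpmSeries, eSeries_mul_psumPleth_hSeries, mul_one]

/-- `E^± = ∑_{r ≥ 0} (-1)^r e_r`. -/
def epmSeries : Ser := sumAll fun r => (-1 : ℂ) ^ r • esymm r

theorem isSymmSeries_epmSeries : IsSymmSeries epmSeries :=
  isSymmSeries_sumAll fun n => (isSymmSeries_esymm n).smul _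

theorem coeff_epmSeries (d : ℕ →₀ ℕ) : MvPowerSeries.coeff d epmSeries =
    (-1) ^ d.degree * MvPowerSeries.coeff d eSeries := rfl

/-- The identity E·H^± = 1 after x_i ↦ -x_i, carried out as a sign (-1)^deg on each coefficient. -/
theorem epmSeries_mul_hSeries : epmSeries * hSeries = 1 := by
  classical
  ext d
  have h := congrArg (fun f => (-1) ^ d.degree * MvPowerSeries.coeff d f) eSeries_mul_hpmSeries
  rw [MvPowerSeries.coeff_mul, Finset.mul_sum] at h
  have h1 : (-1) ^ d.degree * MvPowerSeries.coeff d (1 : Ser) = MvPowerSeries.coeff d 1 := by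
    rw [MvPowerSeries.coeff_one]
    split_ifs with hd
    · simp [hd]
    · rw [mul_zero]
  rw [h1] at h
  rw [← h, MvPowerSeries.coeff_mul]
  refine Finset.sum_congr rfl fun p hp => ?_
  rw [Finset.HasAntidiagonal.mem_antidiagonal] at hp
  rw [coeff_epmSeries, coeff_hSeries, coeff_hpmSeries, ← hp, map_add, pow_add]
  have h2 : ((-1 : ℂ) ^ p.2.degree) * (-1) ^ p.2.degree = 1 := by
    rw [← mul_pow, neg_one_mul, neg_neg, one_pow]
  linear_combination (-(-1) ^ p.1.degree * MvPowerSeries.coeff p.1 eSeries) * h2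

/-! ### Plethysm by `H`, `E`, `H^±` and `E^±` -/

theorem pleth_hSeries_zero : pleth hSeries 0 = 1 := by
  have h0 : MvPowerSeries.constantCoeff (0 : Ser) = 0 := map_zero _
  have h := pleth_hSeries_add h0 h0
  have h1 : pleth hSeries 0 ≠ 0 := fun h => by
    have := constantCoeff_pleth_hSeries h0
    rw [h, map_zero] at this
    exact zero_ne_one this
  rw [add_zero] at h
  exact (mul_eq_left₀ h1).1 h.symm

theorem pleth_hSeries_neg {g : Ser} (hg : MvPowerSeries.constantCoeff g = 0) :
    pleth hSeries (-g) * pleth hSeries g = 1 := by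
  rw [← pleth_hSeries_add (by rw [map_neg, hg, neg_zero]) hg, neg_add_cancel, pleth_hSeries_zero]

/-- The relation V·p_2[U] = U between U = H[g] and V = E[g]; every passage between symmetric and
exterior powers below rests on it. -/
theorem pleth_eSeries_mul {g : Ser} (hg : MvPowerSeries.constantCoeff g = 0) :
    pleth eSeries g * psumPleth 2 (pleth hSeries g) = pleth hSeries g := by
  rw [← pleth_psumPleth 2 isSymmSeries_hSeries hg, ← pleth_mul isSymmSeries_eSeries
    (isSymmSeries_hSeries.psumPleth 2) hg, eSeries_mul_psumPleth_hSeries]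

theorem pleth_eSeries_mul_hpm {g : Ser} (hg : MvPowerSeries.constantCoeff g = 0) :
    pleth eSeries g * pleth hpmSeries g = 1 := by
  rw [← pleth_mul isSymmSeries_eSeries isSymmSeries_hpmSeries hg, eSeries_mul_hpmSeries,
    pleth_one hg]

theorem pleth_epmSeries_mul {g : Ser} (hg : MvPowerSeries.constantCoeff g = 0) :
    pleth epmSeries g * pleth hSeries g = 1 := by
  rw [← pleth_mul isSymmSeries_epmSeries isSymmSeries_hSeries hg, epmSeries_mul_hSeries,
    pleth_one hg]

theorem pleth_hSeries_ne_zero {g : Ser} (hg : MvPowerSeries.constantCoeff g = 0) :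
    pleth hSeries g ≠ 0 := right_ne_zero_of_mul_eq_one (pleth_hSeries_neg hg)

theorem psumPleth_injective (k : ℕ+) : Function.Injective (psumPleth k) := fun f g h => by
  ext d
  rw [← coeff_smul_psumPleth k f d, h, coeff_smul_psumPleth]

theorem psumPleth_ne_zero (k : ℕ+) {f : Ser} (hf : f ≠ 0) : psumPleth k f ≠ 0 := fun h =>
  hf (psumPleth_injective k (h.trans (map_zero _).symm))

/-- E[g] = H[g]/p_2[H[g]], and both numerator and denominator are multiplicative in g. -/
theorem pleth_eSeries_add {f g : Ser} (hf : MvPowerSeries.constantCoeff f = 0)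
    (hg : MvPowerSeries.constantCoeff g = 0) :
    pleth eSeries (f + g) = pleth eSeries f * pleth eSeries g := by
  have hfg : MvPowerSeries.constantCoeff (f + g) = 0 := by rw [map_add, hf, hg, add_zero]
  apply mul_right_cancel₀ (psumPleth_ne_zero 2 (pleth_hSeries_ne_zero hfg))
  rw [pleth_eSeries_mul hfg, pleth_hSeries_add hf hg, psumPleth_mul]
  conv_lhs => rw [← pleth_eSeries_mul hf, ← pleth_eSeries_mul hg]
  ring

theorem pleth_hpmSeries_add {f g : Ser} (hf : MvPowerSeries.constantCoeff f = 0)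
    (hg : MvPowerSeries.constantCoeff g = 0) :
    pleth hpmSeries (f + g) = pleth hpmSeries f * pleth hpmSeries g := by
  have hfg : MvPowerSeries.constantCoeff (f + g) = 0 := by rw [map_add, hf, hg, add_zero]
  have h := pleth_eSeries_mul_hpm hfg
  rw [pleth_eSeries_add hf hg] at h
  linear_combination (pleth hpmSeries f * pleth hpmSeries g) * h -
    pleth hpmSeries (f + g) * pleth eSeries g * pleth hpmSeries g * pleth_eSeries_mul_hpm hf -
    pleth hpmSeries (f + g) * pleth_eSeries_mul_hpm hg

theorem pleth_epmSeries_add {f g : Ser} (hf : MvPowerSeries.constantCoeff f = 0)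
    (hg : MvPowerSeries.constantCoeff g = 0) :
    pleth epmSeries (f + g) = pleth epmSeries f * pleth epmSeries g := by
  have hfg : MvPowerSeries.constantCoeff (f + g) = 0 := by rw [map_add, hf, hg, add_zero]
  have h := pleth_epmSeries_mul hfg
  rw [pleth_hSeries_add hf hg] at h
  linear_combination (pleth epmSeries f * pleth epmSeries g) * h -
    pleth epmSeries (f + g) * pleth hSeries g * pleth epmSeries g * pleth_epmSeries_mul hf -
    pleth epmSeries (f + g) * pleth_epmSeries_mul hg

/-! ### Uniqueness for equations involving p_k[·] -/

/-- Descent: the coefficient of x^d in W is 0 unless k divides all exponents, and otherwise equals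
the coefficient of x^{d/k}, of smaller degree. -/
theorem eq_one_of_eq_psumPleth {k : ℕ+} (hk : k ≠ 1) {W : Ser} (hW : W = psumPleth k W)
    (h0 : MvPowerSeries.constantCoeff W = 1) : W = 1 := by
  classical
  have hk2 : 2 ≤ (k : ℕ) := by
    have h1 := k.pos
    have h2 : (k : ℕ) ≠ 1 := fun h => hk (PNat.coe_injective h)
    omega
  ext d
  induction hm : d.degree using Nat.strong_induction_on generalizing d with
  | _ m ih =>
    by_cases hd : d = 0
    · rw [hd, MvPowerSeries.coeff_zero_eq_constantCoeff_apply, h0]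
      simp
    · rw [MvPowerSeries.coeff_one, if_neg hd, hW]
      by_cases h : ∀ i, (k : ℕ) ∣ d i
      · obtain ⟨e, rfl⟩ := eq_smul_of_forall_dvd h
        have he : e ≠ 0 := by
          rintro rfl
          exact hd (smul_zero _)
        have he' : e.degree ≠ 0 := by rwa [Ne, Finsupp.degree_eq_zero_iff]
        rw [coeff_smul_psumPleth, ih e.degree _ e rfl, MvPowerSeries.coeff_one, if_neg he]
        rw [← hm, map_nsmul, smul_eq_mul]
        have := Nat.pos_of_ne_zero he'
        nlinarith
      · push Not at h
        obtain ⟨i, hi⟩ := h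
        exact coeff_psumPleth_of_not_dvd k W hi

/-- Both U·p_2[U'] and U'·p_2[U] equal V·p_2[U]·p_2[U'], so the quotient U/U' is fixed by p_2[·] and
has constant term 1. -/
theorem eq_of_eq_mul_psumPleth {U U' V : Ser} (h0 : MvPowerSeries.constantCoeff U = 1)
    (h0' : MvPowerSeries.constantCoeff U' = 1) (h : V * psumPleth 2 U = U)
    (h' : V * psumPleth 2 U' = U') : U = U' := by
  have hU : U' * U'⁻¹ = 1 := MvPowerSeries.mul_inv_cancel _ (by rw [h0']; exact one_ne_zero)
  have h1 : U * U'⁻¹ = 1 := by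
    have hne : U' ≠ 0 := left_ne_zero_of_mul_eq_one hU
    apply eq_one_of_eq_psumPleth (k := 2) (by decide)
    · apply mul_right_cancel₀ (mul_ne_zero hne (psumPleth_ne_zero 2 hne))
      have h2 : psumPleth 2 U' * psumPleth 2 U'⁻¹ = 1 := by
        rw [← psumPleth_mul, hU, psumPleth_one]
      rw [psumPleth_mul]
      linear_combination (U * psumPleth 2 U') * hU - psumPleth 2 U * U' * h2 -
        psumPleth 2 U' * h + psumPleth 2 U * h'
    · rw [map_mul, h0, one_mul, MvPowerSeries.constantCoeff_inv, h0', inv_one]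
  calc U = (U * U'⁻¹) * U' := by rw [mul_assoc, mul_comm _ U', hU, mul_one]
    _ = U' := by rw [h1, one_mul]

/-- The term k = 1 is g itself, and for k ≥ 2 the coefficient of x^d in p_k[g] is 0 or a coefficient
of g in smaller degree, so induction on the degree applies. -/
theorem eq_zero_of_sumPleth_eq_zero {g : Ser} (hg : MvPowerSeries.constantCoeff g = 0)
    (h : sumPleth 1 g = 0) : g = 0 := by
  ext d
  rw [map_zero]
  induction hm : d.degree using Nat.strong_induction_on generalizing d with
  | _ m ih =>
    by_cases hd : d = 0
    · rw [hd, MvPowerSeries.coeff_zero_eq_constantCoeff_apply, hg]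
    · have h1 := congrArg (MvPowerSeries.coeff d) h
      rw [coeff_sumPleth, map_zero, Finset.sum_eq_single 1] at h1
      · rwa [Pi.one_apply, one_mul, psumPleth_one_apply] at h1
      · intro k _ hk
        by_cases hdvd : ∀ i, (k : ℕ) ∣ d i
        · obtain ⟨e, rfl⟩ := eq_smul_of_forall_dvd hdvd
          have hk2 : 2 ≤ (k : ℕ) := by
            have h1 := k.pos
            have h2 : (k : ℕ) ≠ 1 := fun h => hk (PNat.coe_injective h)
            omega
          have he : e ≠ 0 := by
            rintro rfl
            exact hd (smul_zero _)
          have he' : e.degree ≠ 0 := by rwa [Ne, Finsupp.degree_eq_zero_iff]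
          rw [coeff_smul_psumPleth, ih e.degree _ e rfl, mul_zero]
          rw [← hm, map_nsmul, smul_eq_mul]
          have := Nat.pos_of_ne_zero he'
          nlinarith
        · push Not at hdvd
          obtain ⟨i, hi⟩ := hdvd
          rw [coeff_psumPleth_of_not_dvd k g hi, mul_zero]
      · intro h2
        exact absurd (Finset.mem_Iic.2 (one_le)) h2

theorem eq_zero_of_pleth_hSeries_eq_one {g : Ser} (hg : MvPowerSeries.constantCoeff g = 0)
    (h : pleth hSeries g = 1) : g = 0 := by
  have h1 := euler_pleth_hSeries hg
  rw [h, euler_one, mul_one] at h1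
  have h2 := eq_zero_of_sumPleth_eq_zero (constantCoeff_euler g) h1.symm
  ext d
  have h3 := congrArg (MvPowerSeries.coeff d) h2
  rw [coeff_euler, map_zero] at h3
  by_cases hd : d = 0
  · rw [hd, MvPowerSeries.coeff_zero_eq_constantCoeff_apply, hg, map_zero]
  · have h4 : (d.degree : ℂ) ≠ 0 := by rwa [Ne, Nat.cast_eq_zero, Finsupp.degree_eq_zero_iff]
    rw [map_zero]
    exact (mul_eq_zero.1 h3).resolve_left h4

/-- E[f - g] = 1 forces H[f - g] to be fixed by p_2[·], hence to be 1, and then its logarithmic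
derivative forces f - g = 0. -/
theorem pleth_eSeries_injective {f g : Ser} (hf : MvPowerSeries.constantCoeff f = 0)
    (hg : MvPowerSeries.constantCoeff g = 0) (h : pleth eSeries f = pleth eSeries g) : f = g := by
  have hs : MvPowerSeries.constantCoeff (f - g) = 0 := by rw [map_sub, hf, hg, sub_zero]
  have h1 := pleth_eSeries_add hs hg
  rw [sub_add_cancel, h] at h1
  have h2 : pleth eSeries (f - g) = 1 :=
    (mul_eq_right₀ (left_ne_zero_of_mul_eq_one (pleth_eSeries_mul_hpm hg))).1 h1.symm
  have h3 := pleth_eSeries_mul hs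
  rw [h2, one_mul] at h3
  have h4 := eq_one_of_eq_psumPleth (k := 2) (by decide) h3.symm (constantCoeff_pleth_hSeries hs)
  exact sub_eq_zero.1 (eq_zero_of_pleth_hSeries_eq_one hs h4)

/-! ### The involution `p_k ↦ -p_k` -/

/-- The involution `p_k ↦ -p_k`, which is `(-1)^n ω` in degree `n`. -/
def psumNeg (f : Ser) : Ser := pleth f (-psum 1)

theorem constantCoeff_neg_psum_one : MvPowerSeries.constantCoeff (-psum 1) = 0 := by
  rw [map_neg, constantCoeff_psum_one, neg_zero]

theorem isHomog_neg_psum_one : IsHomog (-psum 1) 1 := isHomog_neg (isHomog_psum 1)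

theorem isSymmSeries_psumNeg (f : Ser) : IsSymmSeries (psumNeg f) :=
  isSymmSeries_pleth f (isSymmSeries_psum 1).neg constantCoeff_neg_psum_one

theorem psumNeg_mul {f g : Ser} (hf : IsSymmSeries f) (hg : IsSymmSeries g) :
    psumNeg (f * g) = psumNeg f * psumNeg g := pleth_mul hf hg constantCoeff_neg_psum_one

theorem psumNeg_add {f g : Ser} (hf : IsSymmSeries f) (hg : IsSymmSeries g) :
    psumNeg (f + g) = psumNeg f + psumNeg g := pleth_add hf hg constantCoeff_neg_psum_one

theorem psumNeg_one : psumNeg 1 = 1 := pleth_one constantCoeff_neg_psum_one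

theorem psumNeg_psum (k : ℕ+) : psumNeg (psum k) = -psum k := by
  rw [psumNeg, pleth_psum constantCoeff_neg_psum_one, psumPleth_neg, psumPleth_psum, mul_one]

theorem psumNeg_psumNeg {f : Ser} (hf : IsSymmSeries f) : psumNeg (psumNeg f) = f := by
  have h := psumNeg_psum 1
  rw [PNat.one_coe, psumNeg] at h
  rw [psumNeg, psumNeg, pleth_assoc f (isSymmSeries_psum 1).neg constantCoeff_neg_psum_one
    constantCoeff_neg_psum_one, pleth_neg (isSymmSeries_psum 1) constantCoeff_neg_psum_one,
    h, neg_neg, pleth_psum_one hf]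

theorem comp_psumNeg {f : Ser} (hf : IsSymmSeries f) (n : ℕ) :
    comp n (psumNeg f) = psumNeg (comp n f) := by
  rw [psumNeg, comp_pleth hf one_ne_zero isHomog_neg_psum_one, if_pos (one_dvd n), Nat.div_one,
    psumNeg]

theorem IsHomog.psumNeg {f : Ser} (hf : IsSymmSeries f) {n : ℕ} (h : IsHomog f n) :
    IsHomog (psumNeg f) n := by
  have := isHomog_pleth hf one_ne_zero h isHomog_neg_psum_one
  rwa [one_mul] at this

theorem constantCoeff_eq_zero_iff {f : Ser} : MvPowerSeries.constantCoeff f = 0 ↔ comp 0 f = 0 := by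
  constructor
  · intro h
    ext d
    rw [coeff_comp, map_zero]
    split_ifs with hd
    · rw [Finsupp.degree_eq_zero_iff] at hd
      rw [hd, MvPowerSeries.coeff_zero_eq_constantCoeff_apply, h]
    · rfl
  · intro h
    have := congrArg (MvPowerSeries.coeff 0) h
    rwa [coeff_comp, if_pos (map_zero _), map_zero,
      MvPowerSeries.coeff_zero_eq_constantCoeff_apply] at this

theorem constantCoeff_psumNeg {f : Ser} (hf : IsSymmSeries f)
    (h : MvPowerSeries.constantCoeff f = 0) : MvPowerSeries.constantCoeff (psumNeg f) = 0 := by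
  rw [constantCoeff_eq_zero_iff] at h ⊢
  rw [comp_psumNeg hf, h, psumNeg, pleth_zero_left constantCoeff_neg_psum_one]

/-- Treating p_k ↦ -p_k as plethysm by -p_1 makes this an instance of associativity: the sign change
moves to the inner argument. -/
theorem psumNeg_pleth (f : Ser) {g : Ser} (hg : IsSymmSeries g)
    (h : MvPowerSeries.constantCoeff g = 0) : psumNeg (pleth f g) = pleth f (psumNeg g) :=
  pleth_assoc f hg h constantCoeff_neg_psum_one

theorem hasSubst_signed_psum :
    MvPowerSeries.HasSubst (fun k : ℕ+ => (-1 : ℂ) ^ ((k : ℕ) - 1) • psum k) where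
  const_coeff k := by
    rw [MvPowerSeries.constantCoeff_smul, constantCoeff_psum k.ne_zero, smul_zero]
    exact IsNilpotent.zero
  coeff_zero d := by
    refine Set.Finite.subset (hasSubst_psum.coeff_zero d) ?_
    intro k hk h
    apply hk
    rw [MvPowerSeries.coeff_smul, h, mul_zero]

/-- The sign (-1)^{k-1} of ω at p_k is (-1)^k times the sign -1; over a monomial in the power sums
the factors (-1)^k multiply to (-1)^weight, and the weight is the degree. -/
theorem coeff_omega (f : Ser) (e : ℕ →₀ ℕ) : MvPowerSeries.coeff e (omega f) =
    (-1) ^ e.degree * MvPowerSeries.coeff e (psumNeg f) := by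
  rw [omega, psumNeg, pleth, MvPowerSeries.coeff_subst hasSubst_signed_psum,
    MvPowerSeries.coeff_subst (hasSubst_psumPleth constantCoeff_neg_psum_one), ← smul_eq_mul,
    smul_finsum]
  refine finsum_congr fun d => ?_
  rw [smul_comm]
  congr 1
  have h1 : (d.prod fun k n => ((-1 : ℂ) ^ ((k : ℕ) - 1) • psum k) ^ n) =
      (-1 : ℂ) ^ weight d • d.prod fun k n => psumPleth k (-psum 1) ^ n := by
    rw [weight_eq, ← Finset.prod_pow_eq_pow_sum, Finsupp.prod, Finsupp.prod,
      Algebra.smul_def, map_prod, ← Finset.prod_mul_distrib]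
    refine Finset.prod_congr rfl fun k _ => ?_
    rw [mul_comm (d k), pow_mul, map_pow, ← mul_pow]
    congr 1
    rw [psumPleth_neg, psumPleth_psum, mul_one, ← Algebra.smul_def]
    obtain ⟨m, hm⟩ := Nat.exists_eq_succ_of_ne_zero k.ne_zero
    rw [hm, Nat.succ_sub_one, pow_succ, mul_neg_one, neg_smul, smul_neg, neg_neg]
  have h2 := isHomog_prod_psumPleth isHomog_neg_psum_one d
  rw [one_mul] at h2
  rw [h1, MvPowerSeries.coeff_smul, smul_eq_mul]
  by_cases h : e.degree = weight d
  · rw [h]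
  · rw [h2 e h, mul_zero, mul_zero]

theorem omega_of_isHomog {f : Ser} (hf : IsSymmSeries f) {n : ℕ} (h : IsHomog f n) :
    omega f = (-1 : ℂ) ^ n • psumNeg f := by
  ext e
  rw [coeff_omega, MvPowerSeries.coeff_smul]
  by_cases he : e.degree = n
  · rw [he]
  · rw [h.psumNeg hf e he, mul_zero, mul_zero]

theorem altOmega_of_isHomog {q : ℕ → Ser} {n : ℕ} (hn : n ≠ 0) (hf : IsSymmSeries (q n))
    (h : IsHomog (q n) n) : altOmega q n = -psumNeg (q n) := by
  rw [altOmega, omega_of_isHomog hf h, smul_smul, ← pow_add]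
  have : Odd (n - 1 + n) := ⟨n - 1, by omega⟩
  rw [this.neg_one_pow, neg_one_smul]

/-- A sequence of symmetric functions, homogeneous of degree `n` for `n ≥ 1`. -/
def IsGraded (q : ℕ → Ser) : Prop := ∀ n, n ≠ 0 → IsSymmSeries (q n) ∧ IsHomog (q n) n

theorem IsGraded.altOmega {q : ℕ → Ser} (hq : IsGraded q) : IsGraded (altOmega q) := by
  intro n hn
  rw [altOmega_of_isHomog hn (hq n hn).1 (hq n hn).2]
  exact ⟨(isSymmSeries_psumNeg _).neg, isHomog_neg ((hq n hn).2.psumNeg (hq n hn).1)⟩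

theorem IsGraded.isSymmSeries_sumPos {q : ℕ → Ser} (hq : IsGraded q) :
    IsSymmSeries (sumPos q) :=
  PlethLie.isSymmSeries_sumPos fun n hn => (hq n (by omega)).1

/-- In degree n the two signs combine to (-1)^{n-1}(-1)^n = -1, uniformly in n. The sum of the
twisted sequence thus has a closed form to which additivity of H and E applies. -/
theorem sumPos_altOmega {q : ℕ → Ser} (hq : IsGraded q) :
    sumPos (altOmega q) = -psumNeg (sumPos q) := by
  apply eq_of_comp_eq
  intro n
  rw [comp_sumPos n fun hn => (hq.altOmega n hn).2, map_neg, comp_psumNeg hq.isSymmSeries_sumPos,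
    comp_sumPos n fun hn => (hq n hn).2]
  split_ifs with h
  · rw [psumNeg, pleth_zero_left constantCoeff_neg_psum_one, neg_zero]
  · exact altOmega_of_isHomog h (hq n h).1 (hq n h).2

theorem pleth_hSeries_altOmega {q : ℕ → Ser} (hq : IsGraded q) :
    pleth hSeries (sumPos (altOmega q)) * psumNeg (pleth hSeries (sumPos q)) = 1 := by
  rw [sumPos_altOmega hq, psumNeg_pleth _ hq.isSymmSeries_sumPos (constantCoeff_sumPos q)]
  exact pleth_hSeries_neg (constantCoeff_psumNeg hq.isSymmSeries_sumPos (constantCoeff_sumPos q))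

theorem pleth_eSeries_zero : pleth eSeries 0 = 1 := by
  have h := pleth_eSeries_mul (map_zero (MvPowerSeries.constantCoeff (σ := ℕ) (R := ℂ)))
  rwa [pleth_hSeries_zero, psumPleth_one, mul_one] at h

theorem pleth_eSeries_altOmega {q : ℕ → Ser} (hq : IsGraded q) :
    pleth eSeries (sumPos (altOmega q)) * psumNeg (pleth eSeries (sumPos q)) = 1 := by
  rw [sumPos_altOmega hq, psumNeg_pleth _ hq.isSymmSeries_sumPos (constantCoeff_sumPos q),
    ← pleth_eSeries_add, neg_add_cancel, pleth_eSeries_zero]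
  · rw [map_neg, constantCoeff_psumNeg hq.isSymmSeries_sumPos (constantCoeff_sumPos q), neg_zero]
  · exact constantCoeff_psumNeg hq.isSymmSeries_sumPos (constantCoeff_sumPos q)

/-! ### Sums over partitions -/

/-- The factor of the partition generating function that belongs to the part size i + 1: the index j
stands for multiplicity j + 1, and multiplicity 0 gives the leading 1. -/
theorem grade_pleth_eq_one_add_tsum {a : ℕ → Ser} (has : ∀ n, IsSymmSeries (a n))
    (hah : ∀ n, IsHomog (a n) n) (ha0 : a 0 = 1) {g : Ser} {i : ℕ} (hg : IsHomog g (i + 1)) :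
    1 + ∑' j, pleth (a (j + 1)) g • (PowerSeries.X : PowerSeries Ser) ^ ((i + 1) * (j + 1)) =
      grade (pleth (sumAll a) g) := by
  have hi : i + 1 ≠ 0 := Nat.succ_ne_zero i
  have hg0 := constantCoeff_eq_zero_of_isHomog hg hi
  suffices h : HasSum
      (fun j => pleth (a (j + 1)) g • (PowerSeries.X : PowerSeries Ser) ^ ((i + 1) * (j + 1)))
      (grade (pleth (sumAll a) g) - 1) by
    rw [h.tsum_eq, add_sub_cancel]
  rw [PowerSeries.WithPiTopology.hasSum_iff_hasSum_coeff]
  intro n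
  -- Only j + 1 = n/(i + 1) can contribute to degree n. For n = 0 the truncated subtraction selects
  -- j = 0, whose term sits in degree i + 1 and contributes 0, which matches the subtracted 1.
  have hval : PowerSeries.coeff n (grade (pleth (sumAll a) g) - 1) =
      PowerSeries.coeff n (pleth (a (n / (i + 1) - 1 + 1)) g •
        (PowerSeries.X : PowerSeries Ser) ^ ((i + 1) * (n / (i + 1) - 1 + 1))) := by
    rw [map_sub, coeff_grade, comp_pleth (isSymmSeries_sumAll has) hi hg, comp_sumAll _ (hah _),
      PowerSeries.coeff_smul, PowerSeries.coeff_X_pow, PowerSeries.coeff_one]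
    by_cases hn : n = 0
    · subst hn
      rw [if_pos (dvd_zero _), Nat.zero_div, ha0, pleth_one hg0, if_pos rfl, if_neg (by simp)]
      simp
    · rw [if_neg hn, sub_zero]
      by_cases hd : i + 1 ∣ n
      · obtain ⟨m, rfl⟩ := hd
        have hm : m ≠ 0 := by
          rintro rfl
          exact hn (mul_zero _)
        rw [if_pos (dvd_mul_right _ _), Nat.mul_div_cancel_left m (Nat.succ_pos i),
          Nat.sub_add_cancel (Nat.pos_of_ne_zero hm), if_pos rfl, smul_eq_mul, mul_one]
      · rw [if_neg hd, if_neg, smul_zero]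
        intro h
        exact hd ⟨_, h⟩
  rw [hval]
  refine hasSum_single (n / (i + 1) - 1) ?_
  intro b hb
  rw [PowerSeries.coeff_smul, PowerSeries.coeff_X_pow, if_neg, smul_zero]
  rintro rfl
  apply hb
  rw [Nat.mul_div_cancel_left _ (Nat.succ_pos i), Nat.add_sub_cancel]

/-- The sum over partitions is the product over part sizes i of ∑_c a_c[q_i] t^{ic}. By `hadd` a
finite product of such factors is the plethysm by the finite sum of the q_i, and modulo high degree
finite sums suffice. The lemma is stated for a general sequence a so as to serve H, E, H^± and E^±
at once. -/
theorem mk_sum_partition {a : ℕ → Ser} (has : ∀ n, IsSymmSeries (a n))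
    (hah : ∀ n, IsHomog (a n) n) (ha0 : a 0 = 1)
    (hadd : ∀ f g : Ser, MvPowerSeries.constantCoeff f = 0 → MvPowerSeries.constantCoeff g = 0 →
      pleth (sumAll a) (f + g) = pleth (sumAll a) f * pleth (sumAll a) g)
    (hzero : pleth (sumAll a) 0 = 1) {q : ℕ → Ser} (hq : ∀ n, n ≠ 0 → IsHomog (q n) n) :
    (PowerSeries.mk fun n => ∑ μ : n.Partition,
      ∏ i ∈ μ.parts.toFinset, pleth (a (μ.parts.count i)) (q i)) =
      grade (pleth (sumAll a) (sumPos q)) := by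
  have h1 := Nat.Partition.hasProd_genFun fun i c => pleth (a c) (q i)
  have h2 : (fun i => 1 + ∑' j, pleth (a (j + 1)) (q (i + 1)) •
      (PowerSeries.X : PowerSeries Ser) ^ ((i + 1) * (j + 1))) =
      fun i => grade (pleth (sumAll a) (q (i + 1))) :=
    funext fun i => grade_pleth_eq_one_add_tsum has hah ha0 (hq (i + 1) (Nat.succ_ne_zero i))
  rw [h2] at h1
  refine HasProd.unique h1 ?_
  have h0 : ∀ i, MvPowerSeries.constantCoeff (q (i + 1)) = 0 := fun i =>
    constantCoeff_eq_zero_of_isHomog (hq (i + 1) (Nat.succ_ne_zero i)) (Nat.succ_ne_zero i)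
  have hsum0 : ∀ s : Finset ℕ, MvPowerSeries.constantCoeff (∑ i ∈ s, q (i + 1)) = 0 := fun s => by
    rw [map_sum]
    exact Finset.sum_eq_zero fun i _ => h0 i
  have hprod : ∀ s : Finset ℕ, ∏ i ∈ s, grade (pleth (sumAll a) (q (i + 1))) =
      grade (pleth (sumAll a) (∑ i ∈ s, q (i + 1))) := by
    intro s
    induction s using Finset.induction with
    | empty => rw [Finset.prod_empty, Finset.sum_empty, hzero, map_one]
    | insert i s hi ih =>
      rw [Finset.prod_insert hi, Finset.sum_insert hi, hadd _ _ (h0 i) (hsum0 s), map_mul, ih]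
  rw [HasProd, PowerSeries.WithPiTopology.tendsto_iff_coeff_tendsto]
  intro n
  -- Index i stands for part size i + 1, so once s contains all i < n the partial sum agrees with
  -- the full sum in degrees at most n.
  refine tendsto_atTop_of_eventually_const (i₀ := Finset.range n) fun s hs => ?_
  rw [hprod, coeff_grade, coeff_grade]
  refine comp_eq_of_sub_mem_highIdeal (n := n) ?_ le_rfl
  refine pleth_sub_mem_highIdeal _ (hsum0 s) (constantCoeff_sumPos q) ?_
  rw [mem_highIdeal]
  intro e he
  rw [map_sub, map_sum, sub_eq_zero, sumPos, coeff_sumAll]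
  by_cases h : e.degree = 0
  · rw [if_pos h, map_zero]
    refine Finset.sum_eq_zero fun i _ => ?_
    exact hq (i + 1) (Nat.succ_ne_zero i) e (by omega)
  · rw [if_neg h, Finset.sum_eq_single (e.degree - 1)]
    · rw [Nat.sub_add_cancel (Nat.pos_of_ne_zero h)]
    · intro b _ hb
      exact hq (b + 1) (Nat.succ_ne_zero b) e (by omega)
    · intro h'
      exact absurd (hs (Finset.mem_range.2 (by omega))) h'

theorem hsymm_zero : hsymm 0 = 1 := by
  classical
  ext d
  rw [coeff_hsymm, MvPowerSeries.coeff_one]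
  exact if_congr (Finsupp.degree_eq_zero_iff d) rfl rfl

theorem esymm_zero : esymm 0 = 1 := by
  classical
  ext d
  rw [coeff_esymm, MvPowerSeries.coeff_one]
  refine if_congr ⟨fun h => (Finsupp.degree_eq_zero_iff d).1 h.1, ?_⟩ rfl rfl
  rintro rfl
  exact ⟨map_zero _, fun i => Nat.zero_le 1⟩

theorem genH_eq {q : ℕ → Ser} (hq : IsGraded q) : genH q = grade (pleth hSeries (sumPos q)) :=
  mk_sum_partition isSymmSeries_hsymm isHomog_hsymm hsymm_zero
    (fun _ _ hf hg => pleth_hSeries_add hf hg) pleth_hSeries_zero fun n hn => (hq n hn).2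

theorem genE_eq {q : ℕ → Ser} (hq : IsGraded q) : genE q = grade (pleth eSeries (sumPos q)) :=
  mk_sum_partition isSymmSeries_esymm isHomog_esymm esymm_zero
    (fun _ _ hf hg => pleth_eSeries_add hf hg) pleth_eSeries_zero fun n hn => (hq n hn).2

/-- The length is the sum of the multiplicities, so the sign distributes over the factors and the
signed sums are those of the sequences (-1)^r h_r and (-1)^r e_r. -/
theorem prod_neg_one_pow_smul_pleth {a : ℕ → Ser} (ha : ∀ n, IsSymmSeries (a n)) {q : ℕ → Ser}
    (hq : IsGraded q) {n : ℕ} (μ : n.Partition) :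
    ∏ i ∈ μ.parts.toFinset, pleth ((-1 : ℂ) ^ μ.parts.count i • a (μ.parts.count i)) (q i) =
      (-1 : ℂ) ^ len μ • ∏ i ∈ μ.parts.toFinset, pleth (a (μ.parts.count i)) (q i) := by
  rw [len, ← Multiset.toFinset_sum_count_eq, ← Finset.prod_pow_eq_pow_sum, Algebra.smul_def,
    map_prod, ← Finset.prod_mul_distrib]
  refine Finset.prod_congr rfl fun i hi => ?_
  have hi : i ≠ 0 := (μ.parts_pos (Multiset.mem_toFinset.1 hi)).ne'
  rw [pleth_smul _ (ha _) (constantCoeff_eq_zero_of_isHomog (hq i hi).2 hi), Algebra.smul_def]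

theorem genHpm_eq {q : ℕ → Ser} (hq : IsGraded q) :
    genHpm q = grade (pleth hpmSeries (sumPos q)) := by
  have hz : pleth hpmSeries 0 = 1 := by
    have h := pleth_eSeries_mul_hpm (map_zero (MvPowerSeries.constantCoeff (σ := ℕ) (R := ℂ)))
    rwa [pleth_eSeries_zero, one_mul] at h
  have h := mk_sum_partition (a := fun r => (-1 : ℂ) ^ r • hsymm r)
    (fun n => (isSymmSeries_hsymm n).smul _) (fun n => isHomog_smul _ (isHomog_hsymm n))
    (by rw [pow_zero, one_smul, hsymm_zero])
    (fun _ _ hf hg => pleth_hpmSeries_add hf hg) hz fun n hn => (hq n hn).2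
  rw [hpmSeries, ← h, genHpm]
  simp only [prod_neg_one_pow_smul_pleth isSymmSeries_hsymm hq, Hpart]

theorem sum_Hpart {q : ℕ → Ser} (hq : IsGraded q) (n : ℕ) :
    ∑ μ : n.Partition, Hpart q μ = comp n (pleth hSeries (sumPos q)) := by
  rw [← coeff_grade, ← genH_eq hq, genH, PowerSeries.coeff_mk]

theorem sum_Epart {q : ℕ → Ser} (hq : IsGraded q) (n : ℕ) :
    ∑ μ : n.Partition, Epart q μ = comp n (pleth eSeries (sumPos q)) := by
  rw [← coeff_grade, ← genE_eq hq, genE, PowerSeries.coeff_mk]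

theorem sum_signed_Hpart {q : ℕ → Ser} (hq : IsGraded q) (n : ℕ) :
    ∑ μ : n.Partition, (-1 : ℂ) ^ len μ • Hpart q μ = comp n (pleth hpmSeries (sumPos q)) := by
  rw [← coeff_grade, ← genHpm_eq hq, genHpm, PowerSeries.coeff_mk]

theorem sum_signed_Epart {q : ℕ → Ser} (hq : IsGraded q) (n : ℕ) :
    ∑ μ : n.Partition, (-1 : ℂ) ^ len μ • Epart q μ = comp n (pleth epmSeries (sumPos q)) := by
  have hz : pleth epmSeries 0 = 1 := by
    have h := pleth_epmSeries_mul (map_zero (MvPowerSeries.constantCoeff (σ := ℕ) (R := ℂ)))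
    rwa [pleth_hSeries_zero, mul_one] at h
  have h := mk_sum_partition (a := fun r => (-1 : ℂ) ^ r • esymm r)
    (fun n => (isSymmSeries_esymm n).smul _) (fun n => isHomog_smul _ (isHomog_esymm n))
    (by rw [pow_zero, one_smul, esymm_zero])
    (fun _ _ hf hg => pleth_epmSeries_add hf hg) hz fun n hn => (hq n hn).2
  rw [epmSeries, ← coeff_grade, ← h, PowerSeries.coeff_mk]
  simp only [prod_neg_one_pow_smul_pleth isSymmSeries_esymm hq, Epart]

theorem len_le {n : ℕ} (μ : n.Partition) : len μ ≤ n := by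
  have := card_le_sum fun k hk => (μ.parts_pos hk).ne'
  rwa [μ.parts_sum] at this

theorem neg_one_pow_sub_len {n : ℕ} (μ : n.Partition) :
    (-1 : ℂ) ^ (n - len μ) = (-1) ^ n * (-1) ^ len μ := by
  have h := len_le μ
  have h2 : ((-1 : ℂ) ^ len μ) * (-1) ^ len μ = 1 := by
    rw [← mul_pow, neg_one_mul, neg_neg, one_pow]
  have h3 : (-1 : ℂ) ^ n = (-1) ^ (n - len μ) * (-1) ^ len μ := by
    rw [← pow_add, Nat.sub_add_cancel h]
  rw [h3, mul_assoc, h2, mul_one]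

/-! ### Products over the powers of two -/

/-- The product `∏_{k ≥ 0} (1 + ε p_{2^k})`. -/
def twoProd (ε : ℤ) : Ser := ∏' k : ℕ, (1 + (ε : Ser) * psum (2 ^ k))

/-- The product converges because p_{2^k} has order at least 2^k, which tends to infinity. -/
theorem hasProd_twoProd (ε : ℤ) :
    HasProd (fun k : ℕ => 1 + (ε : Ser) * psum (2 ^ k)) (twoProd ε) := by
  apply Multipliable.hasProd
  apply MvPowerSeries.WithPiTopology.multipliable_one_add_of_tendsto_order_atTop_nhds_top
  rw [ENat.tendsto_nhds_top_iff_natCast_lt]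
  intro n
  filter_upwards [Filter.eventually_ge_atTop (n + 1)] with k hk
  have h1 : k < 2 ^ k := Nat.lt_two_pow_self
  refine lt_of_lt_of_le (b := ((2 ^ k : ℕ) : ℕ∞)) (by exact_mod_cast (by omega : n < 2 ^ k)) ?_
  apply MvPowerSeries.le_order
  intro d hd
  have h2 : d.degree ≠ 2 ^ k := by
    have : d.degree < 2 ^ k := by exact_mod_cast hd
    exact this.ne
  rw [← map_intCast (MvPowerSeries.C (σ := ℕ) (R := ℂ)) ε, MvPowerSeries.coeff_C_mul,
    isHomog_psum _ d h2, mul_zero]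

theorem constantCoeff_twoProd (ε : ℤ) : MvPowerSeries.constantCoeff (twoProd ε) = 1 := by
  have h := (hasProd_twoProd ε).map (MvPowerSeries.constantCoeff (σ := ℕ) (R := ℂ))
    (MvPowerSeries.WithPiTopology.continuous_constantCoeff ℂ)
  refine h.unique ?_
  convert hasProd_one using 1
  funext k
  rw [Function.comp_apply, map_add, map_mul, constantCoeff_psum (by positivity), mul_zero, map_one,
    add_zero]

/-- p_2[·] sends p_{2^k} to p_{2^{k+1}}, so it turns the product into the same product without its
first factor. -/
theorem twoProd_eq (ε : ℤ) :
    (1 + (ε : Ser) * psum 1) * psumPleth 2 (twoProd ε) = twoProd ε := by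
  refine HasProd.unique ?_ (hasProd_twoProd ε)
  have h := (hasProd_twoProd ε).map
    (MvPowerSeries.expand (σ := ℕ) (R := ℂ) ((2 : ℕ+) : ℕ) (2 : ℕ+).ne_zero)
    (continuous_psumPleth 2)
  refine HasProd.zero_mul (f := fun k : ℕ => 1 + (ε : Ser) * psum (2 ^ k)) ?_
  change HasProd _ (MvPowerSeries.expand ((2 : ℕ+) : ℕ) (2 : ℕ+).ne_zero (twoProd ε))
  convert h using 1
  funext k
  rw [Function.comp_apply, map_add, map_mul, map_one, map_intCast]
  have : MvPowerSeries.expand ((2 : ℕ+) : ℕ) (2 : ℕ+).ne_zero (psum (2 ^ k)) =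
    psum (2 ^ (k + 1)) := by
    rw [pow_succ']
    exact psumPleth_psum 2 (2 ^ k)
  rw [this]

theorem hasProd_grade_twoProd (ε : ℤ) :
    HasProd (fun k : ℕ => 1 + (ε : PowerSeries Ser) * tpsum (2 ^ k)) (grade (twoProd ε)) := by
  have h := (hasProd_twoProd ε).map grade continuous_grade
  convert h using 1
  funext k
  rw [Function.comp_apply, map_add, map_mul, map_one, map_intCast, grade_psum]

theorem hasProd_one_add_tpsum :
    HasProd (fun k : ℕ => 1 + tpsum (2 ^ k)) (grade (twoProd 1)) := by
  simpa using hasProd_grade_twoProd 1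

theorem hasProd_one_sub_tpsum :
    HasProd (fun k : ℕ => 1 - tpsum (2 ^ k)) (grade (twoProd (-1))) := by
  simpa [← sub_eq_add_neg] using hasProd_grade_twoProd (-1)

theorem psumPart_eq {n : ℕ} (μ : n.Partition) :
    psumPart μ = ∏ i ∈ μ.parts.toFinset, psum i ^ μ.parts.count i :=
  Finset.prod_multiset_map_count _ _

theorem injective_two_pow_sub_one : Function.Injective fun k : ℕ => 2 ^ k - 1 := by
  intro a b h
  have h1 := Nat.one_le_two_pow (n := a)
  have h2 := Nat.one_le_two_pow (n := b)
  have : 2 ^ a = 2 ^ b := by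
    simp only at h
    omega
  exact Nat.pow_right_injective le_rfl this

/-- Factors equal to 1 are dropped. The factor with index i belongs to part size i + 1, hence the
shift to 2 ^ k - 1. -/
theorem hasProd_two_pow_iff {f : ℕ → PowerSeries Ser} {a : PowerSeries Ser}
    (hf : ∀ i, (¬ ∃ k : ℕ, i + 1 = 2 ^ k) → f i = 1) :
    HasProd f a ↔ HasProd (fun k : ℕ => f (2 ^ k - 1)) a := by
  refine (injective_two_pow_sub_one.hasProd_iff ?_).symm
  intro i hi
  refine hf i ?_
  rintro ⟨k, hk⟩
  exact hi ⟨k, by simp only; omega⟩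

theorem mk_sum_twoPowerDistinctParts :
    (PowerSeries.mk fun n => ∑ μ ∈ twoPowerDistinctParts n, psumPart μ) = grade (twoProd 1) := by
  classical
  -- The weight of a part size with its multiplicity; the value 0 eliminates every partition with a
  -- repeated part or a part that is not a power of 2.
  let f : ℕ → ℕ → Ser := fun i c => if (∃ k : ℕ, i = 2 ^ k) ∧ c = 1 then psum i else 0
  have h1 : (PowerSeries.mk fun n => ∑ μ ∈ twoPowerDistinctParts n, psumPart μ) =
      Nat.Partition.genFun f := by
    ext1 n
    rw [PowerSeries.coeff_mk, Nat.Partition.coeff_genFun, twoPowerDistinctParts, twoPowerParts,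
      Finset.filter_filter, Finset.sum_filter]
    refine Finset.sum_congr rfl fun μ _ => ?_
    rw [Finsupp.prod, Multiset.toFinsupp_support, psumPart_eq]
    simp only [Multiset.toFinsupp_apply]
    split_ifs with h
    · refine Finset.prod_congr rfl fun i hi => ?_
      rw [Multiset.mem_toFinset] at hi
      have hc : μ.parts.count i = 1 := Multiset.count_eq_one_of_mem h.2 hi
      simp only [f]
      rw [hc, if_pos ⟨h.1 i hi, rfl⟩, pow_one]
    · by_contra h'
      apply h
      rw [eq_comm] at h'
      have key : ∀ i ∈ μ.parts, (∃ k : ℕ, i = 2 ^ k) ∧ μ.parts.count i = 1 := by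
        intro i hi
        by_contra h2
        exact h' (Finset.prod_eq_zero (Multiset.mem_toFinset.2 hi) (if_neg h2))
      refine ⟨fun i hi => (key i hi).1, Multiset.nodup_iff_count_le_one.2 fun i => ?_⟩
      by_cases hi : i ∈ μ.parts
      · exact (key i hi).2.le
      · rw [Multiset.count_eq_zero_of_notMem hi]
        exact Nat.zero_le 1
  rw [h1]
  have h2 := Nat.Partition.hasProd_genFun f
  have h3 : ∀ i, 1 + ∑' j, f (i + 1) (j + 1) • (PowerSeries.X : PowerSeries Ser) ^
      ((i + 1) * (j + 1)) = if ∃ k : ℕ, i + 1 = 2 ^ k then 1 + tpsum (i + 1) else 1 := by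
    intro i
    rw [tsum_eq_single 0]
    · simp only [f, zero_add, mul_one, and_true]
      split_ifs with h
      · rw [PowerSeries.smul_eq_C_mul, tpsum]
      · rw [zero_smul, add_zero]
    · intro j hj
      simp only [f]
      rw [if_neg (by omega), zero_smul]
  simp only [h3] at h2
  rw [hasProd_two_pow_iff fun i hi => if_neg hi] at h2
  refine h2.unique ?_
  convert hasProd_one_add_tpsum using 1
  funext k
  have h4 : 2 ^ k - 1 + 1 = 2 ^ k := Nat.sub_add_cancel Nat.one_le_two_pow
  rw [h4, if_pos ⟨k, rfl⟩]

/-- With arbitrary multiplicities allowed, the factor for the part 2^k is the geometric series in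
t^{2^k} p_{2^k}, which cancels against 1 - t^{2^k} p_{2^k} factor by factor. -/
theorem mk_sum_twoPowerParts_mul :
    (PowerSeries.mk fun n => ∑ μ ∈ twoPowerParts n, psumPart μ) * grade (twoProd (-1)) = 1 := by
  classical
  let f : ℕ → ℕ → Ser := fun i c => if ∃ k : ℕ, i = 2 ^ k then psum i ^ c else 0
  have h1 : (PowerSeries.mk fun n => ∑ μ ∈ twoPowerParts n, psumPart μ) =
      Nat.Partition.genFun f := by
    ext1 n
    rw [PowerSeries.coeff_mk, Nat.Partition.coeff_genFun, twoPowerParts, Finset.sum_filter]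
    refine Finset.sum_congr rfl fun μ _ => ?_
    rw [Finsupp.prod, Multiset.toFinsupp_support, psumPart_eq]
    simp only [Multiset.toFinsupp_apply]
    split_ifs with h
    · refine Finset.prod_congr rfl fun i hi => ?_
      rw [Multiset.mem_toFinset] at hi
      simp only [f]
      rw [if_pos (h i hi)]
    · push Not at h
      obtain ⟨i, hi, h⟩ := h
      refine (Finset.prod_eq_zero (Multiset.mem_toFinset.2 hi) (if_neg ?_)).symm
      rintro ⟨k, hk⟩
      exact h k hk
  rw [h1]
  have h2 := Nat.Partition.hasProd_genFun f
  rw [hasProd_two_pow_iff] at h2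
  · refine (h2.mul hasProd_one_sub_tpsum).unique ?_
    convert hasProd_one using 1
    funext k
    have h4 : 2 ^ k - 1 + 1 = 2 ^ k := Nat.sub_add_cancel Nat.one_le_two_pow
    have h5 : PowerSeries.constantCoeff (tpsum (2 ^ k)) = 0 := by
      rw [tpsum, map_mul, map_pow, PowerSeries.constantCoeff_X, zero_pow (by positivity), mul_zero]
    have h6 : ∑' j, f (2 ^ k) (j + 1) • (PowerSeries.X : PowerSeries Ser) ^ (2 ^ k * (j + 1)) =
        ∑' j, tpsum (2 ^ k) ^ (j + 1) := tsum_congr fun j => by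
      have h7 : f (2 ^ k) (j + 1) = psum (2 ^ k) ^ (j + 1) := if_pos ⟨k, rfl⟩
      rw [h7, tpsum, mul_pow, ← pow_mul, PowerSeries.smul_eq_C_mul, map_pow]
    have h8 := PowerSeries.WithPiTopology.tsum_pow_mul_one_sub_of_constantCoeff_eq_zero h5
    rw [(PowerSeries.WithPiTopology.summable_pow_of_constantCoeff_eq_zero h5).tsum_eq_zero_add,
      pow_zero] at h8
    rw [h4, h6, h8]
  · intro i hi
    have h3 : ∀ j, f (i + 1) (j + 1) = 0 := fun j => if_neg hi
    rw [tsum_congr fun j => by rw [h3, zero_smul], tsum_zero, add_zero]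

theorem mk_sum_twoPowerParts :
    (PowerSeries.mk fun n => ∑ μ ∈ twoPowerParts n, psumPart μ) = grade (twoProd (-1))⁻¹ := by
  have h : twoProd (-1) * (twoProd (-1))⁻¹ = 1 :=
    MvPowerSeries.mul_inv_cancel _ (by rw [constantCoeff_twoProd]; exact one_ne_zero)
  exact left_inv_eq_right_inv mk_sum_twoPowerParts_mul (by rw [← map_mul, h, map_one])

/-! ### Low degrees -/

theorem degree_eq_one_iff (d : ℕ →₀ ℕ) : d.degree = 1 ↔ ∃ i, d = Finsupp.single i 1 := by
  constructor
  · intro h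
    exact (Finsupp.sum_eq_one_iff d).1 h
  · rintro ⟨i, rfl⟩
    exact Finsupp.degree_single i 1

theorem hsymm_one : hsymm 1 = psum 1 := by
  classical
  ext d
  rw [coeff_hsymm, coeff_psum]
  refine if_congr ?_ rfl rfl
  rw [degree_eq_one_iff]

theorem esymm_one : esymm 1 = psum 1 := by
  classical
  ext d
  rw [coeff_esymm, coeff_psum]
  refine if_congr ?_ rfl rfl
  constructor
  · rintro ⟨h, -⟩
    exact (degree_eq_one_iff d).1 h
  · rintro ⟨i, rfl⟩
    refine ⟨Finsupp.degree_single i 1, fun j => ?_⟩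
    rw [Finsupp.single_apply]
    split_ifs <;> omega

theorem comp_hSeries (n : ℕ) : comp n hSeries = hsymm n := comp_sumAll n (isHomog_hsymm n)

theorem comp_eSeries (n : ℕ) : comp n eSeries = esymm n := comp_sumAll n (isHomog_esymm n)

theorem comp_two_psumPleth_hSeries : comp 2 (psumPleth 2 hSeries) = psum 2 := by
  have h := psumPleth_psum 2 1
  rw [mul_one, ← hsymm_one, PNat.val_ofNat] at h
  rw [← h]
  symm
  rw [eq_psumPleth_iff]
  constructor
  · intro d
    rw [coeff_comp, coeff_smul_psumPleth, coeff_hSeries, coeff_hsymm]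
    refine if_congr ?_ rfl rfl
    rw [map_nsmul, PNat.val_ofNat, smul_eq_mul]
    omega
  · intro d i hi
    rw [coeff_comp, coeff_psumPleth_of_not_dvd 2 _ hi, ite_self]

theorem comp_mul_two (f g : Ser) : comp 2 (f * g) =
    comp 0 f * comp 2 g + comp 1 f * comp 1 g + comp 2 f * comp 0 g := by
  have h : Finset.HasAntidiagonal.antidiagonal 2 = {(0, 2), (1, 1), (2, 0)} := by decide
  rw [← coeff_grade, map_mul, PowerSeries.coeff_mul, h, Finset.sum_insert (by decide),
    Finset.sum_insert (by decide), Finset.sum_singleton, ← add_assoc]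
  simp only [coeff_grade]

theorem comp_zero_psumPleth_hSeries : comp 0 (psumPleth 2 hSeries) = 1 := by
  classical
  ext d
  rw [coeff_comp, MvPowerSeries.coeff_one]
  by_cases hd : d = 0
  · rw [hd, if_pos (map_zero _), if_pos rfl, MvPowerSeries.coeff_zero_eq_constantCoeff_apply,
      constantCoeff_psumPleth, constantCoeff_hSeries]
  · rw [if_neg hd, if_neg]
    rwa [Finsupp.degree_eq_zero_iff]

theorem comp_one_psumPleth_hSeries : comp 1 (psumPleth 2 hSeries) = 0 := by
  ext d
  rw [coeff_comp, map_zero]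
  split_ifs with h
  · obtain ⟨i, rfl⟩ := (degree_eq_one_iff d).1 h
    exact coeff_psumPleth_of_not_dvd 2 hSeries (i := i) (by simp)
  · rfl

/-- In degree 2 the relations E·p_2[H] = H and H·H^± = p_2[H] read e_2 + p_2 = h_2 and 2h_2 - p_1² =
p_2; eliminating h_2 gives the claim. -/
theorem two_mul_esymm_two : 2 * esymm 2 = psum 1 ^ 2 - psum 2 := by
  have h1 := congrArg (comp 2) eSeries_mul_psumPleth_hSeries
  have h2 := congrArg (comp 2) hSeries_mul_hpmSeries
  have h3 : ∀ n, comp n hpmSeries = (-1 : ℂ) ^ n • hsymm n := fun n =>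
    comp_sumAll n (isHomog_smul _ (isHomog_hsymm n))
  rw [comp_mul_two, comp_eSeries, comp_eSeries, comp_eSeries, comp_two_psumPleth_hSeries,
    comp_one_psumPleth_hSeries, comp_zero_psumPleth_hSeries, comp_hSeries, esymm_zero] at h1
  rw [comp_mul_two, h3, h3, h3, comp_two_psumPleth_hSeries, comp_hSeries, comp_hSeries,
    comp_hSeries, hsymm_zero, hsymm_one, neg_one_sq, pow_zero, pow_one, one_smul, one_smul,
    neg_one_smul] at h2
  linear_combination 2 * h1 + h2

theorem mk_pow_mul_one_sub :
    (PowerSeries.mk fun n => psum 1 ^ n) * (1 - tpsum 1) = 1 := by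
  ext1 n
  rw [mul_sub, mul_one, map_sub, tpsum, pow_one, ← mul_assoc, PowerSeries.coeff_mk]
  cases n with
  | zero => simp
  | succ n =>
    rw [PowerSeries.coeff_succ_mul_X, PowerSeries.coeff_mul_C, PowerSeries.coeff_mk, ← pow_succ,
      sub_self, PowerSeries.coeff_one, if_neg (Nat.succ_ne_zero n)]

/-- In degree n ≥ 2 the quotient (1 - t²p_2)/(1 - tp_1) has coefficient p_1^n - p_2 p_1^{n-2} = 2e_2
p_1^{n-2}; degrees 0 and 1, about which the identity is silent, are filled in as 1 and p_1. -/
theorem mk_two_mul_esymm_two_mul_one_sub :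
    (PowerSeries.mk fun n => if n = 0 then 1 else if n = 1 then psum 1 else
      2 * esymm 2 * psum 1 ^ (n - 2)) * (1 - tpsum 1) = 1 - tpsum 2 := by
  ext1 n
  rw [mul_sub, mul_one, map_sub, map_sub, tpsum, pow_one, ← mul_assoc, PowerSeries.coeff_mk,
    tpsum, PowerSeries.coeff_C_mul, PowerSeries.coeff_X_pow, PowerSeries.coeff_one]
  match n with
  | 0 => simp
  | 1 => simp
  | 2 =>
    rw [PowerSeries.coeff_succ_mul_X, PowerSeries.coeff_mul_C, PowerSeries.coeff_mk]
    simp only [OfNat.ofNat_ne_zero, OfNat.ofNat_ne_one, if_false, if_true, one_ne_zero,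
      Nat.sub_self, pow_zero, mul_one, two_mul_esymm_two]
    ring
  | n + 3 =>
    rw [PowerSeries.coeff_succ_mul_X, PowerSeries.coeff_mul_C, PowerSeries.coeff_mk]
    rw [if_neg (by omega), if_neg (by omega), if_neg (by omega), if_neg (by omega),
      if_neg (by omega), if_neg (by omega), show n + 3 - 2 = n + 1 by omega,
      show n + 2 - 2 = n by omega, pow_succ]
    ring

/-! ### Equivalent forms of the identities -/

theorem forall_coeff_eq_pow_iff {A : PowerSeries Ser} :
    (∀ n, PowerSeries.coeff n A = psum 1 ^ n) ↔ A * (1 - tpsum 1) = 1 := by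
  constructor
  · intro h
    have h1 : A = PowerSeries.mk fun n => psum 1 ^ n := by
      ext1 n
      rw [h, PowerSeries.coeff_mk]
    rw [h1, mk_pow_mul_one_sub]
  · intro h n
    have h1 : A = PowerSeries.mk fun n => psum 1 ^ n :=
      left_inv_eq_right_inv h (by rw [mul_comm, mk_pow_mul_one_sub])
    rw [h1, PowerSeries.coeff_mk]

theorem grade_mul_one_sub_iff {A : Ser} :
    grade A * (1 - tpsum 1) = 1 ↔ A * (1 - psum 1) = 1 := by
  rw [← grade_psum, ← map_one grade, ← map_sub, ← map_mul, grade_injective.eq_iff]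

theorem one_sub_psum_ne_zero : MvPowerSeries.constantCoeff (1 - psum 1) ≠ 0 := by
  rw [map_sub, constantCoeff_psum_one, map_one, sub_zero]
  exact one_ne_zero

/-- Identities asserted only for n ≥ 2 determine the whole series once degrees 0 and 1 are known.
For the series in question those are supplied by f_1 = p_1. -/
theorem eq_one_sub_psum_iff {f : Ser} (h0 : comp 0 f = 1) (h1 : comp 1 f = -psum 1) :
    f = 1 - psum 1 ↔ ∀ n, 2 ≤ n → comp n f = 0 := by
  have key : ∀ n, comp n (1 - psum 1) = if n = 0 then 1 else if n = 1 then -psum 1 else 0 := by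
    intro n
    rw [map_sub, comp_of_isHomog isHomog_one, comp_of_isHomog (isHomog_psum 1)]
    split_ifs with h h'
    · omega
    · rw [sub_zero]
    · rw [zero_sub]
    · rw [sub_zero]
  constructor
  · rintro rfl n hn
    rw [key, if_neg (by omega), if_neg (by omega)]
  · intro h
    apply eq_of_comp_eq
    intro n
    rw [key]
    split_ifs with h2 h3
    · rw [h2, h0]
    · rw [h3, h1]
    · exact h n (by omega)

theorem partition_one_prod (μ : Nat.Partition 1) (f : ℕ → ℕ → Ser) :
    ∏ i ∈ μ.parts.toFinset, f i (μ.parts.count i) = f 1 1 := by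
  rw [Nat.Partition.partition_one_parts, Multiset.toFinset_singleton, Finset.prod_singleton,
    Multiset.count_singleton_self]

theorem len_partition_one (μ : Nat.Partition 1) : len μ = 1 := by
  rw [len, Nat.Partition.partition_one_parts, Multiset.card_singleton]

theorem partition_zero_prod (μ : Nat.Partition 0) (f : ℕ → ℕ → Ser) :
    ∏ i ∈ μ.parts.toFinset, f i (μ.parts.count i) = 1 := by
  rw [Nat.Partition.partition_zero_parts, Multiset.toFinset_zero, Finset.prod_empty]

theorem len_partition_zero (μ : Nat.Partition 0) : len μ = 0 := by
  rw [len, Nat.Partition.partition_zero_parts, Multiset.card_zero]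

theorem Hpart_one {F : ℕ → Ser} (h1 : F 1 = psum 1) (μ : Nat.Partition 1) :
    Hpart F μ = psum 1 := by
  rw [Hpart, partition_one_prod μ fun i c => pleth (hsymm c) (F i), hsymm_one, h1,
    pleth_psum_one (isSymmSeries_psum 1)]

theorem Epart_one {F : ℕ → Ser} (h1 : F 1 = psum 1) (μ : Nat.Partition 1) :
    Epart F μ = psum 1 := by
  rw [Epart, partition_one_prod μ fun i c => pleth (esymm c) (F i), esymm_one, h1,
    pleth_psum_one (isSymmSeries_psum 1)]

theorem Hpart_zero (F : ℕ → Ser) (μ : Nat.Partition 0) : Hpart F μ = 1 :=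
  partition_zero_prod μ fun i c => pleth (hsymm c) (F i)

theorem Epart_zero (F : ℕ → Ser) (μ : Nat.Partition 0) : Epart F μ = 1 :=
  partition_zero_prod μ fun i c => pleth (esymm c) (F i)

theorem forall_sum_signed_Hpart_iff {F : ℕ → Ser} (hF : IsGraded F) (h1 : F 1 = psum 1) :
    (∀ n : ℕ, 2 ≤ n → ∑ μ : n.Partition, (-1 : ℂ) ^ (n - len μ) • Hpart F μ = 0) ↔
      pleth hpmSeries (sumPos F) = 1 - psum 1 := by
  rw [eq_one_sub_psum_iff]
  · refine forall_congr' fun n => forall_congr' fun _ => ?_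
    simp only [neg_one_pow_sub_len, ← smul_smul]
    rw [← Finset.smul_sum, sum_signed_Hpart hF, smul_eq_zero_iff_right]
    exact pow_ne_zero n (neg_ne_zero.2 one_ne_zero)
  · rw [← sum_signed_Hpart hF, Fintype.sum_unique, Hpart_zero, len_partition_zero, pow_zero,
      one_smul]
  · rw [← sum_signed_Hpart hF, Fintype.sum_unique, Hpart_one h1, len_partition_one, pow_one,
      neg_one_smul]

theorem forall_sum_signed_Epart_iff {F : ℕ → Ser} (hF : IsGraded F) (h1 : F 1 = psum 1) :
    (∀ n : ℕ, 2 ≤ n → ∑ μ : n.Partition, (-1 : ℂ) ^ (n - len μ) • Epart F μ = 0) ↔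
      pleth epmSeries (sumPos F) = 1 - psum 1 := by
  rw [eq_one_sub_psum_iff]
  · refine forall_congr' fun n => forall_congr' fun _ => ?_
    simp only [neg_one_pow_sub_len, ← smul_smul]
    rw [← Finset.smul_sum, sum_signed_Epart hF, smul_eq_zero_iff_right]
    exact pow_ne_zero n (neg_ne_zero.2 one_ne_zero)
  · rw [← sum_signed_Epart hF, Fintype.sum_unique, Epart_zero, len_partition_zero, pow_zero,
      one_smul]
  · rw [← sum_signed_Epart hF, Fintype.sum_unique, Epart_one h1, len_partition_one, pow_one,
      neg_one_smul]

/-- The involution p_k ↦ -p_k exchanges 1 - p_1 and 1 + p_1, and Z is the inverse of the image of V.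
-/
theorem mul_psumNeg_eq_one_iff {V Z : Ser} (hV : IsSymmSeries V) (h : Z * psumNeg V = 1) :
    Z = 1 + psum 1 ↔ V * (1 - psum 1) = 1 := by
  have hs : IsSymmSeries (1 - psum 1) := isSymmSeries_one.sub (isSymmSeries_psum 1)
  have hn : psumNeg (1 - psum 1) = 1 + psum 1 := by
    have := psumNeg_psum 1
    rw [PNat.one_coe] at this
    rw [sub_eq_add_neg, psumNeg_add isSymmSeries_one (isSymmSeries_psum 1).neg, psumNeg_one,
      psumNeg, pleth_neg (isSymmSeries_psum 1) constantCoeff_neg_psum_one, ← psumNeg, this, neg_neg]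
  constructor
  · rintro rfl
    rw [← psumNeg_psumNeg (hV.mul hs), psumNeg_mul hV hs, hn, mul_comm (psumNeg V), h, psumNeg_one]
  · intro h2
    have h3 : psumNeg V * (1 + psum 1) = 1 := by
      rw [← hn, ← psumNeg_mul hV hs, h2, psumNeg_one]
    exact left_inv_eq_right_inv h h3

theorem isSymmSeries_pleth_sumPos (f : Ser) {F : ℕ → Ser} (hF : IsGraded F) :
    IsSymmSeries (pleth f (sumPos F)) :=
  isSymmSeries_pleth f hF.isSymmSeries_sumPos (constantCoeff_sumPos F)

theorem eq_one_sub_iff_of_mul_eq_one {K V : Ser} (h : K * V = 1) :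
    K = 1 - psum 1 ↔ V * (1 - psum 1) = 1 := by
  constructor
  · rintro rfl
    rw [mul_comm, h]
  · intro h2
    exact left_inv_eq_right_inv h h2

theorem forall_sum_Hpart_iff {F : ℕ → Ser} (hF : IsGraded F) :
    (∀ n : ℕ, ∑ μ : n.Partition, Hpart F μ = psum 1 ^ n) ↔
      pleth hSeries (sumPos F) * (1 - psum 1) = 1 := by
  rw [← grade_mul_one_sub_iff, ← forall_coeff_eq_pow_iff]
  simp only [sum_Hpart hF, coeff_grade]

theorem forall_sum_Epart_iff {F : ℕ → Ser} (hF : IsGraded F) :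
    (∀ n : ℕ, ∑ μ : n.Partition, Epart F μ = psum 1 ^ n) ↔
      pleth eSeries (sumPos F) * (1 - psum 1) = 1 := by
  rw [← grade_mul_one_sub_iff, ← forall_coeff_eq_pow_iff]
  simp only [sum_Epart hF, coeff_grade]

/-- For W = (1 - p_1)^{-1} one has W/p_2[W] = (1 - p_2)/(1 - p_1). Since E[F] = H[F]/p_2[H[F]]
determines H[F], the two conditions are the same. -/
theorem pleth_eSeries_mul_one_sub_iff {F : ℕ → Ser} :
    pleth eSeries (sumPos F) * (1 - psum 1) = 1 - psum 2 ↔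
      pleth hSeries (sumPos F) * (1 - psum 1) = 1 := by
  have h0 := constantCoeff_sumPos F
  have hVU := pleth_eSeries_mul h0
  have hp : psumPleth 2 (1 - psum 1) = 1 - psum 2 := by
    rw [psumPleth_sub, psumPleth_one, psumPleth_psum, PNat.val_ofNat]
  have hI : (1 - psum 1)⁻¹ * (1 - psum 1) = 1 := MvPowerSeries.inv_mul_cancel _ one_sub_psum_ne_zero
  have hI2 : psumPleth 2 (1 - psum 1)⁻¹ * (1 - psum 2) = 1 := by
    rw [← hp, ← psumPleth_mul, hI, psumPleth_one]
  constructor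
  · intro h
    have h2 : pleth hSeries (sumPos F) = (1 - psum 1)⁻¹ := by
      refine eq_of_eq_mul_psumPleth (constantCoeff_pleth_hSeries h0) ?_ hVU ?_
      · rw [MvPowerSeries.constantCoeff_inv, map_sub, constantCoeff_psum_one, map_one, sub_zero,
          inv_one]
      · linear_combination (1 - psum 1)⁻¹ * psumPleth 2 (1 - psum 1)⁻¹ * h -
          pleth eSeries (sumPos F) * psumPleth 2 (1 - psum 1)⁻¹ * hI + (1 - psum 1)⁻¹ * hI2
    rw [h2, hI]
  · intro h
    have h2 : psumPleth 2 (pleth hSeries (sumPos F)) * (1 - psum 2) = 1 := by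
      rw [← hp, ← psumPleth_mul, h, psumPleth_one]
    linear_combination (1 - psum 1) * (1 - psum 2) * hVU -
      (1 - psum 1) * pleth eSeries (sumPos F) * h2 + (1 - psum 2) * h

theorem forall_sum_Epart_eq_iff {F : ℕ → Ser} (hF : IsGraded F) (h1 : F 1 = psum 1) :
    (∀ n : ℕ, 2 ≤ n →
      ∑ μ : n.Partition, Epart F μ = 2 * esymm 2 * psum 1 ^ (n - 2)) ↔
      pleth eSeries (sumPos F) * (1 - psum 1) = 1 - psum 2 := by
  have h2 : pleth eSeries (sumPos F) * (1 - psum 1) = 1 - psum 2 ↔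
      grade (pleth eSeries (sumPos F)) * (1 - tpsum 1) = 1 - tpsum 2 := by
    rw [← grade_psum, ← grade_psum, ← map_one grade, ← map_sub, ← map_sub, ← map_mul,
      grade_injective.eq_iff]
  have hne : (1 - tpsum 1 : PowerSeries Ser) ≠ 0 :=
    right_ne_zero_of_mul_eq_one mk_pow_mul_one_sub
  rw [h2, ← mk_two_mul_esymm_two_mul_one_sub, mul_left_inj' hne]
  constructor
  · intro h
    ext1 n
    rw [coeff_grade, PowerSeries.coeff_mk, ← sum_Epart hF]
    split_ifs with h3 h4
    · subst h3
      rw [Fintype.sum_unique, Epart_zero]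
    · subst h4
      rw [Fintype.sum_unique, Epart_one h1]
    · exact h n (by omega)
  · intro h n hn
    rw [sum_Epart hF, ← coeff_grade, h, PowerSeries.coeff_mk, if_neg (by omega),
      if_neg (by omega)]

/-- Each statement is rewritten as H[F]·(1 - p_1) = 1. -/
theorem tfae_hSeries {F : ℕ → Ser} (hF : IsGraded F) (h1 : F 1 = psum 1) :
    List.TFAE [
      ∀ n : ℕ, ∑ μ : n.Partition, Hpart F μ = psum 1 ^ n,
      pleth hSeries (sumPos (altOmega F)) = 1 + psum 1,
      ∀ n : ℕ, 2 ≤ n → ∑ μ : n.Partition, (-1 : ℂ) ^ (n - len μ) • Epart F μ = 0,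
      ∀ n : ℕ, 2 ≤ n → ∑ μ : n.Partition, Epart F μ = 2 * esymm 2 * psum 1 ^ (n - 2)] := by
  rw [forall_sum_Hpart_iff hF, forall_sum_signed_Epart_iff hF h1, forall_sum_Epart_eq_iff hF h1,
    pleth_eSeries_mul_one_sub_iff, eq_one_sub_iff_of_mul_eq_one
      (pleth_epmSeries_mul (constantCoeff_sumPos F)),
    mul_psumNeg_eq_one_iff (isSymmSeries_pleth_sumPos _ hF) (pleth_hSeries_altOmega hF)]
  tfae_finish

/-! ### The second set of identities -/

theorem sumPos_esymm : sumPos esymm = eSeries - 1 := by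
  apply eq_of_comp_eq
  intro n
  rw [comp_sumPos n fun _ => isHomog_esymm n, map_sub, comp_eSeries, comp_of_isHomog isHomog_one]
  split_ifs with h
  · rw [h, esymm_zero, sub_self]
  · rw [sub_zero]

/-- The constant term of f[g] does not depend on g, as all admissible g agree in degree 0; the
choice g = -p_1 is already settled. -/
theorem constantCoeff_pleth {f g : Ser} (hf : IsSymmSeries f)
    (hf0 : MvPowerSeries.constantCoeff f = 0) (hg : MvPowerSeries.constantCoeff g = 0) :
    MvPowerSeries.constantCoeff (pleth f g) = 0 := by
  have h := pleth_sub_mem_highIdeal f hg constantCoeff_neg_psum_one (n := 0) (by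
    rw [mem_highIdeal]
    intro e he
    rw [Nat.le_zero, Finsupp.degree_eq_zero_iff] at he
    rw [he, MvPowerSeries.coeff_zero_eq_constantCoeff_apply, map_sub, hg,
      constantCoeff_neg_psum_one, sub_zero])
  have h2 := mem_highIdeal.1 h 0 (map_zero _).le
  rwa [MvPowerSeries.coeff_zero_eq_constantCoeff_apply, map_sub, ← psumNeg,
    constantCoeff_psumNeg hf hf0, sub_zero] at h2

/-- One composite is E[G] - 1. For the other, put e = E - 1 and apply the injective map E[·]:
E[G[e]] = (E[G])[e] = (1 + p_1)[e] = E = E[p_1], whence G[e] = p_1. -/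
theorem isPlethInverse_esymm_iff {G : Ser} (hG : IsSymmSeries G)
    (hG0 : MvPowerSeries.constantCoeff G = 0) :
    IsPlethInverse (sumPos esymm) G ↔ pleth eSeries G = 1 + psum 1 := by
  have he0 := constantCoeff_sumPos esymm
  have hes : IsSymmSeries (sumPos esymm) := isSymmSeries_sumPos fun n _ => isSymmSeries_esymm n
  have hE : eSeries = 1 + sumPos esymm := by rw [sumPos_esymm]; ring
  have h1 : pleth eSeries G = 1 + pleth (sumPos esymm) G := by
    rw [hE, pleth_add isSymmSeries_one hes hG0, pleth_one hG0]
  constructor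
  · intro h
    rw [h1, h.1]
  · intro h
    refine ⟨add_left_cancel (h1.symm.trans h), ?_⟩
    refine pleth_eSeries_injective (constantCoeff_pleth hG hG0 he0) constantCoeff_psum_one ?_
    rw [← pleth_assoc _ hG hG0 he0, h, pleth_add isSymmSeries_one (isSymmSeries_psum 1) he0,
      pleth_one he0, pleth_psum_one isSymmSeries_eSeries]
    have := pleth_psum he0 1
    rw [PNat.one_coe, psumPleth_one_apply] at this
    rw [this, ← hE]

/-- T = ∏(1 - p_{2^k}) satisfies (1 - p_1)·p_2[T] = T, so U = T^{-1} is the solution of V·p_2[U] = U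
that belongs to V = (1 - p_1)^{-1}; uniqueness gives the converse. -/
theorem hSeries_eq_inv_twoProd_iff {F : ℕ → Ser} :
    pleth hSeries (sumPos F) = (twoProd (-1))⁻¹ ↔
      pleth eSeries (sumPos F) * (1 - psum 1) = 1 := by
  have h0 := constantCoeff_sumPos F
  have hVU := pleth_eSeries_mul h0
  have hc : MvPowerSeries.constantCoeff (twoProd (-1)) ≠ 0 := by
    rw [constantCoeff_twoProd]
    exact one_ne_zero
  have hT : (twoProd (-1))⁻¹ * twoProd (-1) = 1 := MvPowerSeries.inv_mul_cancel _ hc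
  have hT2 : psumPleth 2 (twoProd (-1))⁻¹ * psumPleth 2 (twoProd (-1)) = 1 := by
    rw [← psumPleth_mul, hT, psumPleth_one]
  have hP : (1 - psum 1) * psumPleth 2 (twoProd (-1)) = twoProd (-1) := by
    have := twoProd_eq (-1)
    rwa [Int.cast_neg, Int.cast_one, neg_one_mul, ← sub_eq_add_neg] at this
  constructor
  · intro h
    rw [h] at hVU
    linear_combination (-(pleth eSeries (sumPos F) * (1 - psum 1))) * hT2 +
      (1 - psum 1) * psumPleth 2 (twoProd (-1)) * hVU + (twoProd (-1))⁻¹ * hP + hT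
  · intro h
    refine eq_of_eq_mul_psumPleth (constantCoeff_pleth_hSeries h0) ?_ hVU ?_
    · rw [MvPowerSeries.constantCoeff_inv, constantCoeff_twoProd, inv_one]
    · linear_combination (-(pleth eSeries (sumPos F) * psumPleth 2 (twoProd (-1))⁻¹)) * hT -
        pleth eSeries (sumPos F) * psumPleth 2 (twoProd (-1))⁻¹ * (twoProd (-1))⁻¹ * hP +
        pleth eSeries (sumPos F) * (1 - psum 1) * (twoProd (-1))⁻¹ * hT2 + (twoProd (-1))⁻¹ * h

theorem hSeries_eq_twoProd_iff {F : ℕ → Ser} :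
    pleth hSeries (sumPos F) = twoProd 1 ↔ pleth eSeries (sumPos F) = 1 + psum 1 := by
  have h0 := constantCoeff_sumPos F
  have hVU := pleth_eSeries_mul h0
  have hP : (1 + psum 1) * psumPleth 2 (twoProd 1) = twoProd 1 := by
    have := twoProd_eq 1
    rwa [Int.cast_one, one_mul] at this
  constructor
  · intro h
    rw [h] at hVU
    refine mul_right_cancel₀ (psumPleth_ne_zero 2 fun h2 => ?_) (hVU.trans hP.symm)
    have := constantCoeff_twoProd 1
    rw [h2, map_zero] at this
    exact zero_ne_one this
  · intro h
    rw [h] at hVU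
    exact eq_of_eq_mul_psumPleth (constantCoeff_pleth_hSeries h0) (constantCoeff_twoProd 1) hVU hP

theorem forall_sum_Hpart_eq_twoPowerParts_iff {F : ℕ → Ser} (hF : IsGraded F) :
    (∀ n : ℕ, ∑ μ : n.Partition, Hpart F μ = ∑ μ ∈ twoPowerParts n, psumPart μ) ↔
      pleth hSeries (sumPos F) = (twoProd (-1))⁻¹ := by
  rw [← grade_injective.eq_iff, ← mk_sum_twoPowerParts, PowerSeries.ext_iff]
  simp only [PowerSeries.coeff_mk, coeff_grade, sum_Hpart hF]

theorem forall_sum_Hpart_eq_twoPowerDistinctParts_iff {F : ℕ → Ser} (hF : IsGraded F) :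
    (∀ n : ℕ, ∑ μ : n.Partition, Hpart F μ = ∑ μ ∈ twoPowerDistinctParts n, psumPart μ) ↔
      pleth hSeries (sumPos F) = twoProd 1 := by
  rw [← grade_injective.eq_iff, ← mk_sum_twoPowerDistinctParts, PowerSeries.ext_iff]
  simp only [PowerSeries.coeff_mk, coeff_grade, sum_Hpart hF]

/-- The limit of the infinite product is unique, so the witness D can only be the graded form of
`twoProd (-1)`. -/
theorem exists_hasProd_iff {F : ℕ → Ser} (hF : IsGraded F) :
    (∃ D : PowerSeries Ser, HasProd (fun k : ℕ => 1 - tpsum (2 ^ k)) D ∧ genH F * D = 1) ↔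
      pleth hSeries (sumPos F) = (twoProd (-1))⁻¹ := by
  rw [MvPowerSeries.eq_inv_iff_mul_eq_one
    (by rw [constantCoeff_twoProd]; exact one_ne_zero), ← grade_injective.eq_iff, map_mul,
    map_one, ← genH_eq hF]
  constructor
  · rintro ⟨D, hD, h⟩
    rwa [← hD.unique hasProd_one_sub_tpsum]
  · intro h
    exact ⟨_, hasProd_one_sub_tpsum, h⟩

theorem hasProd_genH_iff {F : ℕ → Ser} (hF : IsGraded F) :
    HasProd (fun k : ℕ => 1 + tpsum (2 ^ k)) (genH F) ↔
      pleth hSeries (sumPos F) = twoProd 1 := by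
  rw [← grade_injective.eq_iff, ← genH_eq hF]
  constructor
  · intro h
    exact h.unique hasProd_one_add_tpsum
  · intro h
    rw [h]
    exact hasProd_one_add_tpsum

theorem isSymmSeries_Epart {F : ℕ → Ser} (hF : IsGraded F) {n : ℕ} (μ : n.Partition) :
    IsSymmSeries (Epart F μ) := by
  rw [Epart]
  refine Finset.prod_induction _ IsSymmSeries (fun _ _ h h' => h.mul h') isSymmSeries_one ?_
  intro i hi
  have hi : i ≠ 0 := (μ.parts_pos (Multiset.mem_toFinset.1 hi)).ne'
  exact isSymmSeries_pleth _ (hF i hi).1 (constantCoeff_eq_zero_of_isHomog (hF i hi).2 hi)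

theorem isHomog_Epart {F : ℕ → Ser} (hF : IsGraded F) {n : ℕ} (μ : n.Partition) :
    IsHomog (Epart F μ) n := by
  have h := isHomog_prod μ.parts.toFinset
    (fun i => pleth (esymm (μ.parts.count i)) (F i)) (fun i => i * μ.parts.count i) ?_
  · have h2 : ∑ i ∈ μ.parts.toFinset, i * μ.parts.count i = n := by
      conv_rhs => rw [← μ.parts_sum, Finset.sum_multiset_count]
      exact Finset.sum_congr rfl fun i _ => by rw [smul_eq_mul, mul_comm]
    rwa [h2] at h
  · intro i hi
    have hi : i ≠ 0 := (μ.parts_pos (Multiset.mem_toFinset.1 hi)).ne'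
    exact isHomog_pleth (isSymmSeries_esymm _) hi (isHomog_esymm _) (hF i hi).2

theorem psumNeg_smul (c : ℂ) {f : Ser} (hf : IsSymmSeries f) :
    psumNeg (c • f) = c • psumNeg f := pleth_smul c hf constantCoeff_neg_psum_one

theorem psumNeg_sum {ι : Type*} (s : Finset ι) {f : ι → Ser} (hf : ∀ i, IsSymmSeries (f i)) :
    psumNeg (∑ i ∈ s, f i) = ∑ i ∈ s, psumNeg (f i) := by
  classical
  have hs : ∀ s : Finset ι, IsSymmSeries (∑ i ∈ s, f i) := fun s =>
    Finset.sum_induction _ IsSymmSeries (fun _ _ h h' => h.add h') isSymmSeries_zero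
      fun i _ => hf i
  induction s using Finset.induction with
  | empty => exact pleth_zero_left constantCoeff_neg_psum_one
  | insert i s hi ih =>
    rw [Finset.sum_insert hi, Finset.sum_insert hi, psumNeg_add (hf i) (hs s), ih]

/-- On degree n, (-1)^{n-ℓ} ω is (-1)^ℓ times p_k ↦ -p_k. The left side is therefore the image of
E^±[F] = H[F]^{-1} under this involution, which is H[F^ω]. The equality holds for every graded
sequence F. -/
theorem sum_signed_omega_Epart {F : ℕ → Ser} (hF : IsGraded F) (n : ℕ) :
    ∑ μ : n.Partition, (-1 : ℂ) ^ (n - len μ) • omega (Epart F μ) =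
      ∑ μ : n.Partition, Hpart (altOmega F) μ := by
  have hU := isSymmSeries_pleth_sumPos hSeries hF
  have hK := isSymmSeries_pleth_sumPos epmSeries hF
  have h1 : pleth hSeries (sumPos (altOmega F)) = psumNeg (pleth epmSeries (sumPos F)) := by
    refine left_inv_eq_right_inv (pleth_hSeries_altOmega hF) ?_
    rw [mul_comm, ← psumNeg_mul hK hU, pleth_epmSeries_mul (constantCoeff_sumPos F), psumNeg_one]
  rw [sum_Hpart hF.altOmega, h1, comp_psumNeg hK, ← sum_signed_Epart hF, psumNeg_sum _
    fun μ => (isSymmSeries_Epart hF μ).smul _]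
  refine Finset.sum_congr rfl fun μ _ => ?_
  have h2 : ((-1 : ℂ) ^ n) * (-1) ^ n = 1 := by
    rw [← mul_pow, neg_one_mul, neg_neg, one_pow]
  rw [omega_of_isHomog (isSymmSeries_Epart hF μ) (isHomog_Epart hF μ), smul_smul,
    psumNeg_smul _ (isSymmSeries_Epart hF μ), neg_one_pow_sub_len]
  congr 1
  linear_combination (-1 : ℂ) ^ len μ * h2

/-- Each statement is rewritten as E[F]·(1 - p_1) = 1; the signed sums of the ω(E_λ) are first
exchanged for sums of H_λ of the twisted sequence. -/
theorem tfae_eSeries {F : ℕ → Ser} (hF : IsGraded F) (h1 : F 1 = psum 1) :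
    List.TFAE [
      ∀ n : ℕ, ∑ μ : n.Partition, Epart F μ = psum 1 ^ n,
      pleth eSeries (sumPos F) = (1 - psum 1)⁻¹,
      genE F * (1 - tpsum 1) = 1,
      pleth hpmSeries (sumPos F) = 1 - psum 1,
      genHpm F = 1 - tpsum 1,
      pleth eSeries (sumPos (altOmega F)) = 1 + psum 1,
      genE (altOmega F) = 1 + tpsum 1,
      IsPlethInverse (sumPos esymm) (sumPos (altOmega F)),
      ∀ n : ℕ, 2 ≤ n → ∑ μ : n.Partition, (-1 : ℂ) ^ (n - len μ) • Hpart F μ = 0,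
      ∀ n : ℕ, ∑ μ : n.Partition, Hpart F μ = ∑ μ ∈ twoPowerParts n, psumPart μ,
      ∃ D : PowerSeries Ser, HasProd (fun k : ℕ => 1 - tpsum (2 ^ k)) D ∧ genH F * D = 1,
      ∀ n : ℕ, ∑ μ : n.Partition, (-1 : ℂ) ^ (n - len μ) • omega (Epart F μ) =
        ∑ μ ∈ twoPowerDistinctParts n, psumPart μ,
      ∀ n : ℕ, ∑ μ : n.Partition, Hpart (altOmega F) μ =
        ∑ μ ∈ twoPowerDistinctParts n, psumPart μ,
      HasProd (fun k : ℕ => 1 + tpsum (2 ^ k)) (genH (altOmega F))] := by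
  have hG := hF.altOmega
  have g1 : genHpm F = 1 - tpsum 1 ↔ pleth hpmSeries (sumPos F) = 1 - psum 1 := by
    rw [genHpm_eq hF, ← grade_psum, ← map_one grade, ← map_sub, grade_injective.eq_iff]
  have g2 : genE (altOmega F) = 1 + tpsum 1 ↔
      pleth eSeries (sumPos (altOmega F)) = 1 + psum 1 := by
    rw [genE_eq hG, ← grade_psum, ← map_one grade, ← map_add, grade_injective.eq_iff]
  have g3 : pleth hpmSeries (sumPos F) = 1 - psum 1 ↔
      pleth eSeries (sumPos F) * (1 - psum 1) = 1 :=
    eq_one_sub_iff_of_mul_eq_one ((mul_comm _ _).trans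
      (pleth_eSeries_mul_hpm (constantCoeff_sumPos F)))
  simp only [sum_signed_omega_Epart hF]
  rw [forall_sum_Epart_iff hF, MvPowerSeries.eq_inv_iff_mul_eq_one one_sub_psum_ne_zero,
    genE_eq hF, grade_mul_one_sub_iff, g1, g2,
    isPlethInverse_esymm_iff hG.isSymmSeries_sumPos (constantCoeff_sumPos _),
    forall_sum_signed_Hpart_iff hF h1, forall_sum_Hpart_eq_twoPowerParts_iff hF,
    exists_hasProd_iff hF, forall_sum_Hpart_eq_twoPowerDistinctParts_iff hG,
    hasProd_genH_iff hG, hSeries_eq_twoProd_iff, hSeries_eq_inv_twoProd_iff, g3,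
    mul_psumNeg_eq_one_iff (isSymmSeries_pleth_sumPos _ hF) (pleth_eSeries_altOmega hF)]
  tfae_finish

/-! ### The characteristic of an induced representation -/

open scoped MonoidAlgebra in
theorem trace_of_forall_single {G : Type*} [Fintype G] [DecidableEq G]
    (f : ℂ[G] →ₗ[ℂ] ℂ[G]) (φ : G → G)
    (h : ∀ x, f (MonoidAlgebra.single x 1) = MonoidAlgebra.single (φ x) 1) :
    LinearMap.trace ℂ _ f = ∑ x : G, if φ x = x then 1 else 0 := by
  rw [LinearMap.trace_eq_matrix_trace ℂ (MonoidAlgebra.basis G ℂ), Matrix.trace]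
  refine Finset.sum_congr rfl fun x _ => ?_
  rw [Matrix.diag_apply, LinearMap.toMatrix_apply]
  change MonoidAlgebra.coeff (f (MonoidAlgebra.single x 1)) x = _
  rw [h, MonoidAlgebra.coeff_single, Finsupp.single_apply]

theorem trace_leftRegular {G : Type*} [Group G] [Fintype G] [DecidableEq G] (g : G) :
    LinearMap.trace ℂ _ (Representation.leftRegular ℂ G g) =
      if g = 1 then (Fintype.card G : ℂ) else 0 := by
  rw [trace_of_forall_single _ (fun x => g * x) fun x => by simp]
  simp only [mul_eq_right]
  split_ifs <;> simp

/-- The averaging operator A factors through the quotient map q as A = s ∘ q with q ∘ s = id. Then F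
= q ∘ f ∘ s, and cyclicity of the trace gives tr F = tr(f ∘ s ∘ q) = tr(f ∘ A). -/
theorem trace_coinvariants {G V : Type*} [Group G] [Fintype G] [AddCommGroup V] [Module ℂ V]
    [Module.Finite ℂ V] (ρ : Representation ℂ G V) (f : V →ₗ[ℂ] V)
    (F : ρ.Coinvariants →ₗ[ℂ] ρ.Coinvariants)
    (hF : F ∘ₗ Representation.Coinvariants.mk ρ = Representation.Coinvariants.mk ρ ∘ₗ f) :
    LinearMap.trace ℂ _ F =
      (Fintype.card G : ℂ)⁻¹ * ∑ g, LinearMap.trace ℂ V (f ∘ₗ ρ g) := by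
  let q := Representation.Coinvariants.mk ρ
  let A : V →ₗ[ℂ] V := (Fintype.card G : ℂ)⁻¹ • ∑ g, ρ g
  have hA : ∀ x, A ∘ₗ ρ x = A := fun x => by
    simp only [A, LinearMap.smul_comp]
    congr 1
    change (∑ g, ρ g) * ρ x = _
    rw [Finset.sum_mul]
    refine Fintype.sum_equiv (Equiv.mulRight x) _ _ fun g => ?_
    rw [Equiv.coe_mulRight, map_mul]
  let s := Representation.Coinvariants.lift ρ A hA
  have hs : q ∘ₗ s = LinearMap.id := by
    apply Representation.Coinvariants.hom_ext
    ext v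
    simp only [LinearMap.comp_apply, LinearMap.id_apply, s, q, A,
      Representation.Coinvariants.lift_mk, LinearMap.smul_apply, LinearMap.sum_apply, map_smul,
      map_sum, Representation.Coinvariants.mk_self_apply, Finset.sum_const, Finset.card_univ]
    rw [← Nat.cast_smul_eq_nsmul ℂ, smul_smul,
      inv_mul_cancel₀ (Nat.cast_ne_zero.2 Fintype.card_ne_zero), one_smul]
  have h1 : F = q ∘ₗ (f ∘ₗ s) := by
    rw [← LinearMap.comp_assoc, ← hF, LinearMap.comp_assoc, hs, LinearMap.comp_id]
  have h2 : s ∘ₗ q = A := Representation.Coinvariants.lift_comp_mk _ _ _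
  rw [h1, LinearMap.trace_comp_comm', LinearMap.comp_assoc, h2]
  simp only [A, LinearMap.comp_smul, map_smul, smul_eq_mul]
  congr 1
  change LinearMap.trace ℂ V (f * ∑ g, ρ g) = _
  rw [Finset.mul_sum, map_sum]
  rfl

/-- The induced module is the module of K-coinvariants of ℂ[G] ⊗ ρ; on the tensor product the trace
splits into a fixed point count on G and the scalar ρ k 1. -/
theorem trace_ind {G : Type*} [Group G] [Fintype G] [DecidableEq G] (K : Subgroup G) [Fintype K]
    (ρ : Representation ℂ K ℂ) (g : G) :
    LinearMap.trace ℂ _ (Representation.ind K.subtype ρ g) =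
      (Fintype.card K : ℂ)⁻¹ * ∑ k : K, (∑ x : G, if k * x * g⁻¹ = x then 1 else 0) * ρ k 1 := by
  rw [trace_coinvariants _ ((MonoidAlgebra.mapDomainLinearMap ℂ ℂ fun x => x * g⁻¹).rTensor ℂ)]
  · congr 1
    refine Finset.sum_congr rfl fun k _ => ?_
    rw [Representation.tprod_apply, LinearMap.rTensor_comp_map, LinearMap.trace_tensorProduct',
      trace_of_forall_single _ fun x => k * x * g⁻¹]
    · congr 1
      rw [LinearMap.trace_eq_matrix_trace ℂ (Module.Basis.singleton Unit ℂ)]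
      simp [Matrix.trace, LinearMap.toMatrix_apply]
    · intro x
      simp [mul_assoc]
  · rfl

/-- Each pair (k, x) is counted for the single σ = x⁻¹kx, which has the cycle type of k. Summing
over the n! choices of x cancels the factor 1/n!. -/
theorem ch_ind {n : ℕ} (K : Subgroup (Equiv.Perm (Fin n))) [Fintype K]
    (ρ : Representation ℂ K ℂ) :
    ch (Representation.ind K.subtype ρ) = (Fintype.card K : ℂ)⁻¹ •
      ∑ k : K, ρ k 1 • psumPart (k : Equiv.Perm (Fin n)).partition := by
  have h1 : ∀ (k : K), ∑ σ : Equiv.Perm (Fin n), (∑ x : Equiv.Perm (Fin n),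
      if (k : Equiv.Perm (Fin n)) * x * σ⁻¹ = x then (1 : ℂ) else 0) • psumPart σ.partition =
      (n.factorial : ℂ) • psumPart (k : Equiv.Perm (Fin n)).partition := by
    intro k
    simp_rw [Finset.sum_smul]
    rw [Finset.sum_comm]
    have : ∀ x : Equiv.Perm (Fin n), ∑ σ : Equiv.Perm (Fin n),
        (if (k : Equiv.Perm (Fin n)) * x * σ⁻¹ = x then (1 : ℂ) else 0) • psumPart σ.partition =
        psumPart (k : Equiv.Perm (Fin n)).partition := by
      intro x
      rw [Finset.sum_eq_single (x⁻¹ * k * x)]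
      · rw [if_pos (by group), one_smul]
        congr 1
        apply Equiv.Perm.partition_eq_of_isConj.1
        exact isConj_iff.2 ⟨x, by group⟩
      · intro σ _ hσ
        rw [if_neg, zero_smul]
        intro h
        apply hσ
        rw [mul_inv_eq_iff_eq_mul] at h
        rw [mul_assoc, h, inv_mul_cancel_left]
      · exact fun h => absurd (Finset.mem_univ _) h
    have hc : Fintype.card (Equiv.Perm (Fin n)) = n.factorial := by
      rw [Fintype.card_perm, Fintype.card_fin]
    rw [Finset.sum_congr rfl fun x _ => this x, Finset.sum_const, Finset.card_univ, hc,
      ← Nat.cast_smul_eq_nsmul ℂ]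
  rw [ch]
  simp_rw [trace_ind, mul_smul]
  rw [← Finset.smul_sum, smul_comm]
  congr 1
  simp_rw [Finset.sum_smul, mul_comm _ (ρ _ 1), mul_smul]
  rw [Finset.sum_comm]
  simp_rw [← Finset.smul_sum, h1]
  rw [Finset.smul_sum]
  refine Finset.sum_congr rfl fun k _ => ?_
  rw [smul_comm, smul_smul _ (n.factorial : ℂ),
    inv_mul_cancel₀ (Nat.cast_ne_zero.2 n.factorial_ne_zero), one_smul]

theorem psumPart_partition_one (n : ℕ) :
    psumPart (1 : Equiv.Perm (Fin n)).partition = psum 1 ^ n := by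
  rw [psumPart, Equiv.Perm.parts_partition, Equiv.Perm.cycleType_one, Equiv.Perm.support_one]
  simp

theorem ch_leftRegular (n : ℕ) :
    ch (Representation.leftRegular ℂ (Equiv.Perm (Fin n))) = psum 1 ^ n := by
  rw [ch]
  simp_rw [trace_leftRegular, ite_smul, zero_smul]
  rw [Finset.sum_ite_eq' Finset.univ, if_pos (Finset.mem_univ _), psumPart_partition_one,
    Fintype.card_perm, Fintype.card_fin, smul_smul,
    inv_mul_cancel₀ (Nat.cast_ne_zero.2 n.factorial_ne_zero), one_smul]

theorem isSymmSeries_sum {ι : Type*} (s : Finset ι) {f : ι → Ser}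
    (hf : ∀ i, IsSymmSeries (f i)) : IsSymmSeries (∑ i ∈ s, f i) := by
  classical
  induction s using Finset.induction with
  | empty => exact isSymmSeries_zero
  | insert i s hi ih =>
    rw [Finset.sum_insert hi]
    exact (hf i).add ih

theorem isSymmSeries_ch {n : ℕ} {V : Type*} [AddCommGroup V] [Module ℂ V]
    (ρ : Representation ℂ (Equiv.Perm (Fin n)) V) : IsSymmSeries (ch ρ) := by
  apply IsSymmSeries.smul
  apply isSymmSeries_sum
  intro σ
  apply IsSymmSeries.smul
  exact isSymmSeries_psumMul σ.partition.parts

theorem isHomog_psumPart_partition {n : ℕ} (σ : Equiv.Perm (Fin n)) :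
    IsHomog (psumPart σ.partition) n := by
  intro d hd
  exact isHomog_psumPart σ.partition d (by rwa [Fintype.card_fin])

theorem isHomog_ch {n : ℕ} {V : Type*} [AddCommGroup V] [Module ℂ V]
    (ρ : Representation ℂ (Equiv.Perm (Fin n)) V) : IsHomog (ch ρ) n :=
  isHomog_smul _ (isHomog_sum _ _ _ fun σ _ => isHomog_smul _
    (isHomog_psumPart_partition σ))

/-! ### Series with a cyclic structure -/

/-- The series `∑_{d, m ≥ 1} c_d p_d^m`. -/
def cycSeries (c : ℕ → ℂ) : Ser := sumAll fun n => ∑ d ∈ n.divisors, c d • psum d ^ (n / d)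

theorem coeff_cycSeries (c : ℕ → ℂ) (e : ℕ →₀ ℕ) : MvPowerSeries.coeff e (cycSeries c) =
    ∑ d ∈ e.degree.divisors, c d * MvPowerSeries.coeff e (psum d ^ (e.degree / d)) := by
  rw [cycSeries, coeff_sumAll, map_sum]
  exact Finset.sum_congr rfl fun d _ => MvPowerSeries.coeff_smul _ _ _

theorem cycSeries_add (c c' : ℕ → ℂ) : cycSeries (c + c') = cycSeries c + cycSeries c' := by
  ext e
  simp only [map_add, coeff_cycSeries, Pi.add_apply, add_mul, Finset.sum_add_distrib]

theorem smul_cycSeries (a : ℂ) (c : ℕ → ℂ) : a • cycSeries c = cycSeries (a • c) := by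
  ext e
  simp only [MvPowerSeries.coeff_smul, coeff_cycSeries, Pi.smul_apply, smul_eq_mul,
    Finset.mul_sum, mul_assoc]

/-- p_k[·] maps p_d^m to p_{kd}^m, so the coefficient at d moves to kd and the exponent stays. -/
theorem psumPleth_cycSeries (k : ℕ+) (c : ℕ → ℂ) :
    psumPleth k (cycSeries c) = cycSeries fun d => if (k : ℕ) ∣ d then c (d / k) else 0 := by
  ext e
  have hk : 0 < (k : ℕ) := k.pos
  have key : ∀ d n, psum (k * d) ^ n = psumPleth k (psum d ^ n) := fun d n => by
    rw [psumPleth_pow, psumPleth_psum]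
  rw [coeff_cycSeries]
  by_cases h : ∀ i, (k : ℕ) ∣ e i
  · obtain ⟨m, rfl⟩ := eq_smul_of_forall_dvd h
    rw [coeff_smul_psumPleth, coeff_cycSeries]
    have hd : ((k : ℕ) • m).degree = k * m.degree := by rw [map_nsmul, smul_eq_mul]
    rw [hd]
    refine Finset.sum_of_injOn (fun d => k * d) ?_ ?_ ?_ ?_
    · intro a _ b _ hab
      exact Nat.eq_of_mul_eq_mul_left hk hab
    · intro d hd
      simp only [Finset.mem_coe, Nat.mem_divisors] at hd ⊢
      exact ⟨Nat.mul_dvd_mul_left _ hd.1, mul_ne_zero hk.ne' hd.2⟩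
    · intro d hd hd'
      rw [Nat.mem_divisors] at hd
      rw [if_neg, zero_mul]
      rintro ⟨d, rfl⟩
      apply hd'
      refine ⟨d, ?_, rfl⟩
      rw [Finset.mem_coe, Nat.mem_divisors]
      exact ⟨Nat.dvd_of_mul_dvd_mul_left hk hd.1, right_ne_zero_of_mul hd.2⟩
    · intro d _
      rw [if_pos (dvd_mul_right _ _), Nat.mul_div_cancel_left _ hk, Nat.mul_div_mul_left _ _ hk,
        key, coeff_smul_psumPleth]
  · push Not at h
    obtain ⟨i, hi⟩ := h
    rw [coeff_psumPleth_of_not_dvd k _ hi]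
    symm
    refine Finset.sum_eq_zero fun d _ => ?_
    split_ifs with h
    · obtain ⟨d, rfl⟩ := h
      rw [key, coeff_psumPleth_of_not_dvd k _ hi, mul_zero]
    · rw [zero_mul]

theorem sum_filter_dvd {D N : ℕ} (hD : D ≠ 0) (hN : D ≤ N) (c : ℕ → ℂ) :
    ∑ k ∈ Finset.Iic (Nat.succPNat N), (if (k : ℕ) ∣ D then c (D / k) else 0) =
      ∑ d ∈ D.divisors, c d := by
  rw [← Nat.sum_div_divisors, ← Finset.sum_filter]
  refine Finset.sum_nbij (fun k : ℕ+ => (k : ℕ)) ?_ ?_ ?_ ?_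
  · intro k hk
    rw [Nat.mem_divisors]
    exact ⟨(Finset.mem_filter.1 hk).2, hD⟩
  · exact PNat.coe_injective.injOn
  · intro d hd
    rw [Finset.mem_coe, Nat.mem_divisors] at hd
    have h0 := Nat.pos_of_dvd_of_pos hd.1 (Nat.pos_of_ne_zero hD)
    have h1 := Nat.le_of_dvd (Nat.pos_of_ne_zero hD) hd.1
    refine ⟨Nat.toPNat d h0, ?_, rfl⟩
    rw [Finset.mem_coe, Finset.mem_filter, Finset.mem_Iic, ← PNat.coe_le_coe]
    exact ⟨by rw [Nat.succPNat_coe]; exact (h1.trans hN).trans (Nat.le_succ N), hd.1⟩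
  · exact fun _ _ => rfl

/-- The contributions to p_D^m come from all factorizations D = k·d, so summing over k replaces c by
its divisor sums. -/
theorem sumPleth_cycSeries (c : ℕ → ℂ) :
    sumPleth 1 (cycSeries c) = cycSeries fun n => ∑ d ∈ n.divisors, c d := by
  ext e
  rw [coeff_sumPleth, coeff_cycSeries]
  simp_rw [psumPleth_cycSeries, coeff_cycSeries, Pi.one_apply, one_mul]
  rw [Finset.sum_comm]
  refine Finset.sum_congr rfl fun D hD => ?_
  rw [Nat.mem_divisors] at hD
  have h0 := Nat.pos_of_dvd_of_pos hD.1 (Nat.pos_of_ne_zero hD.2)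
  rw [← Finset.sum_mul, sum_filter_dvd h0.ne' (Nat.le_of_dvd (Nat.pos_of_ne_zero hD.2) hD.1)]

theorem euler_sumPos_eq_cycSeries {q : ℕ → Ser} {c : ℕ → ℂ} (h : ∀ n : ℕ, n ≠ 0 →
      (n : ℂ) • q n = ∑ d ∈ n.divisors, c d • psum d ^ (n / d)) :
    euler (sumPos q) = cycSeries c := by
  ext e
  rw [coeff_euler, sumPos, coeff_sumAll, cycSeries, coeff_sumAll]
  split_ifs with h0
  · rw [h0]
    simp
  · rw [← h _ h0, MvPowerSeries.coeff_smul]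

theorem cycSeries_one_mul_one_sub :
    cycSeries (fun d => if d = 1 then 1 else 0) * (1 - psum 1) = psum 1 := by
  have key : ∀ n, comp n (cycSeries fun d => if d = 1 then 1 else 0) =
      if n = 0 then 0 else psum 1 ^ n := by
    intro n
    have hs : (∑ d ∈ n.divisors, (if d = 1 then (1 : ℂ) else 0) • psum d ^ (n / d)) =
        if n = 0 then 0 else psum 1 ^ n := by
      split_ifs with h0
      · rw [h0]
        simp
      · rw [Finset.sum_eq_single_of_mem 1 (Nat.one_mem_divisors.2 h0)
          fun d _ hd => by rw [if_neg hd, zero_smul], if_pos rfl, one_smul, Nat.div_one]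
    rw [cycSeries, comp_sumAll, hs]
    rw [hs]
    split_ifs with h0
    · exact isHomog_zero n
    · simpa using isHomog_pow (isHomog_psum 1) n
  have h1 : grade (1 + cycSeries fun d => if d = 1 then 1 else 0) =
      PowerSeries.mk fun n => psum 1 ^ n := by
    ext1 n
    rw [coeff_grade, map_add, key, comp_of_isHomog isHomog_one, PowerSeries.coeff_mk]
    split_ifs with h0
    · rw [h0, add_zero, pow_zero]
    · rw [zero_add]
  have h2 := grade_mul_one_sub_iff.1 (h1 ▸ mk_pow_mul_one_sub)
  linear_combination h2

/-- The hypothesis says that H[g] has the logarithmic derivative p_1/(1 - p_1) of (1 - p_1)^{-1}, so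
the product has Euler derivative 0 and equals its constant term. -/
theorem pleth_hSeries_mul_one_sub {g : Ser} (hg : MvPowerSeries.constantCoeff g = 0)
    (h : sumPleth 1 (euler g) = cycSeries fun d => if d = 1 then 1 else 0) :
    pleth hSeries g * (1 - psum 1) = 1 := by
  apply eq_of_euler_eq_mul (N := 0) (map_zero _)
  · rw [euler_mul, euler_pleth_hSeries hg, h, map_sub, euler_one, euler_of_isHomog (isHomog_psum 1),
      Nat.cast_one, one_smul]
    linear_combination pleth hSeries g * cycSeries_one_mul_one_sub
  · rw [euler_one, zero_mul]
  · rw [map_mul, constantCoeff_pleth_hSeries hg, map_sub, map_one, constantCoeff_psum_one]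
    simp

/-- With M the logarithmic derivative of U = H[g], the equation M = p_1/(1 - p_1) + 2p_2[M] says
that U(1 - p_1) and p_2[U] both have logarithmic derivative 2p_2[M]. They are equal, and E[g] =
U/p_2[U]. -/
theorem pleth_eSeries_mul_one_sub {g : Ser} (hg : MvPowerSeries.constantCoeff g = 0)
    (h : sumPleth 1 (euler g) = (cycSeries fun d => if d = 1 then 1 else 0) +
      (2 : ℂ) • psumPleth 2 (sumPleth 1 (euler g))) :
    pleth eSeries g * (1 - psum 1) = 1 := by
  have hU := euler_pleth_hSeries hg
  set M := sumPleth 1 (euler g) with hM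
  have hM0 : MvPowerSeries.constantCoeff M = 0 :=
    constantCoeff_sumPleth _ (constantCoeff_euler g)
  have h1 : pleth hSeries g * (1 - psum 1) = psumPleth 2 (pleth hSeries g) := by
    apply eq_of_euler_eq_mul (N := (2 : ℂ) • psumPleth 2 M)
    · rw [← MvPowerSeries.coeff_zero_eq_constantCoeff_apply, MvPowerSeries.coeff_smul,
        MvPowerSeries.coeff_zero_eq_constantCoeff_apply, constantCoeff_psumPleth, hM0, mul_zero]
    · rw [euler_mul, hU, map_sub, euler_one, euler_of_isHomog (isHomog_psum 1),
        Nat.cast_one, one_smul]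
      linear_combination pleth hSeries g * cycSeries_one_mul_one_sub +
        pleth hSeries g * (1 - psum 1) * h
    · rw [euler_psumPleth, hU, psumPleth_mul, smul_mul_assoc]
      rfl
    · rw [constantCoeff_psumPleth, map_mul, constantCoeff_pleth_hSeries hg, map_sub, map_one,
        constantCoeff_psum_one]
      simp
  refine mul_right_cancel₀ (psumPleth_ne_zero 2 (pleth_hSeries_ne_zero hg)) ?_
  rw [one_mul, mul_right_comm, pleth_eSeries_mul hg, h1]

/-! ### The characters of the cyclic groups -/

/-- C_n is abelian and transitive, so an element that fixes one point fixes all of them. -/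
theorem pow_eq_one_of_apply_eq {n : ℕ} {σ : Equiv.Perm (Fin n)} (hσ : σ ∈ cyc n) {x : Fin n}
    (h : σ x = x) : σ = 1 := by
  obtain ⟨j, rfl⟩ := hσ
  change (finRotate n ^ j) x = x at h
  change finRotate n ^ j = 1
  -- There is no x for n = 0, and for n = 1 the group is trivial; `finRotate` is a genuine cycle
  -- from n = 2 on.
  match n, x with
  | 1, x => exact Subsingleton.elim _ _
  | n + 2, x =>
    have hne : ∀ y, finRotate (n + 2) y ≠ y := fun y => by
      rw [← Equiv.Perm.mem_support, support_finRotate]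
      exact Finset.mem_univ y
    ext y
    obtain ⟨i, rfl⟩ := isCycle_finRotate.exists_zpow_eq (hne x) (hne y)
    rw [← Equiv.Perm.mul_apply, (Commute.refl _).zpow_zpow, Equiv.Perm.mul_apply, h,
      Equiv.Perm.one_apply]

/-- Since the action is free, a power of σ that fixes one point of a cycle is the identity, so all
cycles have length equal to the order of σ. -/
theorem psumPart_partition_of_mem_cyc {n : ℕ} {σ : Equiv.Perm (Fin n)} (hσ : σ ∈ cyc n) :
    psumPart σ.partition = psum (orderOf σ) ^ (n / orderOf σ) := by
  have hparts : ∀ m ∈ σ.partition.parts, m = orderOf σ := by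
    intro m hm
    rw [Equiv.Perm.parts_partition, Multiset.mem_add] at hm
    rcases hm with hm | hm
    · refine Nat.dvd_antisymm (Equiv.Perm.dvd_of_mem_cycleType hm) ?_
      rw [Equiv.Perm.cycleType_def, Multiset.mem_map] at hm
      obtain ⟨c, hc, rfl⟩ := hm
      rw [Finset.mem_val, Equiv.Perm.mem_cycleFactorsFinset_iff] at hc
      obtain ⟨x, hx⟩ := hc.1.nonempty_support
      rw [orderOf_dvd_iff_pow_eq_one]
      apply pow_eq_one_of_apply_eq (Subgroup.pow_mem _ hσ _) (x := x)
      have h1 : c = σ.cycleOf x := Equiv.Perm.cycle_is_cycleOf hx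
        (Equiv.Perm.mem_cycleFactorsFinset_iff.2 hc)
      rw [Function.comp_apply, ← hc.1.orderOf, ← Equiv.Perm.cycleOf_pow_apply_self, ← h1,
        pow_orderOf_eq_one, Equiv.Perm.one_apply]
    -- Parts 1 come from fixed points; if there is one, σ is the identity and its order is 1.
    · obtain ⟨h0, rfl⟩ := Multiset.mem_replicate.1 hm
      have : ∃ x, x ∉ σ.support := by
        by_contra h
        push Not at h
        rw [Finset.eq_univ_iff_forall.2 h, Finset.card_univ, Nat.sub_self] at h0
        exact h0 rfl
      obtain ⟨x, hx⟩ := this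
      rw [pow_eq_one_of_apply_eq hσ (Equiv.Perm.notMem_support.1 hx), orderOf_one]
  have h1 := Multiset.eq_replicate_card.2 hparts
  have h2 : σ.partition.parts.card * orderOf σ = n := by
    have h3 := σ.partition.parts_sum
    rw [h1, Multiset.sum_replicate, smul_eq_mul] at h3
    exact h3.trans (Fintype.card_fin n)
  rw [psumPart, h1, Multiset.map_replicate, Multiset.prod_replicate]
  congr 1
  exact (Nat.div_eq_of_eq_mul_left (orderOf_pos σ) h2.symm).symm

theorem orderOf_finRotate {n : ℕ} (hn : n ≠ 0) : orderOf (finRotate n) = n := by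
  rcases n with _ | _ | n
  · exact absurd rfl hn
  · exact orderOf_eq_one_iff.2 (Subsingleton.elim (α := Equiv.Perm (Fin 1)) _ _)
  · rw [← Equiv.Perm.lcm_cycleType, cycleType_finRotate]
    simp

theorem orderOf_cycGen {n : ℕ} (hn : n ≠ 0) : orderOf (cycGen n) = n :=
  (Subgroup.orderOf_mk ..).trans (orderOf_finRotate hn)

theorem card_cyc {n : ℕ} (hn : n ≠ 0) : Nat.card (cyc n) = n :=
  Nat.card_zpowers _ |>.trans (orderOf_finRotate hn)

theorem rootExp_pow_eq_one_iff {n r D : ℕ} (hn : n ≠ 0) (hD : D ∣ n) :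
    rootExp n r ^ (n / D) = 1 ↔ D ∣ r := by
  obtain ⟨m, rfl⟩ := hD
  have hD0 : D ≠ 0 := left_ne_zero_of_mul hn
  have hm0 : m ≠ 0 := right_ne_zero_of_mul hn
  have hDc : (D : ℂ) ≠ 0 := Nat.cast_ne_zero.2 hD0
  have hmc : (m : ℂ) ≠ 0 := Nat.cast_ne_zero.2 hm0
  rw [Nat.mul_div_cancel_left _ (Nat.pos_of_ne_zero hD0), Units.ext_iff, Units.val_pow_eq_pow_val,
    rootExp, Units.val_mk0, Units.val_one, ← Complex.exp_nat_mul, Complex.exp_eq_one_iff]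
  have e1 : (m : ℂ) * (2 * Real.pi * Complex.I / (D * m : ℕ) * r) =
      (r / D) * (2 * Real.pi * Complex.I) := by
    push_cast
    field_simp
  simp_rw [e1, mul_left_inj' Complex.two_pi_I_ne_zero, div_eq_iff hDc]
  rw [← Int.natCast_dvd_natCast]
  constructor
  · rintro ⟨a, ha⟩
    exact ⟨a, by exact_mod_cast ha.trans (mul_comm _ _)⟩
  · rintro ⟨a, ha⟩
    exact ⟨a, by exact_mod_cast ha.trans (mul_comm _ _)⟩

theorem mem_zpowers_of_pow_eq_one {n D : ℕ} (hn : n ≠ 0) (hD : D ∣ n) (x : cyc n) :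
    x ^ D = 1 ↔ x ∈ Subgroup.zpowers (cycGen n ^ (n / D)) := by
  obtain ⟨m, rfl⟩ := hD
  have hD0 : D ≠ 0 := left_ne_zero_of_mul hn
  rw [Nat.mul_div_cancel_left _ (Nat.pos_of_ne_zero hD0)]
  obtain ⟨j, rfl⟩ := mem_zpowers_cycGen (D * m) x
  constructor
  · intro h
    simp only at h
    rw [← zpow_natCast, ← zpow_mul, ← orderOf_dvd_iff_zpow_eq_one, orderOf_cycGen hn,
      Nat.cast_mul, mul_comm] at h
    obtain ⟨i, rfl⟩ := Int.dvd_of_mul_dvd_mul_right (Nat.cast_ne_zero.2 hD0) h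
    exact ⟨i, by simp only [← zpow_natCast, ← zpow_mul]⟩
  · rintro ⟨i, hi⟩
    simp only at hi ⊢
    rw [← hi, ← zpow_natCast, ← zpow_mul, ← zpow_natCast, ← zpow_mul,
      ← orderOf_dvd_iff_zpow_eq_one, orderOf_cycGen hn]
    exact ⟨i, by push_cast; ring⟩

open Classical in
/-- The sum of the values of the character `cycChar n r` at the elements of order `d`. -/
def charSum (n r d : ℕ) : ℂ := ∑ k : cyc n with orderOf k = d, (cycChar n r k : ℂ)

/-- The elements of order dividing D form the subgroup generated by the (n/D)-th power of the
generator, which has order D. A character sums to D over it if trivial there and to 0 otherwise, and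
it is trivial iff exp(2πi r/D) = 1. -/
theorem sum_charSum {n r D : ℕ} (hn : n ≠ 0) (hD : D ∣ n) :
    ∑ d ∈ D.divisors, charSum n r d = if D ∣ r then (D : ℂ) else 0 := by
  classical
  have hD0 : D ≠ 0 := ne_zero_of_dvd_ne_zero hn hD
  let A : Subgroup (cyc n) := Subgroup.zpowers (cycGen n ^ (n / D))
  have h1 : ∑ d ∈ D.divisors, charSum n r d =
      ∑ k : cyc n with k ∈ A, (cycChar n r k : ℂ) := by
    unfold charSum
    rw [← Finset.sum_fiberwise_of_maps_to (s := Finset.univ.filter fun k : cyc n => k ∈ A)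
      (t := D.divisors) (g := fun k : cyc n => orderOf k)]
    · refine Finset.sum_congr rfl fun d hd => Finset.sum_congr ?_ fun _ _ => rfl
      ext k
      simp only [Finset.mem_filter, Finset.mem_univ, true_and, A,
        ← mem_zpowers_of_pow_eq_one hn hD, ← orderOf_dvd_iff_pow_eq_one]
      constructor
      · rintro rfl
        exact ⟨Nat.dvd_of_mem_divisors hd, rfl⟩
      · exact fun h => h.2
    · intro k hk
      rw [Finset.mem_filter, ← mem_zpowers_of_pow_eq_one hn hD, ← orderOf_dvd_iff_pow_eq_one] at hk
      exact Nat.mem_divisors.2 ⟨hk.2, hD0⟩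
  let f : A →* ℂ := ((Units.coeHom ℂ).comp (cycChar n r)).comp A.subtype
  have h2 : ∑ k : cyc n with k ∈ A, (cycChar n r k : ℂ) = ∑ k : A, f k :=
    Finset.sum_subtype _ (by simp) _
  have h3 : f = 1 ↔ D ∣ r := by
    rw [← rootExp_pow_eq_one_iff hn hD, ← cycChar_gen, ← map_pow]
    constructor
    · intro h
      have h5 : f ⟨cycGen n ^ (n / D), Subgroup.mem_zpowers _⟩ = 1 := by rw [h, MonoidHom.one_apply]
      exact Units.ext h5
    · intro h
      ext ⟨k, i, rfl⟩
      change ((cycChar n r ((cycGen n ^ (n / D)) ^ i) : ℂˣ) : ℂ) = 1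
      rw [map_zpow, h, one_zpow, Units.val_one]
  have h4 : Fintype.card A = D := by
    rw [← Nat.card_eq_fintype_card, Nat.card_zpowers, orderOf_pow, orderOf_cycGen hn,
      Nat.gcd_eq_right (Nat.div_dvd_of_dvd hD), Nat.div_div_self hD hn]
  rw [h1, h2, sum_hom_units, h4]
  simp only [h3]
  split_ifs <;> simp

theorem card_smul_ch_cycInd {n : ℕ} (hn : n ≠ 0) (r : ℕ) :
    (n : ℂ) • ch (cycInd n r) = ∑ d ∈ n.divisors, charSum n r d • psum d ^ (n / d) := by
  classical
  have hc : Fintype.card (cyc n) = n := by rw [← Nat.card_eq_fintype_card, card_cyc hn]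
  rw [cycInd, ch_ind, hc, smul_smul, mul_inv_cancel₀ (Nat.cast_ne_zero.2 hn), one_smul,
    ← Finset.sum_fiberwise_of_maps_to (t := n.divisors) (g := fun k : cyc n => orderOf k)]
  · refine Finset.sum_congr rfl fun d _ => ?_
    rw [charSum, Finset.sum_smul]
    refine Finset.sum_congr rfl fun k hk => ?_
    rw [psumPart_partition_of_mem_cyc k.2, Subgroup.orderOf_coe, (Finset.mem_filter.1 hk).2]
    congr 1
    change (cycChar n r k : ℂ) * 1 = _
    rw [mul_one]
  · intro k _
    rw [Nat.mem_divisors]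
    refine ⟨?_, hn⟩
    have := orderOf_dvd_natCard k
    rwa [card_cyc hn] at this

/-! ### From character sums to the series of Lie and Lie^(2) -/

/-- Uniqueness in Möbius inversion restricted to the divisors of a fixed n. The restriction is
needed because `charSum n r d` is only relevant for d ∣ n. -/
theorem eqOn_divisors_of_sum_eq {f g : ℕ → ℂ} {n : ℕ} (hn : n ≠ 0)
    (h : ∀ D, D ∣ n → ∑ d ∈ D.divisors, f d = ∑ d ∈ D.divisors, g d) :
    ∀ D, D ∣ n → f D = g D := by
  intro D
  induction D using Nat.strong_induction_on with
  | _ D ih =>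
    intro hD
    have h1 := h D hD
    have hD0 := ne_zero_of_dvd_ne_zero hn hD
    rw [← Nat.cons_self_properDivisors hD0, Finset.sum_cons, Finset.sum_cons] at h1
    have h2 : ∑ d ∈ D.properDivisors, f d = ∑ d ∈ D.properDivisors, g d :=
      Finset.sum_congr rfl fun d hd => by
        rw [Nat.mem_properDivisors] at hd
        exact ih d hd.2 (hd.1.trans hD)
    rw [h2] at h1
    exact add_right_cancel h1

theorem exists_sum_divisors_eq (K : ℕ → ℂ) : ∃ c : ℕ → ℂ, ∀ n > 0, ∑ d ∈ n.divisors, c d = K n :=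
  ⟨_, ArithmeticFunction.sum_eq_iff_sum_mul_moebius_eq.2 fun _ _ => rfl⟩

/-- `hK` says that the divisor sums of the character sums do not depend on n. Then the character
sums are the values of one sequence c, the Möbius inverse of K, and the summation of p_k[·] over k
undoes the inversion. `hK0` matches the empty divisor sum at 0. -/
theorem sumPleth_euler_sumPos_cycInd {r : ℕ → ℕ} {K : ℕ → ℂ} (hK : ∀ n D : ℕ, n ≠ 0 → D ∣ n →
      (if D ∣ r n then (D : ℂ) else 0) = K D) (hK0 : K 0 = 0) :
    sumPleth 1 (euler (sumPos fun n => ch (cycInd n (r n)))) = cycSeries K := by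
  obtain ⟨c, hc⟩ := exists_sum_divisors_eq K
  rw [euler_sumPos_eq_cycSeries (c := c), sumPleth_cycSeries]
  · congr 1
    funext n
    rcases Nat.eq_zero_or_pos n with rfl | hn
    · simp [hK0]
    · exact hc n hn
  · intro n hn
    rw [card_smul_ch_cycInd hn]
    refine Finset.sum_congr rfl fun d hd => ?_
    rw [eqOn_divisors_of_sum_eq hn (f := charSum n (r n)) (g := c) _ d
      (Nat.dvd_of_mem_divisors hd)]
    intro D hD
    rw [sum_charSum hn hD, hK n D hn hD, hc D (Nat.pos_of_dvd_of_pos hD (Nat.pos_of_ne_zero hn))]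

theorem isGraded_ch_cycInd (r : ℕ → ℕ) : IsGraded fun n => ch (cycInd n (r n)) :=
  fun _ _ => ⟨isSymmSeries_ch _, isHomog_ch _⟩

theorem ch_cycInd_one (r : ℕ) : ch (cycInd 1 r) = psum 1 := by
  have h := card_smul_ch_cycInd one_ne_zero r
  have h1 := sum_charSum (r := r) one_ne_zero dvd_rfl
  rw [Nat.divisors_one, Finset.sum_singleton, if_pos (one_dvd r), Nat.cast_one] at h1
  rwa [Nat.divisors_one, Finset.sum_singleton, h1, Nat.cast_one, one_smul, one_smul, Nat.div_self
    one_pos, pow_one] at h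

theorem pleth_hSeries_LieSym : pleth hSeries (sumPos LieSym) * (1 - psum 1) = 1 := by
  apply pleth_hSeries_mul_one_sub (constantCoeff_sumPos _)
  refine sumPleth_euler_sumPos_cycInd (r := fun _ => 1) (fun n D hn hD => ?_) (if_neg zero_ne_one)
  simp only [Nat.dvd_one]
  split_ifs with h
  · rw [h, Nat.cast_one]
  · rfl

/-- For divisors D of n, the condition depends on D alone; this independence of n is the purpose of
the exponent 2^{k_n} in Lie^(2). -/
theorem dvd_two_pow_padicValNat_iff {n D : ℕ} (hn : n ≠ 0) (hD : D ∣ n) :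
    D ∣ 2 ^ padicValNat 2 n ↔ ∃ a, D = 2 ^ a := by
  constructor
  · intro h
    obtain ⟨a, -, ha⟩ := (Nat.dvd_prime_pow Nat.prime_two).1 h
    exact ⟨a, ha⟩
  · rintro ⟨a, rfl⟩
    exact pow_dvd_pow 2 ((padicValNat_dvd_iff_le hn).1 hD)

-- The coefficient form of M = p_1/(1 - p_1) + 2p_2[M]: every power of 2 other than 1 is twice a
-- power of 2.
open Classical in
theorem ite_two_pow_eq (D : ℕ) : (if ∃ a, D = 2 ^ a then (D : ℂ) else 0) =
    (if D = 1 then 1 else 0) +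
      2 * if 2 ∣ D then (if ∃ a, D / 2 = 2 ^ a then ((D / 2 : ℕ) : ℂ) else 0) else 0 := by
  by_cases h1 : D = 1
  · subst h1
    rw [if_pos ⟨0, rfl⟩, if_pos rfl, if_neg (by decide)]
    simp
  rw [if_neg h1, zero_add]
  by_cases h2 : 2 ∣ D
  · obtain ⟨D, rfl⟩ := h2
    rw [if_pos (dvd_mul_right _ _), Nat.mul_div_cancel_left _ two_pos]
    have h3 : (∃ a, 2 * D = 2 ^ a) ↔ ∃ a, D = 2 ^ a := by
      constructor
      · rintro ⟨a, ha⟩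
        rcases a with _ | a
        · omega
        · exact ⟨a, by rw [pow_succ] at ha; omega⟩
      · rintro ⟨a, rfl⟩
        exact ⟨a + 1, by rw [pow_succ, mul_comm]⟩
    simp only [h3]
    split_ifs
    · push_cast
      rfl
    · rw [mul_zero]
  · rw [if_neg h2, mul_zero, if_neg]
    rintro ⟨a, rfl⟩
    rcases a with _ | a
    · exact h1 rfl
    · exact h2 (dvd_pow_self 2 (Nat.succ_ne_zero a))

open Classical in
theorem pleth_eSeries_LieTwoSym : pleth eSeries (sumPos LieTwoSym) * (1 - psum 1) = 1 := by
  apply pleth_eSeries_mul_one_sub (constantCoeff_sumPos _)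
  have h : sumPleth 1 (euler (sumPos LieTwoSym)) =
      cycSeries fun D => if ∃ a, D = 2 ^ a then (D : ℂ) else 0 := by
    refine sumPleth_euler_sumPos_cycInd (r := fun n => 2 ^ padicValNat 2 n)
      (fun n D hn hD => ?_) (by simp)
    simp only [dvd_two_pow_padicValNat_iff hn hD]
  rw [h, psumPleth_cycSeries, smul_cycSeries, ← cycSeries_add]
  congr 1
  funext D
  rw [ite_two_pow_eq]
  simp only [Pi.add_apply, Pi.smul_apply, smul_eq_mul, PNat.val_ofNat]
  congr

end

end PlethLie

/-! ### The theorem -/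

theorem mainTheorem1 :
    -- `p₁ⁿ` is the characteristic of the regular representation of `S_n`
    (∀ n : ℕ, ch (Representation.leftRegular ℂ (Equiv.Perm (Fin n))) = psum 1 ^ n) ∧
    -- the regular representation as the sum of the exterior powers of `Lie^(2)`
    (∀ n : ℕ, ∑ μ : n.Partition, Epart LieTwoSym μ =
      ch (Representation.leftRegular ℂ (Equiv.Perm (Fin n)))) ∧
    -- the identities for `Lie`
    (∀ n : ℕ, ∑ μ : n.Partition, Hpart LieSym μ = psum 1 ^ n) ∧
    (pleth hSeries (sumPos (altOmega LieSym)) = 1 + psum 1) ∧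
    (∀ n : ℕ, 2 ≤ n →
      ∑ μ : n.Partition, (-1 : ℂ) ^ (n - len μ) • Epart LieSym μ = 0) ∧
    (∀ n : ℕ, 2 ≤ n →
      ∑ μ : n.Partition, Epart LieSym μ = 2 * esymm 2 * psum 1 ^ (n - 2)) ∧
    -- the identities for `Lie^(2)`: exterior powers
    (∀ n : ℕ, ∑ μ : n.Partition, Epart LieTwoSym μ = psum 1 ^ n) ∧
    (pleth eSeries (sumPos LieTwoSym) = (1 - psum 1)⁻¹) ∧
    (genE LieTwoSym * (1 - tpsum 1) = 1) ∧
    (pleth hpmSeries (sumPos LieTwoSym) = 1 - psum 1) ∧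
    (genHpm LieTwoSym = 1 - tpsum 1) ∧
    -- the plethystic inverse of `∑_{n ≥ 1} e_n`
    (pleth eSeries (sumPos (altOmega LieTwoSym)) = 1 + psum 1) ∧
    (genE (altOmega LieTwoSym) = 1 + tpsum 1) ∧
    IsPlethInverse (sumPos esymm) (sumPos (altOmega LieTwoSym)) ∧
    -- alternating symmetric powers
    (∀ n : ℕ, 2 ≤ n →
      ∑ μ : n.Partition, (-1 : ℂ) ^ (n - len μ) • Hpart LieTwoSym μ = 0) ∧
    -- symmetric powers
    (∀ n : ℕ, ∑ μ : n.Partition, Hpart LieTwoSym μ = ∑ μ ∈ twoPowerParts n, psumPart μ) ∧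
    (∃ D : PowerSeries Ser, HasProd (fun k : ℕ => 1 - tpsum (2 ^ k)) D ∧
      genH LieTwoSym * D = 1) ∧
    -- alternating exterior powers
    (∀ n : ℕ, ∑ μ : n.Partition, (-1 : ℂ) ^ (n - len μ) • omega (Epart LieTwoSym μ) =
      ∑ μ ∈ twoPowerDistinctParts n, psumPart μ) ∧
    (∀ n : ℕ, ∑ μ : n.Partition, Hpart (altOmega LieTwoSym) μ =
      ∑ μ ∈ twoPowerDistinctParts n, psumPart μ) ∧
    HasProd (fun k : ℕ => 1 + tpsum (2 ^ k)) (genH (altOmega LieTwoSym)) ∧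
    -- the equivalences, for an arbitrary sequence of symmetric functions that starts with `p₁`
    (∀ F : ℕ → Ser, (∀ n : ℕ, 1 ≤ n → IsSymmSeries (F n) ∧ (F n).IsHomogeneous n) →
      F 1 = psum 1 →
      List.TFAE [
        ∀ n : ℕ, ∑ μ : n.Partition, Hpart F μ = psum 1 ^ n,
        pleth hSeries (sumPos (altOmega F)) = 1 + psum 1,
        ∀ n : ℕ, 2 ≤ n → ∑ μ : n.Partition, (-1 : ℂ) ^ (n - len μ) • Epart F μ = 0,
        ∀ n : ℕ, 2 ≤ n → ∑ μ : n.Partition, Epart F μ = 2 * esymm 2 * psum 1 ^ (n - 2)] ∧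
      List.TFAE [
        ∀ n : ℕ, ∑ μ : n.Partition, Epart F μ = psum 1 ^ n,
        pleth eSeries (sumPos F) = (1 - psum 1)⁻¹,
        genE F * (1 - tpsum 1) = 1,
        pleth hpmSeries (sumPos F) = 1 - psum 1,
        genHpm F = 1 - tpsum 1,
        pleth eSeries (sumPos (altOmega F)) = 1 + psum 1,
        genE (altOmega F) = 1 + tpsum 1,
        IsPlethInverse (sumPos esymm) (sumPos (altOmega F)),
        ∀ n : ℕ, 2 ≤ n → ∑ μ : n.Partition, (-1 : ℂ) ^ (n - len μ) • Hpart F μ = 0,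
        ∀ n : ℕ, ∑ μ : n.Partition, Hpart F μ = ∑ μ ∈ twoPowerParts n, psumPart μ,
        ∃ D : PowerSeries Ser, HasProd (fun k : ℕ => 1 - tpsum (2 ^ k)) D ∧ genH F * D = 1,
        ∀ n : ℕ, ∑ μ : n.Partition, (-1 : ℂ) ^ (n - len μ) • omega (Epart F μ) =
          ∑ μ ∈ twoPowerDistinctParts n, psumPart μ,
        ∀ n : ℕ, ∑ μ : n.Partition, Hpart (altOmega F) μ =
          ∑ μ ∈ twoPowerDistinctParts n, psumPart μ,
        HasProd (fun k : ℕ => 1 + tpsum (2 ^ k)) (genH (altOmega F))]) := by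
  have hL : IsGraded LieSym := isGraded_ch_cycInd fun _ => 1
  have hT : IsGraded LieTwoSym := isGraded_ch_cycInd fun n => 2 ^ padicValNat 2 n
  have tL := tfae_hSeries hL (ch_cycInd_one 1)
  have tT := tfae_eSeries hT (ch_cycInd_one _)
  -- Only the first identity of each list is computed for the actual modules; the equivalences,
  -- applied to these sequences, give the others.
  have hL0 := (forall_sum_Hpart_iff hL).2 pleth_hSeries_LieSym
  have hT0 := (forall_sum_Epart_iff hT).2 pleth_eSeries_LieTwoSym
  refine ⟨ch_leftRegular, fun n => (hT0 n).trans (ch_leftRegular n).symm, hL0,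
    (tL.out 0 1).1 hL0, (tL.out 0 2).1 hL0, (tL.out 0 3).1 hL0, hT0,
    (tT.out 0 1).1 hT0, (tT.out 0 2).1 hT0, (tT.out 0 3).1 hT0, (tT.out 0 4).1 hT0,
    (tT.out 0 5).1 hT0, (tT.out 0 6).1 hT0, (tT.out 0 7).1 hT0, (tT.out 0 8).1 hT0,
    (tT.out 0 9).1 hT0, (tT.out 0 10).1 hT0, (tT.out 0 11).1 hT0, (tT.out 0 12).1 hT0,
    (tT.out 0 13).1 hT0, fun F hF h1 => ?_⟩
  have hG : IsGraded F := fun n hn =>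
    let h := hF n (Nat.one_le_iff_ne_zero.2 hn)
    ⟨h.1, isHomog_of_isHomogeneous h.2⟩
  exact ⟨tfae_hSeries hG h1, tfae_eSeries hG h1⟩
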